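/- Let $\iota:\mathbb S^1\hookrightarrow\mathbb S^2$ be the equator of the unit sphere, $\mathcal P$ the set of smooth embeddings $F:\mathbb S^2\to\mathbb R^3$ (so $T_F\mathcal P=C^\infty(\mathbb S^2,\mathbb R^3)$), and $G$ the group of diffeomorphisms $\gamma$ of $\mathbb S^2$ with $\gamma\circ\iota=\iota\circ\bar\gamma$ for some diffeomorphism $\bar\gamma$ of $\mathbb S^1$, acting by $F\mapsto F\circ\gamma$. The shape space of embedded surfaces decorated with curves is $\mathcal F=\mathcal P/G$; the class of $F$ is the flag $(C,\Sigma)=(F(\iota(\mathbb S^1)),F(\mathbb S^2))$, and its tangent space is $T_F\mathcal P/\mathrm{Ver}_F$, where $\mathrm{Ver}_F$ is the tangent space to the $G$-orbit of $F$. Let $\nu$ be the unit normal of $\Sigma$, $t$ the unit tangent of $C$, $n=\nu\times t$, with the orientations induced by $F$; let $\kappa_g=\langle D_st,n\rangle$, $\kappa_n=\langle D_st,\nu\rangle$, $\tau_g=\langle D_sn,\nu\rangle$, where $D_s$ is the arc-length derivative along $C$, and let $\kappa_1,\kappa_2$ be the principal curvatures of $\Sigma$. For $X\in T_F\mathcal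 P$ put $h_1=\langle X,n\rangle\in C^\infty(C)$ and $h_2=\langle X,\nu\rangle\in C^\infty(\Sigma)$ (transported by $F$). For a curve $f$ with speed $r$ and unit tangent $t$, and a surface $F$ with induced metric $g$ and unit normal $\nu$, consider the elastic metrics $$E'_f(\delta f)=a\int(\delta r/r)^2\,d\ell+b\int|\delta t|^2\,d\ell,$$ $$E''_F(\delta F)=a'\int\operatorname{Tr}\big(((g^{-1}\delta g)_{\mathbf 0})^2\big)\,dA+b'\int(\operatorname{Tr}(g^{-1}\delta g))^2\,dA+c'\int|\delta\nu|^2\,dA,$$ where $\delta$ denotes the first variation and $B_{\mathbf 0}=B-\tfrac12\operatorname{Tr}(B)I$. Make them gauge invariant by replacing $\delta f$ and $\delta F$ by their components normal to the curve, respectively to the surface, pull back their sum along $F\mapsto(F\circ\iota,F)$, and replace $b|\delta t|^2$ by $b_1\langle\delta t,n\rangle^2+c_1\langle\delta t,\nu\rangle^2$. Then, for all real $a_1,a_2,b_1,b_2,c_1,c_2$ and with $a=a_1$, $a'=a_2/2$, $b'=b_2/4$, $c'=c_2$, the result is the quadratic form of a symmetric bilinear form on $T_F\mathcal P/\mathrm{Ver}_F$,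 for every $F\in\mathcal P$. It is $G$-invariant and depends smoothly on $F$ (along smooth paths in $T\mathcal P$), so that it defines a 6-parameter family of symmetric 2-tensors on $\mathcal F$. If $b_1=c_1=b$, it is the unsplit pull-back. Every pair $(h_1,h_2)\in C^\infty(C)\times C^\infty(\Sigma)$ arises from some $X$, and $$\begin{aligned}\mathcal G_{(C,\Sigma)}(h_1,h_2)={}&a_1\int_C(h_1\kappa_g+h_2|_C\kappa_n)^2d\ell+a_2\int_\Sigma h_2^2(\kappa_1-\kappa_2)^2dA\\&+b_1\int_C(D_sh_1-h_2|_C\tau_g)^2d\ell+b_2\int_\Sigma h_2^2(\kappa_1+\kappa_2)^2dA\\&+c_1\int_C(D_s(h_2|_C)+h_1\tau_g)^2d\ell+c_2\int_\Sigma|\nabla h_2|^2dA.\end{aligned}$$ If all six parameters are positive, then $\mathcal G_{(C,\Sigma)}$ is positive semidefinite, and it is positive definite (a Riemannian metric) at every flag for which $n$ is not constant along $C$. At the exceptional flags for which $n$ is constant along $C$ (for instance, the equator of a round sphere) its null space consists exactly of the pairs $(h_1,h_2)$ with $h_1$ constant and $h_2=0$. -/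

import Mathlib

open scoped Manifold ContDiff RealInnerProductSpace

noncomputable section

namespace FlagShape

/-! ### The reference flag -/

/-- Euclidean three-space. -/
abbrev E3 : Type := EuclideanSpace ℝ (Fin 3)

/-- The unit sphere, the reference surface. The reference curve is `Circle`. -/
abbrev S2 : Type := Metric.sphere (0 : E3) 1

/-- The equator `ι : 𝕊¹ ↪ 𝕊²`. -/
def equator (z : Circle) : S2 :=
  ⟨!₂[(z : ℂ).re, (z : ℂ).im, 0], by
    have h : (z : ℂ).re * (z : ℂ).re + (z : ℂ).im * (z : ℂ).im = 1 := by
      have := Circle.normSq_coe z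
      rwa [Complex.normSq_apply] at this
    simp [EuclideanSpace.norm_eq, Fin.sum_univ_three]
    nlinarith [h]⟩

/-- The cross product of `ℝ³`. -/
def cross (a b : E3) : E3 := WithLp.toLp 2 (crossProduct a.ofLp b.ofLp)

/-! ### Parameterized flags, tangent vectors, reparametrizations -/

/-- The space `C^∞(𝕊², ℝ³)`; it is the tangent space to the space of parameterized flags at each
of its points. -/
abbrev Field : Type := ContMDiffMap (𝓡 2) 𝓘(ℝ, E3) S2 E3 ∞

/-- The pre-shape space: smooth embeddings `𝕊² → ℝ³`. -/
structure PreShape where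
  toField : Field
  isEmbedding : Topology.IsEmbedding (toField : S2 → E3)
  immersion : ∀ p : S2, Function.Injective (mfderiv (𝓡 2) 𝓘(ℝ, E3) (toField : S2 → E3) p)

instance : CoeFun PreShape (fun _ => S2 → E3) := ⟨fun F => F.toField⟩

/-- Diffeomorphisms of the sphere. -/
abbrev DiffS2 : Type := Diffeomorph (𝓡 2) (𝓡 2) S2 S2 ∞

/-- `γ` belongs to the reparametrization group `G`: it restricts to a diffeomorphism of the
equator. -/
def IsReparam (γ : DiffS2) : Prop :=
  ∃ γ' : Diffeomorph (𝓡 1) (𝓡 1) Circle Circle ∞, ∀ z, γ (equator z) = equator (γ' z)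

/-- The action `X ↦ X ∘ γ` on tangent vectors. -/
def reparamField (X : Field) (γ : DiffS2) : Field := X.comp γ.toContMDiffMap

/-- The action `F ↦ F ∘ γ` on parameterized flags. -/
def PreShape.reparam (F : PreShape) (γ : DiffS2) : PreShape where
  toField := reparamField F.toField γ
  isEmbedding := F.isEmbedding.comp γ.toHomeomorph.isEmbedding
  immersion := by
    intro p
    have hF : MDifferentiableAt (𝓡 2) 𝓘(ℝ, E3) (F.toField : S2 → E3) (γ p) :=
      (F.toField.contMDiff (γ p)).mdifferentiableAt (by simp)
    have hγ : MDifferentiableAt (𝓡 2) (𝓡 2) γ p := (γ.contMDiff p).mdifferentiableAt (by simp)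
    have hc : mfderiv (𝓡 2) 𝓘(ℝ, E3) ((F.toField : S2 → E3) ∘ γ) p =
        (mfderiv (𝓡 2) 𝓘(ℝ, E3) (F.toField : S2 → E3) (γ p)).comp
          (mfderiv (𝓡 2) (𝓡 2) γ p) := mfderiv_comp p hF hγ
    have hinj : Function.Injective (mfderiv (𝓡 2) (𝓡 2) γ p) := by
      rw [← γ.mfderivToContinuousLinearEquiv_coe (by simp)]
      exact (γ.mfderivToContinuousLinearEquiv (by simp) p).injective
    change Function.Injective (mfderiv (𝓡 2) 𝓘(ℝ, E3) ((F.toField : S2 → E3) ∘ γ) p)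
    rw [hc]
    exact (F.immersion (γ p)).comp hinj

/-! ### Differentiation on the sphere -/

/-- The radial projection `x ↦ x / ‖x‖` onto the sphere (with an arbitrary value at `0`). -/
def radial (x : E3) : S2 :=
  if h : x = 0 then equator 1 else ⟨‖x‖⁻¹ • x, by
    simp [norm_smul, inv_mul_cancel₀ (norm_ne_zero_iff.mpr h)]⟩

/-- The differential at `p` of a map `φ` on the sphere, as a linear map on `ℝ³`: on the tangent
plane `p^⊥` of the sphere it is the usual differential, and it vanishes on the normal line. -/
def D {V : Type*} [NormedAddCommGroup V] [NormedSpace ℝ V] (φ : S2 → V) (p : S2) : E3 →L[ℝ] V :=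
  fderiv ℝ (fun x => φ (radial x)) (p : E3)

/-- An orthonormal basis of the tangent plane `p^⊥` of the sphere at `p`. -/
def frame (p : S2) (i : Fin 2) : E3 :=
  haveI : Fact (Module.finrank ℝ E3 = 2 + 1) := ⟨by simp⟩
  (OrthonormalBasis.fromOrthogonalSpanSingleton (𝕜 := ℝ) 2
    (ne_zero_of_mem_unit_sphere p) i : (ℝ ∙ (p : E3))ᗮ)

/-! ### Vertical vectors and the normal bundle -/

/-- The Lie algebra of `G`: tangent vector fields of the sphere that are tangent to the equator
along the equator. -/
def gaugeAlgebra : Submodule ℝ Field where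
  carrier := {ξ | (∀ p : S2, ⟪ξ p, (p : E3)⟫ = 0) ∧ ∀ z : Circle, (ξ (equator z)) 2 = 0}
  add_mem' := by
    rintro a b ⟨h1, h2⟩ ⟨h3, h4⟩
    exact ⟨fun p => by simp [inner_add_left, h1, h3], fun z => by simp [h2, h4]⟩
  zero_mem' := ⟨fun p => by simp, fun z => by simp⟩
  smul_mem' := by
    rintro c a ⟨h1, h2⟩
    exact ⟨fun p => by simp [inner_smul_left, h1], fun z => by simp [h2]⟩

/-- The vertical space at `F`: the tangent space `{dF ∘ ξ}` to the `G`-orbit of `F`. -/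
def Ver (F : PreShape) : Submodule ℝ Field where
  carrier := {X | ∃ ξ ∈ gaugeAlgebra, ∀ p, X p = D F p (ξ p)}
  add_mem' := by
    rintro a b ⟨ξ, h1, h2⟩ ⟨η, h3, h4⟩
    exact ⟨ξ + η, add_mem h1 h3, fun p => by simp [h2, h4]⟩
  zero_mem' := ⟨0, zero_mem _, fun p => by simp⟩
  smul_mem' := by
    rintro c a ⟨ξ, h1, h2⟩
    exact ⟨c • ξ, Submodule.smul_mem _ c h1, fun p => by simp [h2]⟩

/-- The fibre `T_F 𝒫 / Ver_F` of the normal bundle, that is, the tangent space to the shape space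
at the flag parameterized by `F`. -/
abbrev Nor (F : PreShape) : Type := Field ⧸ Ver F

/-- The class in `Nor F` of a tangent vector. -/
abbrev Nor.mk (F : PreShape) (X : Field) : Nor F := (Ver F).mkQ X

/-! ### Parameterized curves -/

section Curve

variable {V : Type*} [NormedAddCommGroup V] [NormedSpace ℝ V]

/-- The derivative with respect to the angle of a map on the circle. -/
def dot (f : Circle → V) (z : Circle) : V := deriv (fun s : ℝ => f (z * Circle.exp s)) 0

/-- The speed `r` of a curve. -/
def speed (f : Circle → E3) (z : Circle) : ℝ := ‖dot f z‖

/-- The unit tangent `t` of a curve. -/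
def tangent (f : Circle → E3) (z : Circle) : E3 := (speed f z)⁻¹ • dot f z

/-- The arc-length derivative `D_s` along the curve `f`. -/
def Ds (f : Circle → E3) (h : Circle → V) (z : Circle) : V := (speed f z)⁻¹ • dot h z

/-- The arc-length integral `∫ φ dℓ` along the curve `f`. -/
def lineIntegral (f : Circle → E3) (φ : Circle → ℝ) : ℝ :=
  ∫ θ in (0 : ℝ)..(2 * Real.pi), φ (Circle.exp θ) * speed f (Circle.exp θ)

/-- The variation `δr` of the speed under `δf`. -/
def speedVar (f δf : Circle → E3) (z : Circle) : ℝ := deriv (fun ε : ℝ => speed (f + ε • δf) z) 0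

/-- The variation `δt` of the unit tangent under `δf`. -/
def tangentVar (f δf : Circle → E3) (z : Circle) : E3 :=
  deriv (fun ε : ℝ => tangent (f + ε • δf) z) 0

/-- The elastic metric (squared norm of `δf`) on parameterized curves. -/
def curveElastic (a b : ℝ) (f δf : Circle → E3) : ℝ :=
  a * lineIntegral f (fun z => (speedVar f δf z / speed f z) ^ 2) +
  b * lineIntegral f (fun z => ‖tangentVar f δf z‖ ^ 2)

/-- The component of a variation of a curve that is normal to the curve. -/
def curveNormalPart (f δf : Circle → E3) (z : Circle) : E3 :=
  δf z - ⟪δf z, tangent f z⟫ • tangent f z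

end Curve

/-! ### Parameterized surfaces -/

/-- The normal vector `F_u × F_v`, for a positively oriented orthonormal basis `(u, v)` of the
tangent plane of the (outward oriented) sphere; the first factor is the sign of the basis. -/
def normalVec (F : S2 → E3) (p : S2) : E3 :=
  ⟪(p : E3), cross (frame p 0) (frame p 1)⟫ •
    cross (D F p (frame p 0)) (D F p (frame p 1))

/-- The unit normal `ν`. -/
def unitNormal (F : S2 → E3) (p : S2) : E3 := ‖normalVec F p‖⁻¹ • normalVec F p

/-- The matrix of the induced metric `g = F^* ⟨·,·⟩`. -/
def gram (F : S2 → E3) (p : S2) : Matrix (Fin 2) (Fin 2) ℝ :=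
  Matrix.of fun i j => ⟪D F p (frame p i), D F p (frame p j)⟫

/-- The area integral `∫ φ dA` for the induced metric: `dA = √(det g) dσ`, with `σ` the standard
area measure of the unit sphere. -/
def areaIntegral (F : S2 → E3) (φ : S2 → ℝ) : ℝ :=
  ∫ p, φ p * √(gram F p).det ∂((MeasureTheory.volume : MeasureTheory.Measure E3).toSphere)

/-- The matrix of the variation `δg` of the induced metric under `δF`. -/
def gramVar (F δF : S2 → E3) (p : S2) : Matrix (Fin 2) (Fin 2) ℝ :=
  Matrix.of fun i j => deriv (fun ε : ℝ => gram (F + ε • δF) p i j) 0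

/-- The variation `δν` of the unit normal under `δF`. -/
def normalVar (F δF : S2 → E3) (p : S2) : E3 :=
  deriv (fun ε : ℝ => unitNormal (F + ε • δF) p) 0

/-- The traceless part of a `2 × 2` matrix. -/
def traceless (B : Matrix (Fin 2) (Fin 2) ℝ) : Matrix (Fin 2) (Fin 2) ℝ :=
  B - (B.trace / 2) • (1 : Matrix (Fin 2) (Fin 2) ℝ)

/-- The elastic metric (squared norm of `δF`) on parameterized surfaces. -/
def surfElastic (a b c : ℝ) (F δF : S2 → E3) : ℝ :=
  a * areaIntegral F (fun p => (traceless ((gram F p)⁻¹ * gramVar F δF p) ^ 2).trace) +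
  b * areaIntegral F (fun p => ((gram F p)⁻¹ * gramVar F δF p).trace ^ 2) +
  c * areaIntegral F (fun p => ‖normalVar F δF p‖ ^ 2)

/-- The component of a variation of a surface that is normal to the surface. -/
def surfNormalPart (F δF : S2 → E3) (p : S2) : E3 :=
  ⟪δF p, unitNormal F p⟫ • unitNormal F p

/-- The matrix of the shape operator `L = g⁻¹ II`, with `II(u, v) = -⟨dν u, dF v⟩`. -/
def shapeOp (F : S2 → E3) (p : S2) : Matrix (Fin 2) (Fin 2) ℝ :=
  (gram F p)⁻¹ * Matrix.of fun i j => -⟪D (unitNormal F) p (frame p i), D F p (frame p j)⟫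

/-- The larger principal curvature: the largest eigenvalue of the shape operator. -/
def kappa1 (F : S2 → E3) (p : S2) : ℝ := sSup (spectrum ℝ (shapeOp F p))

/-- The smaller principal curvature: the smallest eigenvalue of the shape operator. -/
def kappa2 (F : S2 → E3) (p : S2) : ℝ := sInf (spectrum ℝ (shapeOp F p))

/-- The components of the gradient `∇h = g⁻¹ dh` for the induced metric. -/
def grad (F : S2 → E3) (h : S2 → ℝ) (p : S2) : Fin 2 → ℝ :=
  (gram F p)⁻¹.mulVec fun i => D h p (frame p i)

/-- `|∇h|²`, the norm being that of the induced metric. -/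
def gradNormSq (F : S2 → E3) (h : S2 → ℝ) (p : S2) : ℝ :=
  grad F h p ⬝ᵥ (gram F p).mulVec (grad F h p)

/-! ### The curve on the surface -/

/-- The parameterized curve `F ∘ ι`. -/
def curve (F : S2 → E3) (z : Circle) : E3 := F (equator z)

/-- The vector `t` of the Darboux frame. -/
def darbouxT (F : S2 → E3) (z : Circle) : E3 := tangent (curve F) z

/-- The vector `ν` of the Darboux frame. -/
def darbouxNu (F : S2 → E3) (z : Circle) : E3 := unitNormal F (equator z)

/-- The vector `n = ν × t` of the Darboux frame. -/
def darbouxN (F : S2 → E3) (z : Circle) : E3 := cross (darbouxNu F z) (darbouxT F z)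

/-- Geodesic curvature. -/
def kappaG (F : S2 → E3) (z : Circle) : ℝ := ⟪Ds (curve F) (darbouxT F) z, darbouxN F z⟫

/-- Normal curvature. -/
def kappaN (F : S2 → E3) (z : Circle) : ℝ := ⟪Ds (curve F) (darbouxT F) z, darbouxNu F z⟫

/-- Geodesic torsion. -/
def tauG (F : S2 → E3) (z : Circle) : ℝ := ⟪Ds (curve F) (darbouxN F) z, darbouxNu F z⟫

/-- The elastic metric for the curve `F ∘ ι`, with the term in `|δt|²` split into its `n`- and
`ν`-components. -/
def splitCurveElastic (a b c : ℝ) (F : S2 → E3) (δf : Circle → E3) : ℝ :=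
  a * lineIntegral (curve F) (fun z => (speedVar (curve F) δf z / speed (curve F) z) ^ 2) +
  b * lineIntegral (curve F) (fun z => ⟪tangentVar (curve F) δf z, darbouxN F z⟫ ^ 2) +
  c * lineIntegral (curve F) (fun z => ⟪tangentVar (curve F) δf z, darbouxNu F z⟫ ^ 2)

/-! ### The metrics on flags -/

/-- The pull-back along `F ↦ (F ∘ ι, F)` of the sum of the gauge invariant elastic metrics (elastic
metrics of the normal components of the variations) for curves and for surfaces. -/
def pullbackElastic (a b a' b' c' : ℝ) (F X : S2 → E3) : ℝ :=
  curveElastic a b (curve F) (curveNormalPart (curve F) (curve X)) +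
  surfElastic a' b' c' F (surfNormalPart F X)

/-- The same with the `b`-term for the curve split into two terms. -/
def splitPullbackElastic (a b c a' b' c' : ℝ) (F X : S2 → E3) : ℝ :=
  splitCurveElastic a b c F (curveNormalPart (curve F) (curve X)) +
  surfElastic a' b' c' F (surfNormalPart F X)

/-- The function `h₁ = ⟨X, n⟩` on the curve. -/
def h1 (F X : S2 → E3) (z : Circle) : ℝ := ⟪X (equator z), darbouxN F z⟫

/-- The function `h₂ = ⟨X, ν⟩` on the surface. -/
def h2 (F X : S2 → E3) (p : S2) : ℝ := ⟪X p, unitNormal F p⟫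

/-- The geometric expression in `(h₁, h₂)`, functions on the curve and on the surface being
transported to the circle and to the sphere by the parameterization. -/
def geometricForm (a₁ a₂ b₁ b₂ c₁ c₂ : ℝ) (F : S2 → E3) (u : Circle → ℝ) (v : S2 → ℝ) : ℝ :=
  a₁ * lineIntegral (curve F)
    (fun z => (u z * kappaG F z + v (equator z) * kappaN F z) ^ 2) +
  a₂ * areaIntegral F (fun p => v p ^ 2 * (kappa1 F p - kappa2 F p) ^ 2) +
  b₁ * lineIntegral (curve F)
    (fun z => (Ds (curve F) u z - v (equator z) * tauG F z) ^ 2) +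
  b₂ * areaIntegral F (fun p => v p ^ 2 * (kappa1 F p + kappa2 F p) ^ 2) +
  c₁ * lineIntegral (curve F)
    (fun z => (Ds (curve F) (fun w => v (equator w)) z + u z * tauG F z) ^ 2) +
  c₂ * areaIntegral F (fun p => gradNormSq F v p)

end FlagShape

end

/-!
The unit normal splits every variation `X` of `F` into the two functions `h₁`, `h₂` and a tangential
remainder; the form `norForm` is obtained by polarizing the geometric expression in `(h₁, h₂)`.

*Elastic energies.* A normal variation `h ν` of the surface changes the metric by `-2 h` times the
second fundamental form, so `g⁻¹ δg = -2 h L` with `L` the shape operator, and changes the unit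
normal by `-∇h`. The traces of `L` and of `(L₀)²`, with `L₀` the traceless part of `L`, are
`κ₁ + κ₂` and `(κ₁ - κ₂)² / 2` (`Immersed.surfElastic_eq`). For a curve `δr / r` is the
`t`-component of `D_s (δf)`, and `δt` consists of the other two components; for
`δf = h₁ n + h₂ ν` the Darboux equations express these by `κ_g`, `κ_n` and `τ_g`
(`Immersed.splitCurveElastic_eq`).

*Normal bundle.* A variation is vertical exactly if `h₁ = 0` and `h₂ = 0` (`norMk_eq_zero_iff`):
such an `X` is tangential, hence `dF ∘ ξ` for a unique tangent field `ξ`, which is tangent to the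
equator since `X` is tangent to the curve. Every pair of functions occurs, because a function on the
equator extends to the sphere (`Immersed.exists_field`).

*Smoothness.* The frame of the tangent plane that occurs in the definitions is not continuous. All
quantities reduce to alternating expressions in such a frame, which `wedge` rewrites without it.
Maps on the sphere are extended to `ℝ³ ∖ 0` as constants along rays, where smoothness is an ordinary
`ContDiffOn` condition (`SmoothFam`), closed under differentiation. Integrals depend smoothly on
parameters by differentiation under the integral sign.

*Invariance.* Under `F ↦ F ∘ γ` the normal vector is multiplied by the Jacobian determinant of `γ`,
whose sign is constant, and the derivative along the curve by the angular speed of `γ` on the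
equator, whose sign is constant as well. So each integrand, before squaring, is composed with `γ`
and at most changes its sign. The integrals are compared by changes of variables: on the sphere for
the extension of `γ` that is homogeneous of degree one (`integral_comp_mul_abs_jac`), on the circle
for a lift to angles (`integral_comp_circle`).

*Null space.* If all six terms vanish, then `∇h₂ = 0`, so `h₂` is constant. Were it not `0`, both
principal curvatures would vanish, and `ν` would be constant; but the height function of the compact
surface in a direction orthogonal to `ν` has a maximum, where `ν` is parallel to that direction.
So `h₂ = 0`, and the remaining terms give `D_s h₁ = 0` and `h₁ κ_g = h₁ τ_g = 0`. Thus `h₁` is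
constant, and if it is not `0`, then `D_s n = -κ_g t + τ_g ν` vanishes, so that `n` is constant
(`geometricForm_eq_zero_iff`).
-/

noncomputable section

namespace FlagShape

/-! ### Vector algebra in three-space -/

lemma inner_eq_sum (a b : E3) : ⟪a, b⟫ = a 0 * b 0 + a 1 * b 1 + a 2 * b 2 := by
  simp [PiLp.inner_apply, Fin.sum_univ_three, mul_comm]

@[simp] lemma cross_apply_zero (a b : E3) : cross a b 0 = a 1 * b 2 - a 2 * b 1 := by
  simp [cross, cross_apply]

@[simp] lemma cross_apply_one (a b : E3) : cross a b 1 = a 2 * b 0 - a 0 * b 2 := by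
  simp [cross, cross_apply]

@[simp] lemma cross_apply_two (a b : E3) : cross a b 2 = a 0 * b 1 - a 1 * b 0 := by
  simp [cross, cross_apply]

lemma ext_three {a b : E3} (h0 : a 0 = b 0) (h1 : a 1 = b 1) (h2 : a 2 = b 2) : a = b := by
  ext i; fin_cases i <;> assumption

/-- The cross product as a continuous bilinear map. -/
def crossL : E3 →L[ℝ] E3 →L[ℝ] E3 :=
  LinearMap.toContinuousLinearMap
    ((LinearMap.toContinuousLinearMap : (E3 →ₗ[ℝ] E3) ≃ₗ[ℝ] (E3 →L[ℝ] E3)).toLinearMap ∘ₗ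
      LinearMap.mk₂ ℝ cross
        (by intro a b c; apply ext_three <;> simp <;> ring)
        (by intro r a b; apply ext_three <;> simp <;> ring)
        (by intro a b c; apply ext_three <;> simp <;> ring)
        (by intro r a b; apply ext_three <;> simp <;> ring))

@[simp] lemma crossL_apply (a b : E3) : crossL a b = cross a b := rfl

lemma cross_add_left (a b c : E3) : cross (a + b) c = cross a c + cross b c := by
  apply ext_three <;> simp <;> ring

lemma cross_smul_left (r : ℝ) (a b : E3) : cross (r • a) b = r • cross a b := by
  apply ext_three <;> simp <;> ring

lemma cross_smul_right (r : ℝ) (a b : E3) : cross a (r • b) = r • cross a b := by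
  apply ext_three <;> simp <;> ring

lemma cross_anti (a b : E3) : cross b a = -cross a b := by
  apply ext_three <;> simp <;> ring

@[simp] lemma inner_cross_left (a b : E3) : ⟪a, cross a b⟫ = 0 := by
  simp [inner_eq_sum]; ring

@[simp] lemma inner_cross_right (a b : E3) : ⟪b, cross a b⟫ = 0 := by
  simp [inner_eq_sum]; ring

@[simp] lemma inner_cross_left' (a b : E3) : ⟪cross a b, a⟫ = 0 := by
  rw [real_inner_comm, inner_cross_left]

@[simp] lemma inner_cross_right' (a b : E3) : ⟪cross a b, b⟫ = 0 := by
  rw [real_inner_comm, inner_cross_right]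

lemma cross_cross_eq (x a b : E3) : cross x (cross a b) = ⟪x, b⟫ • a - ⟪x, a⟫ • b := by
  apply ext_three <;> simp [inner_eq_sum] <;> ring

lemma inner_cross_cross (a b c d : E3) :
    ⟪cross a b, cross c d⟫ = ⟪a, c⟫ * ⟪b, d⟫ - ⟪a, d⟫ * ⟪b, c⟫ := by
  simp [inner_eq_sum]; ring

lemma norm_cross_sq (a b : E3) : ‖cross a b‖ ^ 2 = ‖a‖ ^ 2 * ‖b‖ ^ 2 - ⟪a, b⟫ ^ 2 := by
  rw [← real_inner_self_eq_norm_sq, inner_cross_cross, real_inner_self_eq_norm_sq,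
    real_inner_self_eq_norm_sq, real_inner_comm b a]; ring

/-- The expansion of a vector in the orthonormal basis `(u, v, u × v)`. -/
lemma eq_smul_cross {u v : E3} (hu : ‖u‖ = 1) (hv : ‖v‖ = 1) (huv : ⟪u, v⟫ = 0) (x : E3) :
    x = ⟪x, u⟫ • u + ⟪x, v⟫ • v + ⟪x, cross u v⟫ • cross u v := by
  have hu2 : ⟪u, u⟫ = 1 := by rw [real_inner_self_eq_norm_sq, hu, one_pow]
  have hv2 : ⟪v, v⟫ = 1 := by rw [real_inner_self_eq_norm_sq, hv, one_pow]
  have hw2 : ⟪cross u v, cross u v⟫ = 1 := by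
    rw [inner_cross_cross, hu2, hv2, huv]; simp
  have hgram : ∀ y : E3, ‖y‖ ^ 2 = ⟪y, u⟫ ^ 2 + ⟪y, v⟫ ^ 2 + ⟪y, cross u v⟫ ^ 2 := by
    intro y
    have h1 : u 0 ^ 2 + u 1 ^ 2 + u 2 ^ 2 = 1 := by rw [← hu2, inner_eq_sum]; ring
    have h2 : v 0 ^ 2 + v 1 ^ 2 + v 2 ^ 2 = 1 := by rw [← hv2, inner_eq_sum]; ring
    have h3 : u 0 * v 0 + u 1 * v 1 + u 2 * v 2 = 0 := by rw [← huv, inner_eq_sum]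
    -- the squared norm of `cross u v × y`, computed in two ways
    have h4 : ‖cross (cross u v) y‖ ^ 2 = ⟪y, u⟫ ^ 2 + ⟪y, v⟫ ^ 2 := by
      have : cross (cross u v) y = ⟪y, u⟫ • v - ⟪y, v⟫ • u := by
        apply ext_three <;> simp [inner_eq_sum] <;> ring
      rw [this, ← real_inner_self_eq_norm_sq]
      simp only [inner_sub_left, inner_sub_right, inner_smul_left, inner_smul_right, hu2, hv2, huv,
        real_inner_comm u v]
      simp; ring
    rw [norm_cross_sq, ← real_inner_self_eq_norm_sq (cross u v), hw2,
      real_inner_comm] at h4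
    linarith
  have key : ‖x - (⟪x, u⟫ • u + ⟪x, v⟫ • v + ⟪x, cross u v⟫ • cross u v)‖ ^ 2 = 0 := by
    have e1 : ⟪cross u v, u⟫ = 0 := by rw [real_inner_comm, inner_cross_left]
    have e2 : ⟪cross u v, v⟫ = 0 := by rw [real_inner_comm, inner_cross_right]
    have e3 : ⟪v, u⟫ = 0 := by rw [real_inner_comm, huv]
    rw [hgram]
    simp only [inner_sub_left, inner_add_left, inner_smul_left, hu2, hv2, hw2, e1, e2, e3, huv,
      inner_cross_left, inner_cross_right]
    simp
  rw [← sub_eq_zero]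
  exact norm_eq_zero.1 (pow_eq_zero_iff (two_ne_zero) |>.1 key)

lemma cross_eq_smul {p u v : E3} (hp : ‖p‖ = 1) (hu : ‖u‖ = 1) (hv : ‖v‖ = 1) (huv : ⟪u, v⟫ = 0)
    (hpu : ⟪p, u⟫ = 0) (hpv : ⟪p, v⟫ = 0) :
    ⟪p, cross u v⟫ ^ 2 = 1 ∧ p = ⟪p, cross u v⟫ • cross u v := by
  have h := eq_smul_cross hu hv huv p
  rw [hpu, hpv, zero_smul, zero_smul, zero_add, zero_add] at h
  refine ⟨?_, h⟩
  have h2 : ‖cross u v‖ ^ 2 = 1 := by rw [norm_cross_sq, hu, hv, huv]; norm_num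
  have h3 : ‖p‖ ^ 2 = ‖⟪p, cross u v⟫ • cross u v‖ ^ 2 := by rw [← h]
  rw [norm_smul, mul_pow, h2, hp, Real.norm_eq_abs, sq_abs] at h3
  linarith

/-! ### Alternating expressions on the tangent planes of the sphere -/

section Wedge

variable {V₁ V₂ V : Type*} [NormedAddCommGroup V₁] [NormedSpace ℝ V₁] [NormedAddCommGroup V₂]
  [NormedSpace ℝ V₂] [NormedAddCommGroup V] [NormedSpace ℝ V]

/-- The standard basis vectors of three-space. -/
def stdVec (i : Fin 3) : E3 := EuclideanSpace.single i 1

lemma eq_sum_stdVec (x : E3) : x = x 0 • stdVec 0 + x 1 • stdVec 1 + x 2 • stdVec 2 := by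
  apply ext_three <;> simp [stdVec]

/-- The value `β(Au, Bv) - β(Av, Bu)` for a positively oriented orthonormal basis `(u, v)` of the
plane `p^⊥`, written without reference to such a basis. It is polynomial in `A`, `B` and `p`. -/
def wedge (β : V₁ →L[ℝ] V₂ →L[ℝ] V) (A : E3 →L[ℝ] V₁) (B : E3 →L[ℝ] V₂) (p : E3) : V :=
  p 0 • (β (A (stdVec 1)) (B (stdVec 2)) - β (A (stdVec 2)) (B (stdVec 1))) +
  p 1 • (β (A (stdVec 2)) (B (stdVec 0)) - β (A (stdVec 0)) (B (stdVec 2))) +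
  p 2 • (β (A (stdVec 0)) (B (stdVec 1)) - β (A (stdVec 1)) (B (stdVec 0)))

lemma wedge_cross (β : V₁ →L[ℝ] V₂ →L[ℝ] V) (A : E3 →L[ℝ] V₁) (B : E3 →L[ℝ] V₂) (u v : E3) :
    wedge β A B (cross u v) = β (A u) (B v) - β (A v) (B u) := by
  conv_rhs => rw [eq_sum_stdVec u, eq_sum_stdVec v]
  simp only [wedge, cross_apply_zero, cross_apply_one, cross_apply_two, map_add, map_smul,
    add_apply, smul_apply]
  module

lemma wedge_smul (β : V₁ →L[ℝ] V₂ →L[ℝ] V) (A : E3 →L[ℝ] V₁) (B : E3 →L[ℝ] V₂) (r : ℝ) (p : E3) :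
    wedge β A B (r • p) = r • wedge β A B p := by
  simp only [wedge, PiLp.smul_apply, smul_eq_mul]
  module

lemma wedge_eq {p u v : E3} (hp : ‖p‖ = 1) (hu : ‖u‖ = 1) (hv : ‖v‖ = 1) (huv : ⟪u, v⟫ = 0)
    (hpu : ⟪p, u⟫ = 0) (hpv : ⟪p, v⟫ = 0) (β : V₁ →L[ℝ] V₂ →L[ℝ] V) (A : E3 →L[ℝ] V₁)
    (B : E3 →L[ℝ] V₂) :
    wedge β A B p = ⟪p, cross u v⟫ • (β (A u) (B v) - β (A v) (B u)) := by
  conv_lhs => rw [(cross_eq_smul hp hu hv huv hpu hpv).2]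
  rw [wedge_smul, wedge_cross]

end Wedge

/-! ### The frame of the tangent plane -/

lemma norm_coe (p : S2) : ‖(p : E3)‖ = 1 := by simp

lemma coe_ne_zero (p : S2) : (p : E3) ≠ 0 := ne_zero_of_mem_unit_sphere p

lemma frame_norm (p : S2) (i : Fin 2) : ‖frame p i‖ = 1 := by
  have : Fact (Module.finrank ℝ E3 = 2 + 1) := ⟨by simp⟩
  have := (OrthonormalBasis.fromOrthogonalSpanSingleton (𝕜 := ℝ) 2
    (ne_zero_of_mem_unit_sphere p)).orthonormal.1 i
  exact this

lemma frame_orthogonal (p : S2) : ⟪frame p 0, frame p 1⟫ = 0 := by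
  have : Fact (Module.finrank ℝ E3 = 2 + 1) := ⟨by simp⟩
  have := (OrthonormalBasis.fromOrthogonalSpanSingleton (𝕜 := ℝ) 2
    (ne_zero_of_mem_unit_sphere p)).orthonormal.2 (i := 0) (j := 1) (by decide)
  exact this

lemma inner_frame (p : S2) (i : Fin 2) : ⟪(p : E3), frame p i⟫ = 0 :=
  Submodule.mem_orthogonal_singleton_iff_inner_right.1 (Subtype.prop _)

/-- The orientation sign `⟨p, u × v⟩` of the frame `(u, v)`. -/
def sgn (p : S2) : ℝ := ⟪(p : E3), cross (frame p 0) (frame p 1)⟫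

lemma sgn_sq (p : S2) : sgn p ^ 2 = 1 :=
  (cross_eq_smul (norm_coe p) (frame_norm p 0) (frame_norm p 1) (frame_orthogonal p)
    (inner_frame p 0) (inner_frame p 1)).1

lemma coe_eq_sgn_smul (p : S2) : (p : E3) = sgn p • cross (frame p 0) (frame p 1) :=
  (cross_eq_smul (norm_coe p) (frame_norm p 0) (frame_norm p 1) (frame_orthogonal p)
    (inner_frame p 0) (inner_frame p 1)).2

lemma eq_frame (p : S2) (x : E3) :
    x = ⟪x, frame p 0⟫ • frame p 0 + ⟪x, frame p 1⟫ • frame p 1 + ⟪x, (p : E3)⟫ • (p : E3) := by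
  conv_lhs => rw [eq_smul_cross (frame_norm p 0) (frame_norm p 1) (frame_orthogonal p) x]
  have h := sgn_sq p
  have e : ⟪x, (p : E3)⟫ • (p : E3) =
      ⟪x, sgn p • cross (frame p 0) (frame p 1)⟫ • (sgn p • cross (frame p 0) (frame p 1)) := by
    rw [← coe_eq_sgn_smul p]
  rw [e, inner_smul_right, smul_smul, mul_right_comm, ← sq, h, one_mul]

section WedgeFrame

variable {V₁ V₂ V : Type*} [NormedAddCommGroup V₁] [NormedSpace ℝ V₁] [NormedAddCommGroup V₂]
  [NormedSpace ℝ V₂] [NormedAddCommGroup V] [NormedSpace ℝ V]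

lemma wedge_frame (p : S2) (β : V₁ →L[ℝ] V₂ →L[ℝ] V) (A : E3 →L[ℝ] V₁) (B : E3 →L[ℝ] V₂) :
    wedge β A B p = sgn p •
      (β (A (frame p 0)) (B (frame p 1)) - β (A (frame p 1)) (B (frame p 0))) :=
  wedge_eq (norm_coe p) (frame_norm p 0) (frame_norm p 1) (frame_orthogonal p)
    (inner_frame p 0) (inner_frame p 1) β A B

end WedgeFrame

/-! ### Smooth families of maps on the sphere -/

section Smooth

open Set

variable {V W Z : Type*} [NormedAddCommGroup V] [NormedSpace ℝ V] [NormedAddCommGroup W]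
  [NormedSpace ℝ W] [NormedAddCommGroup Z] [NormedSpace ℝ Z]

lemma radial_of_ne {x : E3} (hx : x ≠ 0) : (radial x : E3) = ‖x‖⁻¹ • x := by
  simp [radial, hx]

@[simp] lemma radial_coe (p : S2) : radial (p : E3) = p := by
  apply Subtype.ext
  rw [radial_of_ne (coe_ne_zero p), norm_coe, inv_one, one_smul]

lemma radial_smul {r : ℝ} (hr : 0 < r) (x : E3) : radial (r • x) = radial x := by
  by_cases hx : x = 0
  · simp [hx]
  · apply Subtype.ext
    rw [radial_of_ne hx, radial_of_ne (smul_ne_zero hr.ne' hx), norm_smul, Real.norm_eq_abs,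
      abs_of_pos hr, smul_smul]
    congr 1
    field_simp

/-- The domain `ℝ × (ℝ³ ∖ 0)` of the radial extension of a family of maps on the sphere. -/
def famDomain : Set (ℝ × E3) := {q | q.2 ≠ 0}

lemma isOpen_famDomain : IsOpen famDomain := isOpen_ne_fun continuous_snd continuous_const

/-- A one-parameter family of maps on the sphere is smooth if its extension to `ℝ × (ℝ³ ∖ 0)`,
constant along rays, is smooth. -/
def SmoothFam (φ : ℝ → S2 → V) : Prop :=
  ContDiffOn ℝ ∞ (fun q : ℝ × E3 => φ q.1 (radial q.2)) famDomain

/-- A map on the sphere is smooth if the constant family is. -/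
def Smooth (φ : S2 → V) : Prop := SmoothFam fun _ : ℝ => φ

lemma smoothFam_const (c : V) : SmoothFam fun _ _ => c := contDiffOn_const

lemma contDiffOn_normalize :
    ContDiffOn ℝ ∞ (fun q : ℝ × E3 => ‖q.2‖⁻¹ • q.2) famDomain := by
  have h : ContDiffOn ℝ ∞ (fun q : ℝ × E3 => q.2) famDomain := contDiff_snd.contDiffOn
  exact ((h.norm ℝ fun q hq => hq).inv fun q hq => norm_ne_zero_iff.2 hq).smul h

lemma smoothFam_coe : SmoothFam fun _ p => (p : E3) :=
  contDiffOn_normalize.congr fun _ hq => radial_of_ne hq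

namespace SmoothFam

variable {φ : ℝ → S2 → V} {ψ : ℝ → S2 → W}

lemma add {φ' : ℝ → S2 → V} (h : SmoothFam φ) (h' : SmoothFam φ') :
    SmoothFam fun s p => φ s p + φ' s p := ContDiffOn.add h h'

lemma sub {φ' : ℝ → S2 → V} (h : SmoothFam φ) (h' : SmoothFam φ') :
    SmoothFam fun s p => φ s p - φ' s p := ContDiffOn.sub h h'

lemma neg (h : SmoothFam φ) : SmoothFam fun s p => -φ s p := ContDiffOn.neg h

lemma smul {r : ℝ → S2 → ℝ} (hr : SmoothFam r) (h : SmoothFam φ) :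
    SmoothFam fun s p => r s p • φ s p := ContDiffOn.smul hr h

lemma mul {r r' : ℝ → S2 → ℝ} (hr : SmoothFam r) (h : SmoothFam r') :
    SmoothFam fun s p => r s p * r' s p := ContDiffOn.mul hr h

lemma pow {r : ℝ → S2 → ℝ} (hr : SmoothFam r) (n : ℕ) :
    SmoothFam fun s p => r s p ^ n := ContDiffOn.pow hr n

lemma inv {r : ℝ → S2 → ℝ} (hr : SmoothFam r) (h0 : ∀ s p, r s p ≠ 0) :
    SmoothFam fun s p => (r s p)⁻¹ := ContDiffOn.inv hr fun _ _ => h0 _ _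

lemma div {r r' : ℝ → S2 → ℝ} (hr : SmoothFam r) (hr' : SmoothFam r') (h0 : ∀ s p, r' s p ≠ 0) :
    SmoothFam fun s p => r s p / r' s p := ContDiffOn.div hr hr' fun _ _ => h0 _ _

lemma sqrt {r : ℝ → S2 → ℝ} (hr : SmoothFam r) (h0 : ∀ s p, r s p ≠ 0) :
    SmoothFam fun s p => √(r s p) := ContDiffOn.sqrt hr fun _ _ => h0 _ _

lemma norm {φ : ℝ → S2 → E3} (h : SmoothFam φ) (h0 : ∀ s p, φ s p ≠ 0) :
    SmoothFam fun s p => ‖φ s p‖ := ContDiffOn.norm ℝ h fun _ _ => h0 _ _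

lemma inner {φ φ' : ℝ → S2 → E3} (h : SmoothFam φ) (h' : SmoothFam φ') :
    SmoothFam fun s p => ⟪φ s p, φ' s p⟫ := ContDiffOn.inner ℝ h h'

lemma clm_apply {A : ℝ → S2 → V →L[ℝ] W} (hA : SmoothFam A) (h : SmoothFam φ) :
    SmoothFam fun s p => A s p (φ s p) := ContDiffOn.clm_apply hA h

lemma clm (L : V →L[ℝ] W) (h : SmoothFam φ) : SmoothFam fun s p => L (φ s p) :=
  L.contDiff.comp_contDiffOn h

lemma bilin (β : V →L[ℝ] W →L[ℝ] Z) (h : SmoothFam φ) (h' : SmoothFam ψ) :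
    SmoothFam fun s p => β (φ s p) (ψ s p) := (h.clm β).clm_apply h'

lemma cross {φ φ' : ℝ → S2 → E3} (h : SmoothFam φ) (h' : SmoothFam φ') :
    SmoothFam fun s p => cross (φ s p) (φ' s p) := bilin crossL h h'

lemma coord {φ : ℝ → S2 → E3} (h : SmoothFam φ) (i : Fin 3) : SmoothFam fun s p => φ s p i :=
  h.clm (EuclideanSpace.proj i)

lemma wedge {A : ℝ → S2 → E3 →L[ℝ] V} {B : ℝ → S2 → E3 →L[ℝ] W} (hA : SmoothFam A)
    (hB : SmoothFam B) (β : V →L[ℝ] W →L[ℝ] Z) :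
    SmoothFam fun s p => wedge β (A s p) (B s p) (p : E3) := by
  have hA' : ∀ i, SmoothFam fun s p => A s p (stdVec i) :=
    fun i => hA.clm_apply (smoothFam_const _)
  have hB' : ∀ i, SmoothFam fun s p => B s p (stdVec i) :=
    fun i => hB.clm_apply (smoothFam_const _)
  have key : ∀ i j, SmoothFam fun s p => β (A s p (stdVec i)) (B s p (stdVec j)) -
      β (A s p (stdVec j)) (B s p (stdVec i)) :=
    fun i j => ((hA' i).bilin β (hB' j)).sub ((hA' j).bilin β (hB' i))
  exact (((smoothFam_coe.coord 0).smul (key 1 2)).add ((smoothFam_coe.coord 1).smul (key 2 0))).add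
    ((smoothFam_coe.coord 2).smul (key 0 1))

/-- The differential of a smooth family is a smooth family. -/
lemma D (h : SmoothFam φ) : SmoothFam fun s p => D (φ s) p := by
  set g : ℝ × E3 → V := fun q => φ q.1 (radial q.2) with hg
  have h1 : ContDiffOn ℝ ∞ (fderiv ℝ g) famDomain :=
    ContDiffOn.fderiv_of_isOpen h isOpen_famDomain (by simp)
  have h2 : ContDiffOn ℝ ∞ (fun q : ℝ × E3 => (q.1, ‖q.2‖⁻¹ • q.2)) famDomain :=
    contDiff_fst.contDiffOn.prodMk contDiffOn_normalize
  have hmem : MapsTo (fun q : ℝ × E3 => (q.1, ‖q.2‖⁻¹ • q.2)) famDomain famDomain := by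
    intro q hq
    exact smul_ne_zero (inv_ne_zero (norm_ne_zero_iff.2 hq)) hq
  have h3 := (h1.comp h2 hmem).clm_comp
    (contDiffOn_const (c := ContinuousLinearMap.inr ℝ ℝ E3))
  refine h3.congr fun q hq => ?_
  have hd : DifferentiableAt ℝ g (q.1, ‖q.2‖⁻¹ • q.2) :=
    (ContDiffOn.contDiffAt h (isOpen_famDomain.mem_nhds (hmem hq))).differentiableAt (by simp)
  have hc : HasFDerivAt (fun x : E3 => (q.1, x)) (ContinuousLinearMap.inr ℝ ℝ E3)
      (‖q.2‖⁻¹ • q.2) := hasFDerivAt_prodMk_right _ _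
  have := (hd.hasFDerivAt.comp _ hc).fderiv
  simp only [FlagShape.D]
  rw [radial_of_ne hq]
  exact this

/-- The members of a smooth family are smooth. -/
lemma smooth (h : SmoothFam φ) (s : ℝ) : Smooth (φ s) := by
  have : ContDiffOn ℝ ∞ (fun q : ℝ × E3 => (s, q.2)) famDomain :=
    (contDiff_const.prodMk contDiff_snd).contDiffOn
  exact ContDiffOn.comp (g := fun q : ℝ × E3 => φ q.1 (radial q.2)) h this fun q hq => hq

end SmoothFam

variable {φ : S2 → V}

lemma Smooth.contDiffAt (h : Smooth φ) {x : E3} (hx : x ≠ 0) :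
    ContDiffAt ℝ ∞ (fun x => φ (radial x)) x := by
  have h1 : ContDiffAt ℝ ∞ (fun q : ℝ × E3 => φ (radial q.2)) (0, x) :=
    ContDiffOn.contDiffAt h (isOpen_famDomain.mem_nhds hx)
  exact h1.comp x (contDiffAt_const.prodMk contDiffAt_id)

lemma Smooth.differentiableAt (h : Smooth φ) {x : E3} (hx : x ≠ 0) :
    DifferentiableAt ℝ (fun x => φ (radial x)) x :=
  (h.contDiffAt hx).differentiableAt (by simp)

lemma Smooth.hasFDerivAt (h : Smooth φ) (p : S2) :
    HasFDerivAt (fun x => φ (radial x)) (D φ p) (p : E3) :=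
  (h.differentiableAt (coe_ne_zero p)).hasFDerivAt

lemma smooth_of_contDiffAt (h : ∀ x : E3, x ≠ 0 → ContDiffAt ℝ ∞ (fun x => φ (radial x)) x) :
    Smooth φ := by
  intro q hq
  exact ((h q.2 hq).comp q contDiffAt_snd).contDiffWithinAt

/-- The radial extension has the derivative `‖x‖⁻¹ D φ (x / ‖x‖)` at `x`. -/
lemma fderiv_radial (h : Smooth φ) {x : E3} (hx : x ≠ 0) :
    fderiv ℝ (fun x => φ (radial x)) x = ‖x‖⁻¹ • D φ (radial x) := by
  have hr : 0 < ‖x‖⁻¹ := inv_pos.2 (norm_pos_iff.2 hx)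
  have e : (fun y => φ (radial y)) = (fun y => φ (radial y)) ∘ fun y : E3 => ‖x‖⁻¹ • y := by
    funext y; simp [radial_smul hr]
  have h1 : HasFDerivAt (fun y : E3 => ‖x‖⁻¹ • y) (‖x‖⁻¹ • ContinuousLinearMap.id ℝ E3) x :=
    (‖x‖⁻¹ • ContinuousLinearMap.id ℝ E3).hasFDerivAt
  have h2 := h.hasFDerivAt (radial x)
  rw [radial_of_ne hx] at h2
  have h3 := h2.comp x h1
  rw [← e] at h3
  rw [h3.fderiv]
  ext v; simp

/-- Radial extensions are constant along rays. -/
lemma D_self (h : Smooth φ) (p : S2) : D φ p (p : E3) = 0 := by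
  have h1 : HasDerivAt (fun t : ℝ => t • (p : E3)) ((1 : ℝ) • (p : E3)) 1 :=
    (hasDerivAt_id (1 : ℝ)).smul_const (p : E3)
  have h2 : HasFDerivAt (fun x => φ (radial x)) (D φ p) ((1 : ℝ) • (p : E3)) := by
    rw [one_smul]; exact h.hasFDerivAt p
  have h3 := h2.comp_hasDerivAt (1 : ℝ) h1
  have h4 : HasDerivAt ((fun x => φ (radial x)) ∘ fun t : ℝ => t • (p : E3)) 0 1 := by
    refine (hasDerivAt_const (1 : ℝ) (φ p)).congr_of_eventuallyEq ?_
    filter_upwards [lt_mem_nhds (zero_lt_one (α := ℝ))] with t ht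
    simp [radial_smul ht]
  have := h3.unique h4
  rwa [one_smul] at this

lemma D_frame (h : Smooth φ) (p : S2) (x : E3) :
    D φ p x = ⟪x, frame p 0⟫ • D φ p (frame p 0) + ⟪x, frame p 1⟫ • D φ p (frame p 1) := by
  conv_lhs => rw [eq_frame p x]
  rw [map_add, map_add, map_smul, map_smul, map_smul, D_self h, smul_zero, add_zero]

/-- A map with vanishing differential on the sphere is constant. -/
lemma eq_of_D_eq_zero (h : Smooth φ) (h0 : ∀ p, D φ p = 0) (p q : S2) : φ p = φ q := by
  have hconn : IsPreconnected ({0}ᶜ : Set E3) :=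
    (isConnected_compl_singleton_of_one_lt_rank
      (by rw [← Module.finrank_eq_rank, finrank_euclideanSpace_fin]; norm_num) 0).isPreconnected
  have := isOpen_compl_singleton.is_const_of_fderiv_eq_zero (𝕜 := ℝ)
    (f := fun x => φ (radial x)) hconn
    (fun x hx => (h.differentiableAt hx).differentiableWithinAt)
    (fun x hx => by rw [fderiv_radial h hx, h0, smul_zero]; rfl)
    (coe_ne_zero p) (coe_ne_zero q)
  simpa using this

lemma SmoothFam.continuous {φ : ℝ → S2 → V} (h : SmoothFam φ) :
    Continuous fun q : ℝ × S2 => φ q.1 q.2 := by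
  have h1 : Continuous fun q : ℝ × S2 => (q.1, (q.2 : E3)) := by fun_prop
  have := ContinuousOn.comp_continuous (ContDiffOn.continuousOn h) h1 fun q => coe_ne_zero q.2
  simpa [Function.comp_def] using this

lemma Smooth.continuous (h : Smooth φ) : Continuous φ :=
  (SmoothFam.continuous h).comp (Continuous.prodMk_right (0 : ℝ))

/-! ### Comparison with smoothness on manifolds -/

lemma fact_finrank_E3 : Fact (Module.finrank ℝ E3 = 2 + 1) := ⟨finrank_euclideanSpace_fin⟩

/-- Read as a map to the manifold `S2`, the radial projection is smooth away from `0`. -/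
lemma contMDiffAt_radial {x : E3} (hx : x ≠ 0) :
    ContMDiffAt 𝓘(ℝ, E3) (𝓡 2) ∞ radial x := by
  set U : TopologicalSpace.Opens E3 := ⟨{0}ᶜ, isOpen_compl_singleton⟩ with hU
  have h1 : ContMDiff 𝓘(ℝ, E3) 𝓘(ℝ, E3) ∞ fun y : U => (radial (y : E3) : E3) := by
    intro y
    refine (contMDiffAt_subtype_iff (U := U) (f := fun y : E3 => (radial y : E3))).2 ?_
    have hy : (y : E3) ≠ 0 := y.2
    have : ContDiffAt ℝ ∞ (fun y : E3 => ‖y‖⁻¹ • y) (y : E3) :=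
      ((contDiffAt_norm ℝ hy).inv (norm_ne_zero_iff.2 hy)).smul contDiffAt_id
    refine (this.congr_of_eventuallyEq ?_).contMDiffAt
    filter_upwards [isOpen_ne.mem_nhds hy] with z hz using radial_of_ne hz
  have := fact_finrank_E3
  have h2 := h1.codRestrict_sphere (n := 2) (fun y => (radial (y : E3)).2) ⟨x, hx⟩
  exact (contMDiffAt_subtype_iff (U := U) (f := radial) (x := ⟨x, hx⟩)).1 h2

lemma smoothFam_of_contMDiff {φ : ℝ → S2 → V}
    (h : ContMDiff (𝓘(ℝ, ℝ).prod (𝓡 2)) 𝓘(ℝ, V) ∞ fun q : ℝ × S2 => φ q.1 q.2) :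
    SmoothFam φ := by
  intro q hq
  refine ContDiffAt.contDiffWithinAt ?_
  rw [← contMDiffAt_iff_contDiffAt]
  have h1 : ContMDiffAt 𝓘(ℝ, ℝ × E3) (𝓘(ℝ, ℝ).prod (𝓡 2)) ∞
      (fun q : ℝ × E3 => (q.1, radial q.2)) q :=
    contDiffAt_fst.contMDiffAt.prodMk ((contMDiffAt_radial hq).comp q contDiffAt_snd.contMDiffAt)
  exact (h (q.1, radial q.2)).comp q h1

lemma smooth_of_contMDiff (h : ContMDiff (𝓡 2) 𝓘(ℝ, V) ∞ φ) : Smooth φ :=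
  smoothFam_of_contMDiff (h.comp contMDiff_snd)

lemma Field.smooth (X : Field) : Smooth X := smooth_of_contMDiff X.contMDiff

lemma Smooth.contMDiff (h : Smooth φ) : ContMDiff (𝓡 2) 𝓘(ℝ, V) ∞ φ := by
  intro p
  have h1 := (h.contDiffAt (coe_ne_zero p)).contMDiffAt
  have := fact_finrank_E3
  have h2 : ContMDiffAt (𝓡 2) 𝓘(ℝ, E3) ∞ (Subtype.val : S2 → E3) p := contMDiff_coe_sphere p
  have := h1.comp p h2
  convert! this using 1
  funext q; simp

/-! ### Smooth families of maps on the circle -/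

/-- A one-parameter family of maps on the circle is smooth if it is a smooth function of the
parameter and the angle. -/
def SmoothLoop (f : ℝ → Circle → V) : Prop :=
  ContDiff ℝ ∞ fun q : ℝ × ℝ => f q.1 (Circle.exp q.2)

lemma dot_exp (f : Circle → V) (θ : ℝ) :
    dot f (Circle.exp θ) = deriv (fun θ => f (Circle.exp θ)) θ := by
  simp only [dot, ← Circle.exp_add]
  rw [deriv_comp_const_add (f := fun θ => f (Circle.exp θ)), add_zero]

namespace SmoothLoop

variable {f : ℝ → Circle → V} {k : ℝ → Circle → W}

lemma add {f' : ℝ → Circle → V} (h : SmoothLoop f) (h' : SmoothLoop f') :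
    SmoothLoop fun s z => f s z + f' s z := ContDiff.add h h'

lemma sub {f' : ℝ → Circle → V} (h : SmoothLoop f) (h' : SmoothLoop f') :
    SmoothLoop fun s z => f s z - f' s z := ContDiff.sub h h'

lemma smul {r : ℝ → Circle → ℝ} (hr : SmoothLoop r) (h : SmoothLoop f) :
    SmoothLoop fun s z => r s z • f s z := ContDiff.smul hr h

lemma mul {r r' : ℝ → Circle → ℝ} (hr : SmoothLoop r) (h : SmoothLoop r') :
    SmoothLoop fun s z => r s z * r' s z := ContDiff.mul hr h

lemma pow {r : ℝ → Circle → ℝ} (hr : SmoothLoop r) (n : ℕ) :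
    SmoothLoop fun s z => r s z ^ n := ContDiff.pow hr n

lemma inv {r : ℝ → Circle → ℝ} (hr : SmoothLoop r) (h0 : ∀ s z, r s z ≠ 0) :
    SmoothLoop fun s z => (r s z)⁻¹ := ContDiff.inv hr fun _ => h0 _ _

lemma norm {f : ℝ → Circle → E3} (h : SmoothLoop f) (h0 : ∀ s z, f s z ≠ 0) :
    SmoothLoop fun s z => ‖f s z‖ := ContDiff.norm ℝ h fun _ => h0 _ _

lemma inner {f f' : ℝ → Circle → E3} (h : SmoothLoop f) (h' : SmoothLoop f') :
    SmoothLoop fun s z => ⟪f s z, f' s z⟫ := ContDiff.inner ℝ h h'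

lemma cross {f f' : ℝ → Circle → E3} (h : SmoothLoop f) (h' : SmoothLoop f') :
    SmoothLoop fun s z => cross (f s z) (f' s z) :=
  (crossL.contDiff.comp h).clm_apply h'

lemma dot (h : SmoothLoop f) : SmoothLoop fun s z => dot (f s) z := by
  set g : ℝ × ℝ → V := fun q => f q.1 (Circle.exp q.2) with hg
  have h1 : ContDiff ℝ ∞ (fderiv ℝ g) := ContDiff.fderiv_right h (by simp)
  have h2 := h1.clm_apply (contDiff_const (c := ((0 : ℝ), (1 : ℝ))))
  unfold SmoothLoop
  convert! h2 using 1
  funext q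
  beta_reduce
  rw [dot_exp]
  have hd : DifferentiableAt ℝ g (q.1, q.2) := (ContDiff.differentiable h (by simp)) _
  have hc : HasDerivAt (fun θ : ℝ => (q.1, θ)) ((0 : ℝ), (1 : ℝ)) q.2 :=
    (hasDerivAt_const q.2 q.1).prodMk (hasDerivAt_id q.2)
  exact (hd.hasFDerivAt.comp_hasDerivAt q.2 hc).deriv

lemma contDiff (h : SmoothLoop f) (s : ℝ) : ContDiff ℝ ∞ fun θ => f s (Circle.exp θ) :=
  ContDiff.comp (g := fun q : ℝ × ℝ => f q.1 (Circle.exp q.2)) h (contDiff_const.prodMk contDiff_id)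

end SmoothLoop

/-- The point of `ℝ³` on the equator with a given angle. -/
def equatorVec (θ : ℝ) : E3 := !₂[Real.cos θ, Real.sin θ, 0]

lemma equator_exp (θ : ℝ) : (equator (Circle.exp θ) : E3) = equatorVec θ := by
  apply ext_three <;>
    simp [equator, equatorVec, Circle.coe_exp, Complex.exp_ofReal_mul_I_re,
      Complex.exp_ofReal_mul_I_im]

lemma contDiff_equatorVec : ContDiff ℝ ∞ equatorVec := by
  rw [contDiff_euclidean]
  intro i
  fin_cases i
  · exact Real.contDiff_cos
  · exact Real.contDiff_sin
  · exact contDiff_const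

lemma equatorVec_ne_zero (θ : ℝ) : equatorVec θ ≠ 0 := by
  rw [← equator_exp]; exact coe_ne_zero _

lemma SmoothFam.loop {φ : ℝ → S2 → V} (h : SmoothFam φ) :
    SmoothLoop fun s z => φ s (equator z) := by
  have h1 : ContDiff ℝ ∞ fun q : ℝ × ℝ => (q.1, equatorVec q.2) :=
    contDiff_fst.prodMk (contDiff_equatorVec.comp contDiff_snd)
  have h2 := ContDiffOn.comp_contDiff h h1 fun q => equatorVec_ne_zero q.2
  unfold SmoothLoop
  convert! h2 using 1
  funext q
  simp [← equator_exp]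

/-- The unit vector field along the equator, tangent to it. -/
def equatorDir (p : E3) : E3 := cross (stdVec 2) p

lemma equatorDir_eq (p : E3) : equatorDir p = !₂[-p 1, p 0, 0] := by
  apply ext_three <;> simp [equatorDir, stdVec]

lemma hasDerivAt_equatorVec (θ : ℝ) :
    HasDerivAt equatorVec (equatorDir (equatorVec θ)) θ := by
  have h : HasDerivAt (fun θ : ℝ => ![Real.cos θ, Real.sin θ, 0])
      ![-Real.sin θ, Real.cos θ, 0] θ := by
    rw [hasDerivAt_pi]
    intro i
    fin_cases i
    · exact Real.hasDerivAt_cos θ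
    · exact Real.hasDerivAt_sin θ
    · exact hasDerivAt_const θ (0 : ℝ)
  have := (EuclideanSpace.equiv (Fin 3) ℝ).symm.hasFDerivAt.comp_hasDerivAt θ h
  rw [equatorDir_eq]
  exact this

lemma exists_exp (z : Circle) : ∃ θ : ℝ, Circle.exp θ = z :=
  ⟨Complex.arg z, Circle.exp_arg z⟩

lemma dot_equator (h : Smooth φ) (z : Circle) :
    dot (fun z => φ (equator z)) z = D φ (equator z) (equatorDir (equator z)) := by
  obtain ⟨θ, rfl⟩ := exists_exp z
  rw [dot_exp]
  have h1 := h.hasFDerivAt (equator (Circle.exp θ))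
  rw [equator_exp] at h1 ⊢
  have h2 := h1.comp_hasDerivAt θ (hasDerivAt_equatorVec θ)
  have e : ((fun x => φ (radial x)) ∘ equatorVec) = fun θ => φ (equator (Circle.exp θ)) := by
    funext t; simp [← equator_exp]
  rw [e] at h2
  exact h2.deriv

lemma inner_equatorDir (p : E3) : ⟪p, equatorDir p⟫ = 0 := inner_cross_right _ _

lemma equator_two (z : Circle) : (equator z : E3) 2 = 0 := rfl

lemma norm_equatorDir (z : Circle) : ‖equatorDir (equator z)‖ = 1 := by
  have h := norm_cross_sq (stdVec 2) (equator z : E3)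
  have h2 : ‖stdVec 2‖ = 1 := by simp [stdVec]
  have h3 : ⟪stdVec 2, (equator z : E3)⟫ = 0 := by
    simp [inner_eq_sum, stdVec, equator_two]
  rw [norm_coe, h2, h3] at h
  have h4 : ‖equatorDir (equator z)‖ ^ 2 = 1 := by rw [equatorDir, h]; norm_num
  nlinarith [norm_nonneg (equatorDir (equator z))]

lemma equatorDir_ne_zero (z : Circle) : equatorDir (equator z) ≠ 0 := by
  rw [← norm_ne_zero_iff, norm_equatorDir]; exact one_ne_zero

lemma SmoothLoop.continuous {f : ℝ → Circle → V} (h : SmoothLoop f) (s : ℝ) :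
    Continuous (f s) := by
  have hq := isLocalHomeomorph_circleExp.isOpenMap.isQuotientMap Circle.exp.continuous exists_exp
  exact hq.continuous_iff.2 (h.contDiff s).continuous

end Smooth

/-! ### The unit normal of an immersed sphere -/

section Surface

open Set Filter Topology

/-- The normal vector without reference to a frame; the factor `1 / 2` is due to the antisymmetry of
the cross product. -/
lemma normalVec_eq (F : S2 → E3) (p : S2) :
    normalVec F p = (1 / 2 : ℝ) • wedge crossL (D F p) (D F p) (p : E3) := by
  rw [wedge_frame, normalVec, sgn]
  simp only [crossL_apply]
  rw [cross_anti (D F p (frame p 0)) (D F p (frame p 1))]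
  module

lemma normalVec_eq_sgn (F : S2 → E3) (p : S2) :
    normalVec F p = sgn p • cross (D F p (frame p 0)) (D F p (frame p 1)) := rfl

lemma norm_normalVec_sq (F : S2 → E3) (p : S2) :
    ‖normalVec F p‖ ^ 2 = ‖cross (D F p (frame p 0)) (D F p (frame p 1))‖ ^ 2 := by
  rw [normalVec_eq_sgn, norm_smul, mul_pow, Real.norm_eq_abs, sq_abs, sgn_sq, one_mul]

lemma gram_apply (F : S2 → E3) (p : S2) (i j : Fin 2) :
    gram F p i j = ⟪D F p (frame p i), D F p (frame p j)⟫ := rfl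

lemma gram_det (F : S2 → E3) (p : S2) : (gram F p).det = ‖normalVec F p‖ ^ 2 := by
  rw [norm_normalVec_sq, norm_cross_sq, Matrix.det_fin_two]
  simp only [gram_apply, real_inner_self_eq_norm_sq]
  rw [real_inner_comm (D F p (frame p 0))]; ring

lemma sqrt_gram_det (F : S2 → E3) (p : S2) : √(gram F p).det = ‖normalVec F p‖ := by
  rw [gram_det, Real.sqrt_sq (norm_nonneg _)]

/-- A smooth map of the sphere into space whose normal vector vanishes nowhere, that is, a smooth
immersion. -/
structure Immersed (F : S2 → E3) : Prop where
  smooth : Smooth F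
  ne_zero : ∀ p, normalVec F p ≠ 0

/-- The differential of the inclusion of the sphere is injective on tangent planes: it is the
tangential part of the derivative of `x = ‖x‖ • radial x`. -/
lemma eq_zero_of_D_coe_eq_zero (p : S2) {w : E3} (hw : ⟪(p : E3), w⟫ = 0)
    (h : D (fun q : S2 => (q : E3)) p w = 0) : w = 0 := by
  have hn : HasFDerivAt (fun x : E3 => ‖x‖) (fderiv ℝ (fun x : E3 => ‖x‖) p) (p : E3) :=
    ((contDiffAt_norm ℝ (coe_ne_zero p) (n := 1)).differentiableAt (by simp)).hasFDerivAt
  have hc : HasFDerivAt (fun x => (radial x : E3)) (D (fun q : S2 => (q : E3)) p) (p : E3) :=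
    (smoothFam_coe.smooth 0).hasFDerivAt p
  have h1 := hn.smul hc
  have h2 : HasFDerivAt (fun x : E3 => ‖x‖ • (radial x : E3)) (ContinuousLinearMap.id ℝ E3)
      (p : E3) := by
    refine (hasFDerivAt_id (p : E3)).congr_of_eventuallyEq ?_
    filter_upwards [isOpen_ne.mem_nhds (coe_ne_zero p)] with x hx
    rw [radial_of_ne hx, smul_smul, mul_inv_cancel₀ (norm_ne_zero_iff.2 hx), one_smul]; rfl
  have h3 := congrArg (fun L : E3 →L[ℝ] E3 => L w) (h1.unique h2)
  simp only [add_apply, smul_apply, h, smul_zero, zero_add,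
    ContinuousLinearMap.smulRight_apply, radial_coe, ContinuousLinearMap.id_apply] at h3
  rw [← h3, inner_smul_right, real_inner_self_eq_norm_sq, norm_coe] at hw
  have h4 : fderiv ℝ (fun x : E3 => ‖x‖) p w = 0 := by simpa using hw
  rw [← h3, h4, zero_smul]

/-- The immersion condition, in terms of `mfderiv`, expressed by `D`. -/
lemma PreShape.D_injective (F : PreShape) (p : S2) {w : E3} (hw : ⟪(p : E3), w⟫ = 0)
    (h : D F p w = 0) : w = 0 := by
  refine eq_zero_of_D_coe_eq_zero p hw ?_
  have hr : MDifferentiableAt 𝓘(ℝ, E3) (𝓡 2) radial (p : E3) :=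
    (contMDiffAt_radial (coe_ne_zero p)).mdifferentiableAt (by simp)
  have hF : MDifferentiableAt (𝓡 2) 𝓘(ℝ, E3) (F.toField : S2 → E3) (radial p) :=
    (F.toField.contMDiff _).mdifferentiableAt (by simp)
  have := fact_finrank_E3
  have hc : MDifferentiableAt (𝓡 2) 𝓘(ℝ, E3) (Subtype.val : S2 → E3) (radial p) :=
    ((contMDiff_coe_sphere (m := ∞)) _).mdifferentiableAt (by simp)
  have h1 : D F p = (mfderiv (𝓡 2) 𝓘(ℝ, E3) (F.toField : S2 → E3) (radial p)).comp
      (mfderiv 𝓘(ℝ, E3) (𝓡 2) radial (p : E3)) := by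
    rw [← mfderiv_comp (p : E3) hF hr, mfderiv_eq_fderiv]; rfl
  have h2 : D (fun q : S2 => (q : E3)) p =
      (mfderiv (𝓡 2) 𝓘(ℝ, E3) (Subtype.val : S2 → E3) (radial p)).comp
      (mfderiv 𝓘(ℝ, E3) (𝓡 2) radial (p : E3)) := by
    rw [← mfderiv_comp (p : E3) hc hr, mfderiv_eq_fderiv]; rfl
  rw [h1] at h
  have h3 : mfderiv 𝓘(ℝ, E3) (𝓡 2) radial (p : E3) w = 0 :=
    F.immersion (radial p) (h.trans (map_zero _).symm)
  rw [h2]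
  have h4 : ∀ y, y = 0 → mfderiv (𝓡 2) 𝓘(ℝ, E3) (Subtype.val : S2 → E3) (radial p) y = 0 := by
    rintro _ rfl
    exact map_zero _
  exact h4 _ h3

lemma PreShape.immersed (F : PreShape) : Immersed F where
  smooth := F.toField.smooth
  ne_zero p h0 := by
    set a := D F p (frame p 0) with ha
    set b := D F p (frame p 1) with hb
    have h1 : ‖a‖ ^ 2 * ‖b‖ ^ 2 - ⟪a, b⟫ ^ 2 = 0 := by
      rw [← norm_cross_sq, ← norm_normalVec_sq, h0]; simp
    have h2 : ‖‖a‖ ^ 2 • b - ⟪a, b⟫ • a‖ ^ 2 = 0 := by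
      have e : ‖‖a‖ ^ 2 • b - ⟪a, b⟫ • a‖ ^ 2 = ‖a‖ ^ 2 * (‖a‖ ^ 2 * ‖b‖ ^ 2 - ⟪a, b⟫ ^ 2) := by
        rw [← real_inner_self_eq_norm_sq]
        simp only [inner_sub_left, inner_sub_right, inner_smul_left, inner_smul_right,
          real_inner_self_eq_norm_sq, real_inner_comm a b]
        simp; ring
      rw [e, h1, mul_zero]
    have h3 : D F p (‖a‖ ^ 2 • frame p 1 - ⟪a, b⟫ • frame p 0) = 0 := by
      rw [map_sub, map_smul, map_smul]
      exact norm_eq_zero.1 (pow_eq_zero_iff two_ne_zero |>.1 h2)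
    have h4 := F.D_injective p (by
      rw [inner_sub_right, inner_smul_right, inner_smul_right, inner_frame, inner_frame]; simp) h3
    have h5 : ⟪‖a‖ ^ 2 • frame p 1 - ⟪a, b⟫ • frame p 0, frame p 1⟫ = ‖a‖ ^ 2 := by
      rw [inner_sub_left, inner_smul_left, inner_smul_left, real_inner_self_eq_norm_sq, frame_norm,
        frame_orthogonal]
      simp
    rw [h4, inner_zero_left] at h5
    have h6 : a = 0 := norm_eq_zero.1 (pow_eq_zero_iff two_ne_zero |>.1 h5.symm)
    have h7 := F.D_injective p (inner_frame p 0) h6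
    have h8 := frame_norm p 0
    rw [h7, norm_zero] at h8
    exact zero_ne_one h8

lemma inner_normalVec (F : S2 → E3) (hF : Smooth F) (p : S2) (x : E3) :
    ⟪normalVec F p, D F p x⟫ = 0 := by
  rw [normalVec_eq_sgn, D_frame hF p x, inner_add_right, inner_smul_right, inner_smul_right,
    inner_smul_left, inner_smul_left, inner_cross_left', inner_cross_right']
  simp

lemma inner_unitNormal_D (F : S2 → E3) (hF : Smooth F) (p : S2) (x : E3) :
    ⟪unitNormal F p, D F p x⟫ = 0 := by
  rw [unitNormal, inner_smul_left, inner_normalVec F hF, mul_zero]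

/-! ### Smooth families of immersed spheres -/

/-- A smooth family of immersions of the sphere. -/
structure ImmersedFam (F : ℝ → S2 → E3) : Prop where
  smooth : SmoothFam F
  ne_zero : ∀ s p, normalVec (F s) p ≠ 0

lemma Immersed.const {F : S2 → E3} (hF : Immersed F) : ImmersedFam fun _ => F :=
  ⟨hF.smooth, fun _ => hF.ne_zero⟩

lemma ImmersedFam.immersed {F : ℝ → S2 → E3} (hF : ImmersedFam F) (s : ℝ) : Immersed (F s) :=
  ⟨hF.smooth.smooth s, hF.ne_zero s⟩

lemma SmoothFam.normalVec {F : ℝ → S2 → E3} (hF : SmoothFam F) :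
    SmoothFam fun s p => normalVec (F s) p := by
  simp only [normalVec_eq]
  exact (smoothFam_const _).smul (hF.D.wedge hF.D _)

lemma ImmersedFam.norm_normalVec {F : ℝ → S2 → E3} (hF : ImmersedFam F) :
    SmoothFam fun s p => ‖FlagShape.normalVec (F s) p‖ := hF.smooth.normalVec.norm hF.ne_zero

lemma ImmersedFam.unitNormal {F : ℝ → S2 → E3} (hF : ImmersedFam F) :
    SmoothFam fun s p => unitNormal (F s) p :=
  (hF.norm_normalVec.inv fun s p => norm_ne_zero_iff.2 (hF.ne_zero s p)).smul hF.smooth.normalVec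

lemma Immersed.smooth_unitNormal {F : S2 → E3} (hF : Immersed F) : Smooth (unitNormal F) :=
  hF.const.unitNormal

lemma Immersed.norm_unitNormal {F : S2 → E3} (hF : Immersed F) (p : S2) :
    ‖unitNormal F p‖ = 1 := by
  rw [unitNormal, norm_smul, norm_inv, norm_norm, inv_mul_cancel₀]
  exact norm_ne_zero_iff.2 (hF.ne_zero p)

lemma Immersed.inner_unitNormal_self {F : S2 → E3} (hF : Immersed F) (p : S2) :
    ⟪unitNormal F p, unitNormal F p⟫ = 1 := by
  rw [real_inner_self_eq_norm_sq, hF.norm_unitNormal, one_pow]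

/-- Differentiating a constant inner product of maps on the sphere. -/
lemma D_inner_add {φ ψ : S2 → E3} (hφ : Smooth φ) (hψ : Smooth ψ) {c : ℝ}
    (h : ∀ p, ⟪φ p, ψ p⟫ = c) (p : S2) (x : E3) : ⟪φ p, D ψ p x⟫ + ⟪D φ p x, ψ p⟫ = 0 := by
  have h1 := (hφ.hasFDerivAt p).inner ℝ (hψ.hasFDerivAt p)
  simp only [h, radial_coe] at h1
  have h2 := congrArg (fun L : E3 →L[ℝ] ℝ => L x) (h1.unique (hasFDerivAt_const c (p : E3)))
  simpa using h2

lemma Immersed.inner_unitNormal_D_unitNormal {F : S2 → E3} (hF : Immersed F) (p : S2) (x : E3) :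
    ⟪unitNormal F p, D (unitNormal F) p x⟫ = 0 := by
  have := D_inner_add hF.smooth_unitNormal hF.smooth_unitNormal hF.inner_unitNormal_self p x
  rw [real_inner_comm (unitNormal F p)] at this
  linarith

lemma Immersed.eq_zero_of_inner {F : S2 → E3} (hF : Immersed F) (p : S2) {x : E3}
    (h : ⟪unitNormal F p, x⟫ = 0) (h0 : ⟪x, D F p (frame p 0)⟫ = 0)
    (h1 : ⟪x, D F p (frame p 1)⟫ = 0) : x = 0 := by
  have hN := norm_ne_zero_iff.2 (hF.ne_zero p)
  have e : cross x (normalVec F p) = 0 := by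
    rw [normalVec_eq_sgn, cross_smul_right, cross_cross_eq, h0, h1]
    simp
  have e2 : ⟪x, normalVec F p⟫ = 0 := by
    rw [unitNormal, real_inner_smul_left, mul_eq_zero, inv_eq_zero] at h
    rw [real_inner_comm]
    exact h.resolve_left hN
  have e3 := norm_cross_sq x (normalVec F p)
  rw [e, e2, norm_zero, zero_pow two_ne_zero, sub_zero] at e3
  have e4 := (mul_eq_zero.1 e3.symm).resolve_right (pow_ne_zero 2 hN)
  exact norm_eq_zero.1 (pow_eq_zero_iff two_ne_zero |>.1 e4)

/-- The second fundamental form is symmetric. -/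
lemma Immersed.inner_D_unitNormal_symm {F : S2 → E3} (hF : Immersed F) (p : S2) (x y : E3) :
    ⟪D (unitNormal F) p x, D F p y⟫ = ⟪D (unitNormal F) p y, D F p x⟫ := by
  have hc := hF.smooth.contDiffAt (coe_ne_zero p)
  have hsymm : IsSymmSndFDerivAt ℝ (fun x => F (radial x)) (p : E3) :=
    hc.isSymmSndFDerivAt (by simp only [minSmoothness_of_isRCLikeNormedField]; norm_cast)
  have hdd : HasFDerivAt (fderiv ℝ (fun x => F (radial x)))
      (fderiv ℝ (fderiv ℝ (fun x => F (radial x))) p) (p : E3) :=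
    ((hc.fderiv_right (m := 1) (by norm_cast)).differentiableAt (by simp)).hasFDerivAt
  -- differentiate `⟨ν, dF y⟩ = 0` in the direction `x`
  have key : ∀ x y : E3, ⟪D (unitNormal F) p x, D F p y⟫ =
      -⟪unitNormal F p, fderiv ℝ (fderiv ℝ (fun x => F (radial x))) p x y⟫ := by
    intro x y
    have h1 := (hF.smooth_unitNormal.hasFDerivAt p).inner ℝ (hdd.clm_apply (hasFDerivAt_const y _))
    have h2 : HasFDerivAt (fun z => ⟪unitNormal F (radial z),
        fderiv ℝ (fun x => F (radial x)) z y⟫) (0 : E3 →L[ℝ] ℝ) (p : E3) := by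
      refine (hasFDerivAt_const (0 : ℝ) (p : E3)).congr_of_eventuallyEq ?_
      filter_upwards [isOpen_ne.mem_nhds (coe_ne_zero p)] with z hz
      rw [fderiv_radial hF.smooth hz, smul_apply, inner_smul_right,
        inner_unitNormal_D F hF.smooth, mul_zero]
    have h3 := congrArg (fun L : E3 →L[ℝ] ℝ => L x) (h1.unique h2)
    simp at h3
    have e : fderiv ℝ (fun x => F (radial x)) p = D F p := rfl
    rw [e] at h3
    linarith
  rw [key, key, hsymm x y]

/-! ### The shape operator -/

lemma Immersed.det_gram_pos {F : S2 → E3} (hF : Immersed F) (p : S2) : 0 < (gram F p).det := by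
  rw [gram_det]; exact pow_pos (norm_pos_iff.2 (hF.ne_zero p)) 2

lemma gram_inv (F : S2 → E3) (p : S2) :
    (gram F p)⁻¹ = (‖normalVec F p‖ ^ 2)⁻¹ •
      !![gram F p 1 1, -gram F p 0 1; -gram F p 1 0, gram F p 0 0] := by
  rw [Matrix.inv_def, gram_det, Matrix.adjugate_fin_two, Ring.inverse_eq_inv']

/-- The matrix `⟨dν u, dF v⟩`, minus the second fundamental form. -/
def weingarten (F : S2 → E3) (p : S2) (i j : Fin 2) : ℝ :=
  ⟪D (unitNormal F) p (frame p i), D F p (frame p j)⟫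

lemma trace_shapeOp (F : S2 → E3) (p : S2) :
    (shapeOp F p).trace = -((‖normalVec F p‖ ^ 2)⁻¹ *
      (gram F p 1 1 * weingarten F p 0 0 - gram F p 0 1 * (weingarten F p 0 1 + weingarten F p 1 0)
        + gram F p 0 0 * weingarten F p 1 1)) := by
  have : gram F p 1 0 = gram F p 0 1 := by
    rw [gram_apply, gram_apply, real_inner_comm]
  rw [shapeOp, gram_inv, Matrix.trace_fin_two]
  simp [Matrix.mul_apply, Fin.sum_univ_two, weingarten, this]
  ring

lemma det_shapeOp (F : S2 → E3) (p : S2) :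
    (shapeOp F p).det = (‖normalVec F p‖ ^ 2)⁻¹ *
      (weingarten F p 0 0 * weingarten F p 1 1 - weingarten F p 0 1 * weingarten F p 1 0) := by
  rw [shapeOp, Matrix.det_mul, Matrix.det_nonsing_inv, gram_det, Ring.inverse_eq_inv',
    Matrix.det_fin_two]
  simp [weingarten]

lemma sgn_mul_sgn_mul (p : S2) (x : ℝ) : sgn p * (sgn p * x) = x := by
  rw [← mul_assoc, ← sq, sgn_sq, one_mul]

/-- The mean curvature without reference to a frame. -/
lemma trace_shapeOp_eq_wedge (F : S2 → E3) (p : S2) :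
    (shapeOp F p).trace = -((‖normalVec F p‖ ^ 2)⁻¹ *
      ⟪wedge crossL (D F p) (D (unitNormal F) p) p, normalVec F p⟫) := by
  rw [trace_shapeOp, wedge_frame]
  conv_rhs => rw [normalVec_eq_sgn F p]
  rw [real_inner_smul_left, real_inner_smul_right, sgn_mul_sgn_mul, ← normalVec_eq_sgn]
  simp only [crossL_apply, gram_apply, weingarten]
  congr 2
  generalize D F p (frame p 0) = a
  generalize D F p (frame p 1) = b
  simp only [inner_eq_sum, cross_apply_zero, cross_apply_one, cross_apply_two, PiLp.sub_apply]
  ring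

/-- The Gauss curvature without reference to a frame. -/
lemma det_shapeOp_eq_wedge (F : S2 → E3) (p : S2) :
    (shapeOp F p).det = (‖normalVec F p‖ ^ 2)⁻¹ *
      ⟪normalVec (unitNormal F) p, normalVec F p⟫ := by
  rw [det_shapeOp]
  conv_rhs => rw [normalVec_eq_sgn F p, normalVec_eq_sgn (unitNormal F) p]
  rw [real_inner_smul_left, real_inner_smul_right, sgn_mul_sgn_mul, ← normalVec_eq_sgn,
    inner_cross_cross]
  simp only [weingarten]

lemma Immersed.weingarten_symm {F : S2 → E3} (hF : Immersed F) (p : S2) :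
    weingarten F p 1 0 = weingarten F p 0 1 := hF.inner_D_unitNormal_symm p _ _

lemma Immersed.gram_pos {F : S2 → E3} (hF : Immersed F) (p : S2) : 0 < gram F p 0 0 := by
  have h := hF.det_gram_pos p
  rw [Matrix.det_fin_two] at h
  have e : gram F p 1 0 = gram F p 0 1 := by rw [gram_apply, gram_apply, real_inner_comm]
  rw [e] at h
  have h0 : 0 ≤ gram F p 0 0 := by rw [gram_apply]; exact real_inner_self_nonneg
  have h1 : 0 ≤ gram F p 1 1 := by rw [gram_apply]; exact real_inner_self_nonneg
  rcases h0.lt_or_eq with h2 | h2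
  · exact h2
  · rw [← h2] at h; nlinarith [sq_nonneg (gram F p 0 1)]

/-- The discriminant of the characteristic polynomial of the shape operator as a sum of squares.
Here `E`, `F`, `G` are the coefficients of the metric and `a`, `b`, `c` those of the second
fundamental form. -/
lemma discr_identity {E F G a b c : ℝ} (hE : E ≠ 0) :
    (G * a - F * (b + b) + E * c) ^ 2 - 4 * (E * G - F ^ 2) * (a * c - b * b) =
      (E * c - G * a - 2 * F / E * (E * b - F * a)) ^ 2 +
        4 * (E * G - F ^ 2) * ((E * b - F * a) / E) ^ 2 := by
  field_simp; ring

lemma Immersed.discr_eq {F : S2 → E3} (hF : Immersed F) (p : S2) :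
    (‖normalVec F p‖ ^ 2) ^ 2 * ((shapeOp F p).trace ^ 2 - 4 * (shapeOp F p).det) =
      (gram F p 0 0 * weingarten F p 1 1 - gram F p 1 1 * weingarten F p 0 0
        - 2 * gram F p 0 1 / gram F p 0 0 *
          (gram F p 0 0 * weingarten F p 0 1 - gram F p 0 1 * weingarten F p 0 0)) ^ 2 +
        4 * ‖normalVec F p‖ ^ 2 *
          ((gram F p 0 0 * weingarten F p 0 1 - gram F p 0 1 * weingarten F p 0 0) /
            gram F p 0 0) ^ 2 := by
  have hN : ‖normalVec F p‖ ^ 2 ≠ 0 := (pow_pos (norm_pos_iff.2 (hF.ne_zero p)) 2).ne'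
  have e : gram F p 1 0 = gram F p 0 1 := by rw [gram_apply, gram_apply, real_inner_comm]
  have hdet : ‖normalVec F p‖ ^ 2 = gram F p 0 0 * gram F p 1 1 - gram F p 0 1 ^ 2 := by
    rw [← gram_det, Matrix.det_fin_two, e]; ring
  have h := discr_identity (E := gram F p 0 0) (F := gram F p 0 1) (G := gram F p 1 1)
    (a := weingarten F p 0 0) (b := weingarten F p 0 1) (c := weingarten F p 1 1)
    (hF.gram_pos p).ne'
  rw [← hdet] at h
  rw [← h, trace_shapeOp, det_shapeOp, hF.weingarten_symm]
  generalize ‖normalVec F p‖ ^ 2 = N at hN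
  field_simp

/-- The shape operator has real eigenvalues, being self-adjoint for the induced metric. -/
lemma Immersed.discr_nonneg {F : S2 → E3} (hF : Immersed F) (p : S2) :
    0 ≤ (shapeOp F p).trace ^ 2 - 4 * (shapeOp F p).det := by
  have hN : 0 < (‖normalVec F p‖ ^ 2) ^ 2 :=
    pow_pos (pow_pos (norm_pos_iff.2 (hF.ne_zero p)) 2) 2
  refine nonneg_of_mul_nonneg_right ?_ hN
  rw [hF.discr_eq]
  positivity

lemma spectrum_fin_two {L : Matrix (Fin 2) (Fin 2) ℝ} (h : 0 ≤ L.trace ^ 2 - 4 * L.det) :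
    spectrum ℝ L = {(L.trace + √(L.trace ^ 2 - 4 * L.det)) / 2,
      (L.trace - √(L.trace ^ 2 - 4 * L.det)) / 2} := by
  ext r
  rw [Matrix.mem_spectrum_iff_isRoot_charpoly, Matrix.charpoly_fin_two]
  have hs := Real.sq_sqrt h
  set d := √(L.trace ^ 2 - 4 * L.det)
  simp only [Polynomial.IsRoot.def, Polynomial.eval_add, Polynomial.eval_sub, Polynomial.eval_pow,
    Polynomial.eval_mul, Polynomial.eval_X, Polynomial.eval_C, mem_insert_iff, mem_singleton_iff]
  have e : r ^ 2 - L.trace * r + L.det = (r - (L.trace + d) / 2) * (r - (L.trace - d) / 2) := by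
    linear_combination (1 / 4) * hs
  rw [e, mul_eq_zero, sub_eq_zero, sub_eq_zero]

lemma Immersed.kappa_add {F : S2 → E3} (hF : Immersed F) (p : S2) :
    kappa1 F p + kappa2 F p = (shapeOp F p).trace := by
  rw [kappa1, kappa2, spectrum_fin_two (hF.discr_nonneg p), csSup_pair, csInf_pair]
  rw [max_add_min]; ring

lemma Immersed.kappa_sub_sq {F : S2 → E3} (hF : Immersed F) (p : S2) :
    (kappa1 F p - kappa2 F p) ^ 2 = (shapeOp F p).trace ^ 2 - 4 * (shapeOp F p).det := by
  rw [kappa1, kappa2, spectrum_fin_two (hF.discr_nonneg p), csSup_pair, csInf_pair,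
    max_sub_min_eq_abs, sq_abs]
  conv_rhs => rw [← Real.sq_sqrt (hF.discr_nonneg p)]
  ring

/-- Where both principal curvatures vanish, so does the differential of the unit normal. The
vanishing of the discriminant and of the trace gives this for the matrix of the second fundamental
form, since the matrix of the metric is positive definite. -/
lemma Immersed.D_unitNormal_eq_zero {F : S2 → E3} (hF : Immersed F) (p : S2)
    (h1 : kappa1 F p - kappa2 F p = 0) (h2 : kappa1 F p + kappa2 F p = 0) :
    D (unitNormal F) p = 0 := by
  have hN : 0 < ‖normalVec F p‖ ^ 2 := pow_pos (norm_pos_iff.2 (hF.ne_zero p)) 2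
  have hE := hF.gram_pos p
  have ht := hF.kappa_add p
  have hd := hF.discr_eq p
  rw [← hF.kappa_sub_sq, h1, zero_pow two_ne_zero, mul_zero] at hd
  rw [h2, trace_shapeOp, hF.weingarten_symm] at ht
  have e : gram F p 1 0 = gram F p 0 1 := by rw [gram_apply, gram_apply, real_inner_comm]
  have hdet : ‖normalVec F p‖ ^ 2 = gram F p 0 0 * gram F p 1 1 - gram F p 0 1 ^ 2 := by
    rw [← gram_det, Matrix.det_fin_two, e]; ring
  generalize gram F p 0 0 = E at *
  generalize gram F p 0 1 = G' at *
  generalize gram F p 1 1 = G at *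
  generalize ha : weingarten F p 0 0 = a at *
  generalize hb : weingarten F p 0 1 = b at *
  generalize hc : weingarten F p 1 1 = c at *
  generalize ‖normalVec F p‖ ^ 2 = N at *
  have k1 : (E * b - G' * a) / E = 0 := by
    have : 0 ≤ (E * c - G * a - 2 * G' / E * (E * b - G' * a)) ^ 2 := sq_nonneg _
    have : 0 ≤ ((E * b - G' * a) / E) ^ 2 := sq_nonneg _
    have : ((E * b - G' * a) / E) ^ 2 = 0 := by nlinarith
    exact pow_eq_zero_iff two_ne_zero |>.1 this
  have k2 : E * b - G' * a = 0 := by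
    rcases div_eq_zero_iff.1 k1 with h | h
    · exact h
    · exact absurd h hE.ne'
  rw [k1, k2] at hd
  have k3 : E * c - G * a = 0 := by
    have : (E * c - G * a) ^ 2 = 0 := by linarith
    exact pow_eq_zero_iff two_ne_zero |>.1 this
  have k4 : G * a - G' * (b + b) + E * c = 0 := by
    have := neg_eq_zero.1 ht.symm
    rcases mul_eq_zero.1 this with h | h
    · exact absurd h (inv_ne_zero hN.ne')
    · exact h
  have a0 : a = 0 := by
    have : a * N = 0 := by
      rw [hdet]; linear_combination (E / 2) * k4 - (E / 2) * k3 + G' * k2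
    rcases mul_eq_zero.1 this with h | h
    · exact h
    · exact absurd h hN.ne'
  subst a0
  have b0 : b = 0 := by
    have : E * b = 0 := by linarith
    exact (mul_eq_zero.1 this).resolve_left hE.ne'
  have c0 : c = 0 := by
    have : E * c = 0 := by linarith
    exact (mul_eq_zero.1 this).resolve_left hE.ne'
  subst b0 c0
  have h10 := (hF.weingarten_symm p).trans hb
  have k : ∀ i, D (unitNormal F) p (frame p i) = 0 := by
    intro i
    refine hF.eq_zero_of_inner p (hF.inner_unitNormal_D_unitNormal p _) ?_ ?_
    · fin_cases i
      · exact ha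
      · exact h10
    · fin_cases i
      · exact hb
      · exact hc
  ext1 x
  rw [D_frame hF.smooth_unitNormal, k, k]
  simp

/-! ### The gradient -/

/-- The squared norm of the gradient without reference to a frame. -/
lemma Immersed.gradNormSq_eq {F : S2 → E3} (hF : Immersed F) (h : S2 → ℝ) (p : S2) :
    gradNormSq F h p = (‖normalVec F p‖ ^ 2)⁻¹ *
      ‖wedge (ContinuousLinearMap.lsmul ℝ ℝ) (D h p) (D F p) p‖ ^ 2 := by
  have hdet : IsUnit (gram F p).det := (hF.det_gram_pos p).ne'.isUnit
  rw [gradNormSq, grad, Matrix.mulVec_mulVec, Matrix.mul_nonsing_inv _ hdet, Matrix.one_mulVec,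
    gram_inv, wedge_frame, norm_smul, mul_pow, Real.norm_eq_abs, sq_abs, sgn_sq, one_mul,
    ← real_inner_self_eq_norm_sq (_ - _)]
  simp only [inner_sub_left, inner_sub_right, ContinuousLinearMap.lsmul_apply,
    real_inner_smul_left, real_inner_smul_right, gram_apply]
  simp [dotProduct, Matrix.mulVec, Fin.sum_univ_two]
  ring

end Surface

/-! ### The elastic metric of a normal variation of the surface -/

section SurfaceVariation

open Set Filter Topology

lemma D_add_smul {F Y : S2 → E3} (hF : Smooth F) (hY : Smooth Y) (p : S2) (ε : ℝ) :
    D (F + ε • Y) p = D F p + ε • D Y p :=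
  ((hF.hasFDerivAt p).add ((hY.hasFDerivAt p).const_smul ε)).fderiv

lemma Smooth.add_smul {F Y : S2 → E3} (hF : Smooth F) (hY : Smooth Y) (ε : ℝ) :
    Smooth (F + ε • Y) := SmoothFam.add hF ((smoothFam_const ε).smul hY)

lemma gramVar_apply {F Y : S2 → E3} (hF : Smooth F) (hY : Smooth Y) (p : S2) (i j : Fin 2) :
    gramVar F Y p i j = ⟪D Y p (frame p i), D F p (frame p j)⟫ +
      ⟪D F p (frame p i), D Y p (frame p j)⟫ := by
  have h : ∀ i, HasDerivAt (fun ε : ℝ => D (F + ε • Y) p (frame p i)) (D Y p (frame p i)) 0 := by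
    intro i
    simp only [D_add_smul hF hY, add_apply, smul_apply]
    simpa using ((hasDerivAt_id (0 : ℝ)).smul_const (D Y p (frame p i))).const_add
      (D F p (frame p i))
  have h1 := ((h i).inner ℝ (h j)).deriv
  simp only [zero_smul, add_zero] at h1
  rw [add_comm]
  exact h1

/-- The normal field `h ν`. -/
def normalField (F : S2 → E3) (h : S2 → ℝ) (p : S2) : E3 := h p • unitNormal F p

lemma Immersed.smooth_normalField {F : S2 → E3} (hF : Immersed F) {h : S2 → ℝ} (hh : Smooth h) :
    Smooth (normalField F h) := SmoothFam.smul hh hF.smooth_unitNormal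

lemma Immersed.D_normalField {F : S2 → E3} (hF : Immersed F) {h : S2 → ℝ} (hh : Smooth h)
    (p : S2) (x : E3) :
    D (normalField F h) p x = D h p x • unitNormal F p + h p • D (unitNormal F) p x := by
  have h1 := ((hh.hasFDerivAt p).smul (hF.smooth_unitNormal.hasFDerivAt p)).fderiv
  have h2 : D (normalField F h) p = fderiv ℝ ((fun x => h (radial x)) • fun x =>
    unitNormal F (radial x)) p := rfl
  rw [h2, h1]
  simp [add_comm]

/-- The variation of the metric under a normal variation is `-2 h` times the second fundamental
form. -/
lemma Immersed.inv_gram_mul_gramVar {F : S2 → E3} (hF : Immersed F) {h : S2 → ℝ} (hh : Smooth h)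
    (p : S2) : (gram F p)⁻¹ * gramVar F (normalField F h) p = (-2 * h p) • shapeOp F p := by
  have : gramVar F (normalField F h) p = (-2 * h p) •
      Matrix.of fun i j => -⟪D (unitNormal F) p (frame p i), D F p (frame p j)⟫ := by
    ext i j
    rw [gramVar_apply hF.smooth (hF.smooth_normalField hh), hF.D_normalField hh,
      hF.D_normalField hh, inner_add_left, inner_add_right, real_inner_smul_left,
      real_inner_smul_left, real_inner_smul_right, real_inner_smul_right,
      inner_unitNormal_D F hF.smooth, real_inner_comm (unitNormal F p),
      inner_unitNormal_D F hF.smooth, real_inner_comm _ (D F p (frame p i)),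
      hF.inner_D_unitNormal_symm p (frame p j)]
    simp
    ring
  rw [this, shapeOp, Matrix.mul_smul]

lemma trace_traceless_smul_sq (r : ℝ) (L : Matrix (Fin 2) (Fin 2) ℝ) :
    (traceless (r • L) ^ 2).trace = r ^ 2 / 2 * (L.trace ^ 2 - 4 * L.det) := by
  simp [traceless, sq, Matrix.trace_fin_two, Matrix.mul_apply, Fin.sum_univ_two,
    Matrix.det_fin_two]
  ring

lemma Immersed.trace_traceless_sq {F : S2 → E3} (hF : Immersed F) {h : S2 → ℝ} (hh : Smooth h)
    (p : S2) : (traceless ((gram F p)⁻¹ * gramVar F (normalField F h) p) ^ 2).trace =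
      2 * (h p ^ 2 * (kappa1 F p - kappa2 F p) ^ 2) := by
  rw [hF.inv_gram_mul_gramVar hh, trace_traceless_smul_sq, hF.kappa_sub_sq]
  ring

lemma Immersed.trace_sq {F : S2 → E3} (hF : Immersed F) {h : S2 → ℝ} (hh : Smooth h)
    (p : S2) : ((gram F p)⁻¹ * gramVar F (normalField F h) p).trace ^ 2 =
      4 * (h p ^ 2 * (kappa1 F p + kappa2 F p) ^ 2) := by
  rw [hF.inv_gram_mul_gramVar hh, Matrix.trace_smul, hF.kappa_add, smul_eq_mul]
  ring

/-- Under a normal variation `h ν` the variation of the unit normal is the tangent vector `-∇h`: it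
is orthogonal to `ν`, and its products with the vectors `dF y` are `-dh y`, as follows from
differentiating `⟨ν, ν⟩ = 1` and `⟨ν, dF y⟩ = 0`. -/
lemma Immersed.norm_normalVar_sq {F : S2 → E3} (hF : Immersed F) {h : S2 → ℝ} (hh : Smooth h)
    (p : S2) : ‖normalVar F (normalField F h) p‖ ^ 2 = gradNormSq F h p := by
  have hY := hF.smooth_normalField hh
  set Y := normalField F h with hYdef
  have hD : ∀ x, HasDerivAt (fun ε : ℝ => D (F + ε • Y) p x) (D Y p x) 0 := by
    intro x
    simp only [D_add_smul hF.smooth hY, add_apply, smul_apply]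
    simpa using ((hasDerivAt_id (0 : ℝ)).smul_const (D Y p x)).const_add (D F p x)
  have hzero : F + (0 : ℝ) • Y = F := by rw [zero_smul, add_zero]
  have hW : DifferentiableAt ℝ (fun ε : ℝ => normalVec (F + ε • Y) p) 0 := by
    simp only [normalVec_eq_sgn]
    have h1 := ((crossL.hasFDerivAt.comp_hasDerivAt (0 : ℝ) (hD (frame p 0))).clm_apply
      (hD (frame p 1))).const_smul (sgn p)
    exact h1.differentiableAt
  have hW0 : normalVec (F + (0 : ℝ) • Y) p ≠ 0 := by rw [hzero]; exact hF.ne_zero p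
  have hN : DifferentiableAt ℝ (fun ε : ℝ => unitNormal (F + ε • Y) p) 0 :=
    ((hW.norm ℝ hW0).inv (norm_ne_zero_iff.2 hW0)).smul hW
  have hN' : HasDerivAt (fun ε : ℝ => unitNormal (F + ε • Y) p) (normalVar F Y p) 0 :=
    hN.hasDerivAt
  have hnn : ∀ᶠ ε : ℝ in 𝓝 0, ⟪unitNormal (F + ε • Y) p, unitNormal (F + ε • Y) p⟫ = 1 := by
    filter_upwards [hW.continuousAt.eventually_ne hW0] with ε hε
    rw [real_inner_self_eq_norm_sq, unitNormal, norm_smul, norm_inv, norm_norm,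
      inv_mul_cancel₀ (norm_ne_zero_iff.2 hε), one_pow]
  have e1 : ⟪unitNormal F p, normalVar F Y p⟫ = 0 := by
    have h1 := hN'.inner ℝ hN'
    have h2 := h1.unique ((hasDerivAt_const (0 : ℝ) (1 : ℝ)).congr_of_eventuallyEq hnn)
    rw [hzero, real_inner_comm (unitNormal F p) (normalVar F Y p)] at h2
    linarith
  have e2 : ∀ i, ⟪normalVar F Y p, D F p (frame p i)⟫ = -D h p (frame p i) := by
    intro i
    have h1 := hN'.inner ℝ (hD (frame p i))
    simp only [inner_unitNormal_D _ (hF.smooth.add_smul hY _)] at h1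
    have h2 := h1.unique (hasDerivAt_const (0 : ℝ) (0 : ℝ))
    rw [hzero, hF.D_normalField hh, inner_add_right, real_inner_smul_right, real_inner_smul_right,
      hF.inner_unitNormal_self, hF.inner_unitNormal_D_unitNormal] at h2
    linarith
  have e3 : ⟪normalVar F Y p, normalVec F p⟫ = 0 := by
    rw [unitNormal, real_inner_smul_left, mul_eq_zero, inv_eq_zero] at e1
    rw [real_inner_comm]
    exact e1.resolve_left (norm_ne_zero_iff.2 (hF.ne_zero p))
  have e4 := norm_cross_sq (normalVar F Y p) (normalVec F p)
  have e5 : cross (normalVar F Y p) (normalVec F p) =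
      wedge (ContinuousLinearMap.lsmul ℝ ℝ) (D h p) (D F p) p := by
    rw [normalVec_eq_sgn, cross_smul_right, cross_cross_eq, e2, e2, wedge_frame]
    simp only [ContinuousLinearMap.lsmul_apply]
    module
  rw [e3, e5, zero_pow two_ne_zero, sub_zero] at e4
  rw [hF.gradNormSq_eq, e4]
  have := norm_ne_zero_iff.2 (hF.ne_zero p)
  field_simp

/-- The surface part of the geometric expression. -/
lemma Immersed.surfElastic_eq {F : S2 → E3} (hF : Immersed F) {X : S2 → E3} (hX : Smooth X)
    (a b c : ℝ) : surfElastic (a / 2) (b / 4) c F (surfNormalPart F X) =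
      a * areaIntegral F (fun p => h2 F X p ^ 2 * (kappa1 F p - kappa2 F p) ^ 2) +
      b * areaIntegral F (fun p => h2 F X p ^ 2 * (kappa1 F p + kappa2 F p) ^ 2) +
      c * areaIntegral F (fun p => gradNormSq F (h2 F X) p) := by
  have hh : Smooth (h2 F X) := SmoothFam.inner hX hF.smooth_unitNormal
  have e : surfNormalPart F X = normalField F (h2 F X) := rfl
  rw [e, surfElastic]
  simp only [hF.trace_traceless_sq hh, hF.trace_sq hh, hF.norm_normalVar_sq hh]
  have hint : ∀ (r : ℝ) (φ : S2 → ℝ), areaIntegral F (fun p => r * φ p) = r * areaIntegral F φ := by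
    intro r φ
    simp only [areaIntegral, mul_assoc]
    exact MeasureTheory.integral_const_mul _ _
  rw [hint, hint]
  ring

end SurfaceVariation

/-! ### The Darboux frame -/

section Curve

open Set Filter Topology

variable {V : Type*} [NormedAddCommGroup V] [NormedSpace ℝ V]

lemma Immersed.ne_zero_of_tangent {F : S2 → E3} (hF : Immersed F) (p : S2) {w : E3}
    (hw : ⟪(p : E3), w⟫ = 0) (h : D F p w = 0) : w = 0 := by
  have hN := hF.ne_zero p
  have hw' := eq_frame p w
  rw [real_inner_comm] at hw
  rw [hw, zero_smul, add_zero] at hw'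
  set a := ⟪w, frame p 0⟫
  set b := ⟪w, frame p 1⟫
  rw [D_frame hF.smooth] at h
  have h1 : a • cross (D F p (frame p 0)) (D F p (frame p 1)) = 0 := by
    have := congrArg (fun y => cross y (D F p (frame p 1))) h
    simp only [cross_add_left, cross_smul_left] at this
    have hz : ∀ y : E3, cross y y = 0 := fun y => by apply ext_three <;> simp <;> ring
    have hz' : ∀ y : E3, cross 0 y = 0 := fun y => by apply ext_three <;> simp
    simpa [hz, hz'] using this
  have h2 : b • cross (D F p (frame p 0)) (D F p (frame p 1)) = 0 := by
    have := congrArg (fun y => crossL (D F p (frame p 0)) y) h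
    simp only [map_add, map_smul, crossL_apply] at this
    have hz : ∀ y : E3, cross y y = 0 := fun y => by apply ext_three <;> simp <;> ring
    have hz' : ∀ y : E3, cross y 0 = 0 := fun y => by apply ext_three <;> simp
    simpa [hz, hz'] using this
  have hc : cross (D F p (frame p 0)) (D F p (frame p 1)) ≠ 0 := by
    intro h0
    rw [normalVec_eq_sgn, h0, smul_zero] at hN
    exact hN rfl
  have ha := (smul_eq_zero.1 h1).resolve_right hc
  have hb := (smul_eq_zero.1 h2).resolve_right hc
  rw [hw', ha, hb]; simp

lemma dot_curve {F : S2 → E3} (hF : Smooth F) (z : Circle) :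
    dot (curve F) z = D F (equator z) (equatorDir (equator z)) := dot_equator hF z

lemma Immersed.dot_curve_ne_zero {F : S2 → E3} (hF : Immersed F) (z : Circle) :
    dot (curve F) z ≠ 0 := by
  rw [dot_curve hF.smooth]
  intro h
  exact equatorDir_ne_zero z (hF.ne_zero_of_tangent _ (inner_equatorDir _) h)

lemma Immersed.speed_ne_zero {F : S2 → E3} (hF : Immersed F) (z : Circle) :
    speed (curve F) z ≠ 0 := norm_ne_zero_iff.2 (hF.dot_curve_ne_zero z)

lemma ImmersedFam.speed {F : ℝ → S2 → E3} (hF : ImmersedFam F) :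
    SmoothLoop fun s z => speed (curve (F s)) z :=
  hF.smooth.loop.dot.norm fun s z => (hF.immersed s).dot_curve_ne_zero z

lemma ImmersedFam.darbouxT {F : ℝ → S2 → E3} (hF : ImmersedFam F) :
    SmoothLoop fun s z => darbouxT (F s) z :=
  (hF.speed.inv fun s z => (hF.immersed s).speed_ne_zero z).smul hF.smooth.loop.dot

lemma ImmersedFam.darbouxNu {F : ℝ → S2 → E3} (hF : ImmersedFam F) :
    SmoothLoop fun s z => darbouxNu (F s) z := hF.unitNormal.loop

lemma ImmersedFam.darbouxN {F : ℝ → S2 → E3} (hF : ImmersedFam F) :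
    SmoothLoop fun s z => darbouxN (F s) z := hF.darbouxNu.cross hF.darbouxT

lemma ImmersedFam.Ds {F : ℝ → S2 → E3} (hF : ImmersedFam F) {f : ℝ → Circle → V}
    (hf : SmoothLoop f) : SmoothLoop fun s z => Ds (curve (F s)) (f s) z :=
  (hF.speed.inv fun s z => (hF.immersed s).speed_ne_zero z).smul hf.dot

lemma ImmersedFam.kappaG {F : ℝ → S2 → E3} (hF : ImmersedFam F) :
    SmoothLoop fun s z => kappaG (F s) z := (hF.Ds hF.darbouxT).inner hF.darbouxN

lemma ImmersedFam.kappaN {F : ℝ → S2 → E3} (hF : ImmersedFam F) :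
    SmoothLoop fun s z => kappaN (F s) z := (hF.Ds hF.darbouxT).inner hF.darbouxNu

lemma ImmersedFam.tauG {F : ℝ → S2 → E3} (hF : ImmersedFam F) :
    SmoothLoop fun s z => tauG (F s) z := (hF.Ds hF.darbouxN).inner hF.darbouxNu

/-- A single map on the circle is smooth if the constant family is. -/
def SmoothC (f : Circle → V) : Prop := SmoothLoop fun _ : ℝ => f

lemma SmoothC.hasDerivAt {f : Circle → V} (hf : SmoothC f) (θ : ℝ) :
    HasDerivAt (fun θ => f (Circle.exp θ)) (dot f (Circle.exp θ)) θ := by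
  rw [dot_exp]
  exact ((SmoothLoop.contDiff hf 0).differentiable (by simp) θ).hasDerivAt

lemma dot_smul {r : Circle → ℝ} {f : Circle → V} (hr : SmoothC r) (hf : SmoothC f) (z : Circle) :
    dot (fun z => r z • f z) z = r z • dot f z + dot r z • f z := by
  obtain ⟨θ, rfl⟩ := exists_exp z
  rw [dot_exp]
  exact ((hr.hasDerivAt θ).smul (hf.hasDerivAt θ)).deriv

lemma dot_add {f g : Circle → V} (hf : SmoothC f) (hg : SmoothC g) (z : Circle) :
    dot (fun z => f z + g z) z = dot f z + dot g z := by
  obtain ⟨θ, rfl⟩ := exists_exp z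
  rw [dot_exp]
  exact ((hf.hasDerivAt θ).add (hg.hasDerivAt θ)).deriv

lemma dot_add_smul {f g : Circle → V} (hf : SmoothC f) (hg : SmoothC g) (ε : ℝ) (z : Circle) :
    dot (f + ε • g) z = dot f z + ε • dot g z := by
  obtain ⟨θ, rfl⟩ := exists_exp z
  rw [dot_exp]
  exact ((hf.hasDerivAt θ).add ((hg.hasDerivAt θ).const_smul ε)).deriv

lemma dot_inner_add {f g : Circle → E3} (hf : SmoothC f) (hg : SmoothC g) {c : ℝ}
    (h : ∀ z, ⟪f z, g z⟫ = c) (z : Circle) : ⟪f z, dot g z⟫ + ⟪dot f z, g z⟫ = 0 := by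
  obtain ⟨θ, rfl⟩ := exists_exp z
  have h1 := (hf.hasDerivAt θ).inner ℝ (hg.hasDerivAt θ)
  simp only [h] at h1
  exact h1.unique (hasDerivAt_const θ c)

lemma Ds_inner_add (k : Circle → E3) {f g : Circle → E3} (hf : SmoothC f) (hg : SmoothC g) {c : ℝ}
    (h : ∀ z, ⟪f z, g z⟫ = c) (z : Circle) : ⟪f z, Ds k g z⟫ + ⟪Ds k f z, g z⟫ = 0 := by
  rw [Ds, Ds, real_inner_smul_left, real_inner_smul_right, ← mul_add, dot_inner_add hf hg h,
    mul_zero]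

namespace Immersed

variable {F : S2 → E3} (hF : Immersed F)
include hF

lemma smoothC_T : SmoothC (darbouxT F) := hF.const.darbouxT
lemma smoothC_N : SmoothC (darbouxN F) := hF.const.darbouxN
lemma smoothC_Nu : SmoothC (darbouxNu F) := hF.const.darbouxNu
lemma smoothC_curve : SmoothC (curve F) := hF.const.smooth.loop

lemma norm_T (z : Circle) : ‖darbouxT F z‖ = 1 := by
  rw [darbouxT, tangent, norm_smul, norm_inv, speed, norm_norm, inv_mul_cancel₀]
  exact norm_ne_zero_iff.2 (hF.dot_curve_ne_zero z)

lemma inner_T_T (z : Circle) : ⟪darbouxT F z, darbouxT F z⟫ = 1 := by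
  rw [real_inner_self_eq_norm_sq, hF.norm_T, one_pow]

lemma inner_Nu_Nu (z : Circle) : ⟪darbouxNu F z, darbouxNu F z⟫ = 1 :=
  hF.inner_unitNormal_self _

lemma inner_Nu_T (z : Circle) : ⟪darbouxNu F z, darbouxT F z⟫ = 0 := by
  rw [darbouxT, tangent, dot_curve hF.smooth, real_inner_smul_right, darbouxNu,
    inner_unitNormal_D F hF.smooth, mul_zero]

omit hF in
lemma inner_Nu_N (z : Circle) : ⟪darbouxNu F z, darbouxN F z⟫ = 0 := inner_cross_left _ _

omit hF in
lemma inner_T_N (z : Circle) : ⟪darbouxT F z, darbouxN F z⟫ = 0 := inner_cross_right _ _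

lemma inner_N_N (z : Circle) : ⟪darbouxN F z, darbouxN F z⟫ = 1 := by
  rw [darbouxN, inner_cross_cross, hF.inner_Nu_Nu, hF.inner_T_T, hF.inner_Nu_T]; simp

lemma darboux_expand (z : Circle) (x : E3) :
    x = ⟪x, darbouxT F z⟫ • darbouxT F z + ⟪x, darbouxN F z⟫ • darbouxN F z +
      ⟪x, darbouxNu F z⟫ • darbouxNu F z := by
  have hν : ‖darbouxNu F z‖ = 1 := hF.norm_unitNormal _
  have h := eq_smul_cross hν (hF.norm_T z) (hF.inner_Nu_T z) x
  conv_lhs => rw [h]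
  rw [darbouxN]
  abel

end Immersed
end Curve

/-! ### The elastic metric of a normal variation of the curve -/

section CurveVariation

open Set Filter Topology

lemma hasDerivAt_dot_variation {f Y : Circle → E3} (hf : SmoothC f) (hY : SmoothC Y) (z : Circle) :
    HasDerivAt (fun ε : ℝ => dot (f + ε • Y) z) (dot Y z) 0 := by
  simp only [dot_add_smul hf hY]
  simpa using ((hasDerivAt_id (0 : ℝ)).smul_const (dot Y z)).const_add (dot f z)

lemma hasDerivAt_speed_variation {f Y : Circle → E3} (hf : SmoothC f) (hY : SmoothC Y) (z : Circle)
    (h0 : dot f z ≠ 0) :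
    HasDerivAt (fun ε : ℝ => speed (f + ε • Y) z) ⟪dot Y z, tangent f z⟫ 0 := by
  have e0 : dot (f + (0 : ℝ) • Y) z = dot f z := by rw [zero_smul, add_zero]
  have h1 := (hasDerivAt_dot_variation hf hY z).norm_sq.sqrt (by
    rw [e0]; exact pow_ne_zero 2 (norm_ne_zero_iff.2 h0))
  simp only [Real.sqrt_sq (norm_nonneg _), e0] at h1
  refine h1.congr_deriv ?_
  rw [tangent, real_inner_smul_right, speed, real_inner_comm]
  have := norm_ne_zero_iff.2 h0
  field_simp

lemma speedVar_eq {f Y : Circle → E3} (hf : SmoothC f) (hY : SmoothC Y) (z : Circle)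
    (h0 : dot f z ≠ 0) : speedVar f Y z / speed f z = ⟪Ds f Y z, tangent f z⟫ := by
  rw [speedVar, (hasDerivAt_speed_variation hf hY z h0).deriv, Ds, real_inner_smul_left,
    div_eq_inv_mul]

/-- The variation of the unit tangent is the part of `D_s (δf)` orthogonal to it. -/
lemma tangentVar_eq {f Y : Circle → E3} (hf : SmoothC f) (hY : SmoothC Y) (z : Circle)
    (h0 : dot f z ≠ 0) :
    tangentVar f Y z = Ds f Y z - ⟪Ds f Y z, tangent f z⟫ • tangent f z := by
  have e0 : dot (f + (0 : ℝ) • Y) z = dot f z := by rw [zero_smul, add_zero]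
  have e1 : speed (f + (0 : ℝ) • Y) z = speed f z := by rw [zero_smul, add_zero]
  have hr : speed f z ≠ 0 := norm_ne_zero_iff.2 h0
  have h1 := ((hasDerivAt_speed_variation hf hY z h0).inv (by rw [e1]; exact hr)).smul
    (hasDerivAt_dot_variation hf hY z)
  have h2 : HasDerivAt (fun ε : ℝ => tangent (f + ε • Y) z) _ 0 := h1
  rw [tangentVar, h2.deriv]
  simp only [Pi.inv_apply, e0, e1]
  rw [Ds, real_inner_smul_left, tangent, smul_smul, sub_eq_add_neg, ← neg_smul]
  congr 2
  field_simp

lemma Ds_add (k : Circle → E3) {f g : Circle → E3} (hf : SmoothC f) (hg : SmoothC g) (z : Circle) :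
    Ds k (fun z => f z + g z) z = Ds k f z + Ds k g z := by
  rw [Ds, dot_add hf hg, smul_add]; rfl

lemma Ds_smul (k : Circle → E3) {r : Circle → ℝ} {f : Circle → E3} (hr : SmoothC r)
    (hf : SmoothC f) (z : Circle) :
    Ds k (fun z => r z • f z) z = r z • Ds k f z + Ds k r z • f z := by
  rw [Ds, Ds, Ds, dot_smul hr hf, smul_add, smul_comm, smul_assoc]

namespace Immersed

variable {F : S2 → E3} (hF : Immersed F)
include hF

/-- The variation `u n + v ν` of the curve. -/
def _root_.FlagShape.curveNormalField (F : S2 → E3) (u v : Circle → ℝ) (z : Circle) : E3 :=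
  u z • darbouxN F z + v z • darbouxNu F z

lemma curveNormalPart_eq (X : S2 → E3) : curveNormalPart (curve F) (curve X) =
    curveNormalField F (h1 F X) fun z => h2 F X (equator z) := by
  funext z
  have := hF.darboux_expand z (X (equator z))
  rw [curveNormalPart, curveNormalField, curve, sub_eq_iff_eq_add]
  conv_lhs => rw [this]
  simp only [h1, h2, darbouxT, darbouxNu]
  abel

variable {u v : Circle → ℝ} (hu : SmoothC u) (hv : SmoothC v)
include hu hv

lemma smoothC_curveNormalField : SmoothC (curveNormalField F u v) :=
  (SmoothLoop.smul hu hF.smoothC_N).add (SmoothLoop.smul hv hF.smoothC_Nu)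

lemma Ds_curveNormalField (z : Circle) : Ds (curve F) (curveNormalField F u v) z =
    (u z • Ds (curve F) (darbouxN F) z + Ds (curve F) u z • darbouxN F z) +
    (v z • Ds (curve F) (darbouxNu F) z + Ds (curve F) v z • darbouxNu F z) := by
  rw [← Ds_smul _ hu hF.smoothC_N, ← Ds_smul _ hv hF.smoothC_Nu]
  exact Ds_add _ (SmoothLoop.smul hu hF.smoothC_N) (SmoothLoop.smul hv hF.smoothC_Nu) z

omit hu hv

lemma inner_Ds_N_T (z : Circle) : ⟪Ds (curve F) (darbouxN F) z, darbouxT F z⟫ = -kappaG F z := by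
  have := Ds_inner_add (curve F) hF.smoothC_N hF.smoothC_T
    (fun z => (real_inner_comm _ _).trans (inner_T_N z)) z
  rw [real_inner_comm] at this
  rw [kappaG]; linarith

lemma inner_Ds_N_N (z : Circle) : ⟪Ds (curve F) (darbouxN F) z, darbouxN F z⟫ = 0 := by
  have := Ds_inner_add (curve F) hF.smoothC_N hF.smoothC_N hF.inner_N_N z
  rw [real_inner_comm] at this
  linarith

lemma inner_Ds_Nu_T (z : Circle) :
    ⟪Ds (curve F) (darbouxNu F) z, darbouxT F z⟫ = -kappaN F z := by
  have := Ds_inner_add (curve F) hF.smoothC_Nu hF.smoothC_T hF.inner_Nu_T z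
  rw [real_inner_comm] at this
  rw [kappaN]; linarith

lemma inner_Ds_Nu_N (z : Circle) :
    ⟪Ds (curve F) (darbouxNu F) z, darbouxN F z⟫ = -tauG F z := by
  have := Ds_inner_add (curve F) hF.smoothC_Nu hF.smoothC_N inner_Nu_N z
  rw [real_inner_comm] at this
  rw [tauG]; linarith

lemma inner_Ds_Nu_Nu (z : Circle) : ⟪Ds (curve F) (darbouxNu F) z, darbouxNu F z⟫ = 0 := by
  have := Ds_inner_add (curve F) hF.smoothC_Nu hF.smoothC_Nu hF.inner_Nu_Nu z
  rw [real_inner_comm] at this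
  linarith

lemma Ds_N_eq (z : Circle) : Ds (curve F) (darbouxN F) z =
    (-kappaG F z) • darbouxT F z + tauG F z • darbouxNu F z := by
  conv_lhs => rw [hF.darboux_expand z (Ds (curve F) (darbouxN F) z)]
  rw [hF.inner_Ds_N_T, hF.inner_Ds_N_N, zero_smul, add_zero]
  rfl

include hu hv

lemma inner_Ds_T (z : Circle) :
    ⟪Ds (curve F) (curveNormalField F u v) z, tangent (curve F) z⟫ =
      -(u z * kappaG F z + v z * kappaN F z) := by
  change ⟪_, darbouxT F z⟫ = _
  rw [hF.Ds_curveNormalField hu hv]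
  simp only [inner_add_left, real_inner_smul_left, hF.inner_Ds_N_T, hF.inner_Ds_Nu_T,
    hF.inner_Nu_T, (real_inner_comm _ _).trans (inner_T_N z)]
  ring

lemma inner_Ds_N (z : Circle) :
    ⟪Ds (curve F) (curveNormalField F u v) z, darbouxN F z⟫ =
      Ds (curve F) u z - v z * tauG F z := by
  rw [hF.Ds_curveNormalField hu hv]
  simp only [inner_add_left, real_inner_smul_left, hF.inner_Ds_N_N, hF.inner_Ds_Nu_N,
    inner_Nu_N, hF.inner_N_N]
  ring

lemma inner_Ds_Nu (z : Circle) :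
    ⟪Ds (curve F) (curveNormalField F u v) z, darbouxNu F z⟫ =
      Ds (curve F) v z + u z * tauG F z := by
  rw [hF.Ds_curveNormalField hu hv]
  simp only [inner_add_left, real_inner_smul_left, hF.inner_Ds_Nu_Nu,
    hF.inner_Nu_Nu, (real_inner_comm _ _).trans (inner_Nu_N z)]
  rw [tauG]
  ring

lemma speedVar_sq (z : Circle) :
    (speedVar (curve F) (curveNormalField F u v) z / speed (curve F) z) ^ 2 =
      (u z * kappaG F z + v z * kappaN F z) ^ 2 := by
  rw [speedVar_eq hF.smoothC_curve (hF.smoothC_curveNormalField hu hv) z (hF.dot_curve_ne_zero z),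
    hF.inner_Ds_T hu hv, neg_sq]

lemma inner_tangentVar_N (z : Circle) :
    ⟪tangentVar (curve F) (curveNormalField F u v) z, darbouxN F z⟫ =
      Ds (curve F) u z - v z * tauG F z := by
  rw [tangentVar_eq hF.smoothC_curve (hF.smoothC_curveNormalField hu hv) z
    (hF.dot_curve_ne_zero z), inner_sub_left, hF.inner_Ds_N hu hv, real_inner_smul_left]
  have := inner_T_N (F := F) z
  rw [darbouxT] at this
  rw [this, mul_zero, sub_zero]

lemma inner_tangentVar_Nu (z : Circle) :
    ⟪tangentVar (curve F) (curveNormalField F u v) z, darbouxNu F z⟫ =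
      Ds (curve F) v z + u z * tauG F z := by
  rw [tangentVar_eq hF.smoothC_curve (hF.smoothC_curveNormalField hu hv) z
    (hF.dot_curve_ne_zero z), inner_sub_left, hF.inner_Ds_Nu hu hv, real_inner_smul_left]
  have := (real_inner_comm _ _).trans (hF.inner_Nu_T z)
  rw [darbouxT] at this
  rw [this, mul_zero, sub_zero]

lemma norm_tangentVar_sq (z : Circle) :
    ‖tangentVar (curve F) (curveNormalField F u v) z‖ ^ 2 =
      (Ds (curve F) u z - v z * tauG F z) ^ 2 + (Ds (curve F) v z + u z * tauG F z) ^ 2 := by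
  have e : ⟪tangentVar (curve F) (curveNormalField F u v) z, darbouxT F z⟫ = 0 := by
    have h := hF.inner_T_T z
    rw [darbouxT] at h
    rw [tangentVar_eq hF.smoothC_curve (hF.smoothC_curveNormalField hu hv) z
      (hF.dot_curve_ne_zero z), inner_sub_left, real_inner_smul_left, darbouxT, h, mul_one,
      sub_self]
  rw [← real_inner_self_eq_norm_sq]
  nth_rewrite 2 [hF.darboux_expand z (tangentVar (curve F) (curveNormalField F u v) z)]
  simp only [inner_add_right, real_inner_smul_right, e, hF.inner_tangentVar_N hu hv,
    hF.inner_tangentVar_Nu hu hv]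
  ring

lemma splitCurveElastic_eq (a b c : ℝ) :
    splitCurveElastic a b c F (curveNormalField F u v) =
      a * lineIntegral (curve F) (fun z => (u z * kappaG F z + v z * kappaN F z) ^ 2) +
      b * lineIntegral (curve F) (fun z => (Ds (curve F) u z - v z * tauG F z) ^ 2) +
      c * lineIntegral (curve F) (fun z => (Ds (curve F) v z + u z * tauG F z) ^ 2) := by
  simp only [splitCurveElastic, hF.speedVar_sq hu hv, hF.inner_tangentVar_N hu hv,
    hF.inner_tangentVar_Nu hu hv]

omit hu hv in
lemma lineIntegral_add {φ ψ : Circle → ℝ} (hφ : SmoothC φ) (hψ : SmoothC ψ) :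
    lineIntegral (curve F) (fun z => φ z + ψ z) =
      lineIntegral (curve F) φ + lineIntegral (curve F) ψ := by
  have hs : Continuous fun θ => speed (curve F) (Circle.exp θ) :=
    (hF.const.speed.contDiff 0).continuous
  simp only [lineIntegral, add_mul]
  refine intervalIntegral.integral_add ?_ ?_
  · exact (((SmoothLoop.contDiff hφ 0).continuous).mul hs).intervalIntegrable _ _
  · exact (((SmoothLoop.contDiff hψ 0).continuous).mul hs).intervalIntegrable _ _

lemma curveElastic_eq (a b : ℝ) :
    curveElastic a b (curve F) (curveNormalField F u v) =
      splitCurveElastic a b b F (curveNormalField F u v) := by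
  have hτ : SmoothC (tauG F) := hF.const.tauG
  have hDu : SmoothC (Ds (curve F) u) := hF.const.Ds hu
  have hDv : SmoothC (Ds (curve F) v) := hF.const.Ds hv
  rw [hF.splitCurveElastic_eq hu hv]
  simp only [curveElastic, hF.speedVar_sq hu hv, hF.norm_tangentVar_sq hu hv]
  rw [hF.lineIntegral_add ((SmoothLoop.sub hDu (SmoothLoop.mul hv hτ)).pow 2)
    ((SmoothLoop.add hDv (SmoothLoop.mul hu hτ)).pow 2)]
  ring

end Immersed

lemma Immersed.smooth_h2 {F : S2 → E3} (hF : Immersed F) {X : S2 → E3} (hX : Smooth X) :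
    Smooth (h2 F X) := SmoothFam.inner hX hF.smooth_unitNormal

lemma Immersed.smoothC_h1 {F : S2 → E3} (hF : Immersed F) {X : S2 → E3} (hX : Smooth X) :
    SmoothC (h1 F X) := SmoothLoop.inner (SmoothFam.loop hX) hF.smoothC_N

/-- The elastic metric of the normal components is the geometric expression in `(h₁, h₂)`. -/
lemma Immersed.splitPullbackElastic_eq {F : S2 → E3} (hF : Immersed F) {X : S2 → E3}
    (hX : Smooth X) (a₁ a₂ b₁ b₂ c₁ c₂ : ℝ) :
    splitPullbackElastic a₁ b₁ c₁ (a₂ / 2) (b₂ / 4) c₂ F X =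
      geometricForm a₁ a₂ b₁ b₂ c₁ c₂ F (h1 F X) (h2 F X) := by
  rw [splitPullbackElastic, hF.curveNormalPart_eq, hF.surfElastic_eq hX,
    hF.splitCurveElastic_eq (hF.smoothC_h1 hX) (SmoothFam.loop (hF.smooth_h2 hX)), geometricForm]
  ring

lemma Immersed.pullbackElastic_eq {F : S2 → E3} (hF : Immersed F) {X : S2 → E3}
    (hX : Smooth X) (a₁ a' b₁ b' c' : ℝ) :
    pullbackElastic a₁ b₁ a' b' c' F X = splitPullbackElastic a₁ b₁ b₁ a' b' c' F X := by
  rw [splitPullbackElastic, pullbackElastic, hF.curveNormalPart_eq,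
    hF.curveElastic_eq (hF.smoothC_h1 hX) (SmoothFam.loop (hF.smooth_h2 hX))]

end CurveVariation

/-! ### The bilinear form -/

section Form

open Set Filter Topology MeasureTheory

namespace ImmersedFam

variable {F : ℝ → S2 → E3} (hF : ImmersedFam F)
include hF

lemma trace_shapeOp : SmoothFam fun s p => (shapeOp (F s) p).trace := by
  simp only [trace_shapeOp_eq_wedge]
  exact (((hF.norm_normalVec.pow 2).inv fun s p => pow_ne_zero 2 (norm_ne_zero_iff.2
    (hF.ne_zero s p))).mul ((hF.smooth.D.wedge hF.unitNormal.D _).inner hF.smooth.normalVec)).neg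

lemma det_shapeOp : SmoothFam fun s p => (shapeOp (F s) p).det := by
  simp only [det_shapeOp_eq_wedge]
  exact ((hF.norm_normalVec.pow 2).inv fun s p => pow_ne_zero 2 (norm_ne_zero_iff.2
    (hF.ne_zero s p))).mul (hF.unitNormal.normalVec.inner hF.smooth.normalVec)

lemma kappa_add_sq : SmoothFam fun s p => (kappa1 (F s) p + kappa2 (F s) p) ^ 2 := by
  have : ∀ s p, kappa1 (F s) p + kappa2 (F s) p = (shapeOp (F s) p).trace :=
    fun s p => (hF.immersed s).kappa_add p
  simp only [this]
  exact hF.trace_shapeOp.pow 2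

lemma kappa_sub_sq : SmoothFam fun s p => (kappa1 (F s) p - kappa2 (F s) p) ^ 2 := by
  have : ∀ s p, (kappa1 (F s) p - kappa2 (F s) p) ^ 2 =
      (shapeOp (F s) p).trace ^ 2 - 4 * (shapeOp (F s) p).det :=
    fun s p => (hF.immersed s).kappa_sub_sq p
  simp only [this]
  exact (hF.trace_shapeOp.pow 2).sub ((smoothFam_const (4 : ℝ)).mul hF.det_shapeOp)

end ImmersedFam

lemma Immersed.smooth_kappa_add_sq {F : S2 → E3} (hF : Immersed F) :
    Smooth fun p => (kappa1 F p + kappa2 F p) ^ 2 := hF.const.kappa_add_sq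

lemma Immersed.smooth_kappa_sub_sq {F : S2 → E3} (hF : Immersed F) :
    Smooth fun p => (kappa1 F p - kappa2 F p) ^ 2 := hF.const.kappa_sub_sq

/-- The normal vector times the gradient of `h`, turned by a right angle. -/
def rotGrad (F : S2 → E3) (h : S2 → ℝ) (p : S2) : E3 :=
  wedge (ContinuousLinearMap.lsmul ℝ ℝ) (D h p) (D F p) p

lemma gradNormSq_mul_norm {F : S2 → E3} (hF : Immersed F) (h : S2 → ℝ) (p : S2) :
    gradNormSq F h p * ‖normalVec F p‖ = ‖normalVec F p‖⁻¹ * ⟪rotGrad F h p, rotGrad F h p⟫ := by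
  rw [hF.gradNormSq_eq, real_inner_self_eq_norm_sq, rotGrad]
  have := norm_ne_zero_iff.2 (hF.ne_zero p)
  field_simp

lemma areaIntegral_eq (F : S2 → E3) (φ : S2 → ℝ) : areaIntegral F φ =
    ∫ p, φ p * ‖normalVec F p‖ ∂((volume : Measure E3).toSphere) := by
  simp only [areaIntegral, sqrt_gram_det]

lemma lineIntegral_eq (f : Circle → E3) (φ : Circle → ℝ) : lineIntegral f φ =
    ∫ θ, φ (Circle.exp θ) * speed f (Circle.exp θ) ∂(volume.restrict (Ioc 0 (2 * Real.pi))) := by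
  rw [lineIntegral, intervalIntegral.integral_of_le Real.two_pi_pos.le]

/-! Linearity of `h₁` and `h₂` and of the expressions formed from them. -/

lemma h1_add (F : S2 → E3) (X Y : Field) : h1 F (X + Y : Field) = fun z => h1 F X z + h1 F Y z := by
  funext z; simp [h1, inner_add_left]

lemma h1_smul (F : S2 → E3) (c : ℝ) (X : Field) : h1 F (c • X : Field) = fun z => c * h1 F X z := by
  funext z; simp [h1, real_inner_smul_left]

lemma h2_add (F : S2 → E3) (X Y : Field) : h2 F (X + Y : Field) = fun p => h2 F X p + h2 F Y p := by
  funext z; simp [h2, inner_add_left]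

lemma h2_smul (F : S2 → E3) (c : ℝ) (X : Field) : h2 F (c • X : Field) = fun p => c * h2 F X p := by
  funext z; simp [h2, real_inner_smul_left]

lemma Ds_add_real (k : Circle → E3) {f g : Circle → ℝ} (hf : SmoothC f) (hg : SmoothC g)
    (z : Circle) : Ds k (fun z => f z + g z) z = Ds k f z + Ds k g z := by
  rw [Ds, dot_add hf hg, smul_add]; rfl

lemma Ds_const_mul (k : Circle → E3) (c : ℝ) {f : Circle → ℝ} (hf : SmoothC f)
    (z : Circle) : Ds k (fun z => c * f z) z = c * Ds k f z := by
  obtain ⟨θ, rfl⟩ := exists_exp z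
  have : dot (fun z => c * f z) (Circle.exp θ) = c * dot f (Circle.exp θ) := by
    rw [dot_exp]; exact ((hf.hasDerivAt θ).const_mul c).deriv
  rw [Ds, this, Ds, smul_eq_mul, smul_eq_mul]; ring

lemma rotGrad_add (F : S2 → E3) {h k : S2 → ℝ} (hh : Smooth h) (hk : Smooth k) (p : S2) :
    rotGrad F (fun p => h p + k p) p = rotGrad F h p + rotGrad F k p := by
  have : D (fun p => h p + k p) p = D h p + D k p :=
    ((hh.hasFDerivAt p).add (hk.hasFDerivAt p)).fderiv
  simp only [rotGrad, wedge_frame, this, add_apply, ContinuousLinearMap.lsmul_apply]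
  module

lemma rotGrad_const_mul (F : S2 → E3) (c : ℝ) {h : S2 → ℝ} (hh : Smooth h) (p : S2) :
    rotGrad F (fun p => c * h p) p = c • rotGrad F h p := by
  have : D (fun p => c * h p) p = c • D h p := ((hh.hasFDerivAt p).const_mul c).fderiv
  simp only [rotGrad, wedge_frame, this, smul_apply, ContinuousLinearMap.lsmul_apply, smul_eq_mul]
  module

/-- The coefficients of `a₁`, `b₁`, `c₁` in the integrand along the curve, before squaring. -/
def lineTerm (F : S2 → E3) (i : Fin 3) (u : Circle → ℝ) (v : S2 → ℝ) (z : Circle) : ℝ :=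
  match i with
  | 0 => u z * kappaG F z + v (equator z) * kappaN F z
  | 1 => Ds (curve F) u z - v (equator z) * tauG F z
  | 2 => Ds (curve F) (fun w => v (equator w)) z + u z * tauG F z

lemma ImmersedFam.lineTerm {F : ℝ → S2 → E3} (hF : ImmersedFam F) (i : Fin 3)
    {u : ℝ → Circle → ℝ} {v : ℝ → S2 → ℝ} (hu : SmoothLoop u) (hv : SmoothFam v) :
    SmoothLoop fun s z => lineTerm (F s) i (u s) (v s) z := by
  fin_cases i
  · exact (hu.mul hF.kappaG).add (hv.loop.mul hF.kappaN)
  · exact (hF.Ds hu).sub (hv.loop.mul hF.tauG)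
  · exact (hF.Ds hv.loop).add (hu.mul hF.tauG)

lemma Immersed.smoothC_lineTerm {F : S2 → E3} (hF : Immersed F) (i : Fin 3) (X : Field) :
    SmoothC (lineTerm F i (h1 F X) (h2 F X)) :=
  hF.const.lineTerm i (hF.smoothC_h1 X.smooth) (hF.smooth_h2 X.smooth)

/-- `lineTerm` as a linear map on variations. -/
def lineMap (F : S2 → E3) (hF : Immersed F) (i : Fin 3) : Field →ₗ[ℝ] (Circle → ℝ) where
  toFun X := lineTerm F i (h1 F X) (h2 F X)
  map_add' X Y := by
    have a1 := hF.smoothC_h1 X.smooth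
    have a2 := hF.smoothC_h1 Y.smooth
    have b1 : SmoothC fun w => h2 F X (equator w) := SmoothFam.loop (hF.smooth_h2 X.smooth)
    have b2 : SmoothC fun w => h2 F Y (equator w) := SmoothFam.loop (hF.smooth_h2 Y.smooth)
    funext z
    rw [h1_add, h2_add]
    fin_cases i
    · simp only [lineTerm, Pi.add_apply]; ring
    · simp only [lineTerm, Pi.add_apply, Ds_add_real _ a1 a2]; ring
    · simp only [lineTerm, Pi.add_apply, Ds_add_real _ b1 b2]; ring
  map_smul' c X := by
    have a1 := hF.smoothC_h1 X.smooth
    have b1 : SmoothC fun w => h2 F X (equator w) := SmoothFam.loop (hF.smooth_h2 X.smooth)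
    funext z
    rw [h1_smul, h2_smul]
    fin_cases i
    · simp only [lineTerm, Pi.smul_apply, smul_eq_mul, RingHom.id_apply]; ring
    · simp only [lineTerm, Pi.smul_apply, smul_eq_mul, RingHom.id_apply, Ds_const_mul _ c a1]; ring
    · simp only [lineTerm, Pi.smul_apply, smul_eq_mul, RingHom.id_apply, Ds_const_mul _ c b1]; ring

/-- `h₂` as a linear map on variations. -/
def h2Map (F : S2 → E3) : Field →ₗ[ℝ] (S2 → ℝ) where
  toFun X := h2 F X
  map_add' X Y := by rw [h2_add]; rfl
  map_smul' c X := by rw [h2_smul]; rfl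

/-- The turned gradient of `h₂` as a linear map on variations. -/
def rotGradMap (F : S2 → E3) (hF : Immersed F) : Field →ₗ[ℝ] (S2 → E3) where
  toFun X := rotGrad F (h2 F X)
  map_add' X Y := by
    funext p
    rw [h2_add, rotGrad_add F (hF.smooth_h2 X.smooth) (hF.smooth_h2 Y.smooth)]; rfl
  map_smul' c X := by
    funext p
    rw [h2_smul, rotGrad_const_mul F c (hF.smooth_h2 X.smooth)]; rfl

/-- The bilinear form `(x, y) ↦ ∫ w ⟨T x, T y⟩ dμ` for a linear map `T` into functions. -/
def intForm {α M E : Type*} [MeasurableSpace α] [AddCommGroup M] [Module ℝ M]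
    [NormedAddCommGroup E] [InnerProductSpace ℝ E] (μ : Measure α) (w : α → ℝ)
    (T : M →ₗ[ℝ] (α → E)) (hint : ∀ x y, Integrable (fun a => w a * ⟪T x a, T y a⟫) μ) :
    LinearMap.BilinForm ℝ M :=
  LinearMap.mk₂ ℝ (fun x y => ∫ a, w a * ⟪T x a, T y a⟫ ∂μ)
    (fun x x' y => by
      rw [← integral_add (hint x y) (hint x' y)]
      simp only [map_add, Pi.add_apply, inner_add_left, mul_add])
    (fun c x y => by
      rw [smul_eq_mul, ← integral_const_mul]
      simp only [map_smul, Pi.smul_apply, real_inner_smul_left, mul_left_comm])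
    (fun x y y' => by
      rw [← integral_add (hint x y) (hint x y')]
      simp only [map_add, Pi.add_apply, inner_add_right, mul_add])
    (fun c x y => by
      rw [smul_eq_mul, ← integral_const_mul]
      simp only [map_smul, Pi.smul_apply, real_inner_smul_right, mul_left_comm])

lemma intForm_apply {α M E : Type*} [MeasurableSpace α] [AddCommGroup M] [Module ℝ M]
    [NormedAddCommGroup E] [InnerProductSpace ℝ E] (μ : Measure α) (w : α → ℝ)
    (T : M →ₗ[ℝ] (α → E)) (hint : ∀ x y, Integrable (fun a => w a * ⟪T x a, T y a⟫) μ) (x y : M) :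
    intForm μ w T hint x y = ∫ a, w a * ⟪T x a, T y a⟫ ∂μ := rfl

lemma integrable_of_continuous_S2 {φ : S2 → ℝ} (h : Continuous φ) :
    Integrable φ ((volume : Measure E3).toSphere) :=
  integrableOn_univ.1 (h.continuousOn.integrableOn_compact isCompact_univ)

lemma integrable_of_continuous_angle {φ : ℝ → ℝ} (h : Continuous φ) :
    Integrable φ (volume.restrict (Ioc 0 (2 * Real.pi))) := h.integrableOn_Ioc

/-- The restriction of functions on the circle to functions of the angle. -/
def angleMap : (Circle → ℝ) →ₗ[ℝ] (ℝ → ℝ) where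
  toFun f θ := f (Circle.exp θ)
  map_add' _ _ := rfl
  map_smul' _ _ := rfl

/-- The bilinear form `∫ T X T Y dℓ` for one of the three terms `T` along the curve. -/
def lineForm (F : S2 → E3) (hF : Immersed F) (i : Fin 3) : LinearMap.BilinForm ℝ Field :=
  intForm (volume.restrict (Ioc 0 (2 * Real.pi))) (fun θ => speed (curve F) (Circle.exp θ))
    (angleMap ∘ₗ lineMap F hF i) (fun X Y => integrable_of_continuous_angle
      (((SmoothLoop.contDiff hF.const.speed 0).continuous).mul
        ((((SmoothLoop.contDiff (hF.smoothC_lineTerm i X) 0).continuous).inner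
          ((SmoothLoop.contDiff (hF.smoothC_lineTerm i Y) 0).continuous)))))

lemma lineForm_self (F : S2 → E3) (hF : Immersed F) (i : Fin 3) (X : Field) :
    lineForm F hF i X X = lineIntegral (curve F) fun z => lineTerm F i (h1 F X) (h2 F X) z ^ 2 := by
  rw [lineIntegral_eq, lineForm, intForm_apply]
  congr 1
  funext θ
  change _ * ⟪lineTerm F i (h1 F X) (h2 F X) (Circle.exp θ),
    lineTerm F i (h1 F X) (h2 F X) (Circle.exp θ)⟫ = _
  rw [mul_comm, real_inner_self_eq_norm_sq, Real.norm_eq_abs, sq_abs]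

/-- The bilinear form `∫ h₂(X) h₂(Y) w dA` with a smooth weight `w`. -/
def areaForm (F : S2 → E3) (hF : Immersed F) (w : S2 → ℝ) (hw : Smooth w) :
    LinearMap.BilinForm ℝ Field :=
  intForm (volume : Measure E3).toSphere (fun p => w p * ‖normalVec F p‖) (h2Map F)
    (fun X Y => integrable_of_continuous_S2
      (Smooth.continuous (SmoothFam.mul (SmoothFam.mul hw hF.const.norm_normalVec)
        (SmoothFam.mul (hF.smooth_h2 Y.smooth) (hF.smooth_h2 X.smooth)))))

lemma areaForm_self (F : S2 → E3) (hF : Immersed F) (w : S2 → ℝ) (hw : Smooth w) (X : Field) :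
    areaForm F hF w hw X X = areaIntegral F fun p => h2 F X p ^ 2 * w p := by
  rw [areaIntegral_eq, areaForm, intForm_apply]
  congr 1
  funext p
  change _ * ⟪h2 F X p, h2 F X p⟫ = _
  rw [real_inner_self_eq_norm_sq, Real.norm_eq_abs, sq_abs]; ring

lemma SmoothFam.rotGrad {F : ℝ → S2 → E3} {h : ℝ → S2 → ℝ} (hF : SmoothFam F) (hh : SmoothFam h) :
    SmoothFam fun s p => rotGrad (F s) (h s) p := hh.D.wedge hF.D _

/-- The bilinear form `∫ ⟨∇h₂(X), ∇h₂(Y)⟩ dA`. -/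
def gradForm (F : S2 → E3) (hF : Immersed F) : LinearMap.BilinForm ℝ Field :=
  intForm (volume : Measure E3).toSphere (fun p => ‖normalVec F p‖⁻¹) (rotGradMap F hF)
    (fun X Y => integrable_of_continuous_S2
      (Smooth.continuous (SmoothFam.mul
        (SmoothFam.inv hF.const.norm_normalVec fun _ p => norm_ne_zero_iff.2 (hF.ne_zero p))
        (SmoothFam.inner (SmoothFam.rotGrad hF.smooth (hF.smooth_h2 X.smooth))
          (SmoothFam.rotGrad hF.smooth (hF.smooth_h2 Y.smooth))))))

lemma gradForm_self (F : S2 → E3) (hF : Immersed F) (X : Field) :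
    gradForm F hF X X = areaIntegral F (gradNormSq F (h2 F X)) := by
  rw [areaIntegral_eq, gradForm, intForm_apply]
  congr 1
  funext p
  rw [gradNormSq_mul_norm hF]; rfl

/-- The symmetric bilinear form on variations whose quadratic form is the geometric expression. -/
def flagForm (a₁ a₂ b₁ b₂ c₁ c₂ : ℝ) (F : S2 → E3) (hF : Immersed F) :
    LinearMap.BilinForm ℝ Field :=
  a₁ • lineForm F hF 0 +
  a₂ • areaForm F hF (fun p => (kappa1 F p - kappa2 F p) ^ 2) hF.smooth_kappa_sub_sq +
  b₁ • lineForm F hF 1 +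
  b₂ • areaForm F hF (fun p => (kappa1 F p + kappa2 F p) ^ 2) hF.smooth_kappa_add_sq +
  c₁ • lineForm F hF 2 + c₂ • gradForm F hF

lemma flagForm_self (a₁ a₂ b₁ b₂ c₁ c₂ : ℝ) (F : S2 → E3) (hF : Immersed F) (X : Field) :
    flagForm a₁ a₂ b₁ b₂ c₁ c₂ F hF X X =
      geometricForm a₁ a₂ b₁ b₂ c₁ c₂ F (h1 F X) (h2 F X) := by
  simp only [flagForm, LinearMap.add_apply, LinearMap.smul_apply, lineForm_self, areaForm_self,
    gradForm_self, smul_eq_mul, geometricForm, lineTerm]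

lemma intForm_comm {α M E : Type*} [MeasurableSpace α] [AddCommGroup M] [Module ℝ M]
    [NormedAddCommGroup E] [InnerProductSpace ℝ E] (μ : Measure α) (w : α → ℝ)
    (T : M →ₗ[ℝ] (α → E)) (hint : ∀ x y, Integrable (fun a => w a * ⟪T x a, T y a⟫) μ) (x y : M) :
    intForm μ w T hint x y = intForm μ w T hint y x := by
  simp only [intForm_apply, real_inner_comm]

lemma flagForm_comm (a₁ a₂ b₁ b₂ c₁ c₂ : ℝ) (F : S2 → E3) (hF : Immersed F) (X Y : Field) :
    flagForm a₁ a₂ b₁ b₂ c₁ c₂ F hF X Y = flagForm a₁ a₂ b₁ b₂ c₁ c₂ F hF Y X := by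
  simp only [flagForm, LinearMap.add_apply, LinearMap.smul_apply, lineForm, areaForm, gradForm]
  simp only [intForm_comm _ _ _ _ X Y]

/-! ### Vertical vectors -/

lemma eq_smul_equatorDir (z : Circle) {w : E3} (h : ⟪w, (equator z : E3)⟫ = 0) (h2 : w 2 = 0) :
    w = ⟪w, equatorDir (equator z)⟫ • equatorDir (equator z) := by
  have h3 := norm_coe (equator z)
  have h4 : (equator z : E3) 0 ^ 2 + (equator z : E3) 1 ^ 2 = 1 := by
    have : ⟪(equator z : E3), (equator z : E3)⟫ = 1 := by
      rw [real_inner_self_eq_norm_sq, h3, one_pow]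
    rw [inner_eq_sum, equator_two] at this
    linarith
  rw [inner_eq_sum, h2] at h
  rw [equatorDir_eq, inner_eq_sum]
  apply ext_three
  · simp
    linear_combination (-w 0) * h4 + (equator z : E3) 0 * h
  · simp
    linear_combination (-w 1) * h4 + (equator z : E3) 1 * h
  · simp [h2]

/-- Vertical variations have no normal components. -/
lemma h1_h2_of_mem_Ver (F : PreShape) {X : Field} (hX : X ∈ Ver F) :
    h1 F X = 0 ∧ h2 F X = 0 := by
  obtain ⟨ξ, ⟨hξ1, hξ2⟩, hX⟩ := hX
  have hF := F.immersed
  constructor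
  · funext z
    have h := eq_smul_equatorDir z (hξ1 (equator z)) (hξ2 z)
    have h3 : darbouxT F z = (speed (curve F) z)⁻¹ • D F (equator z) (equatorDir (equator z)) := by
      rw [darbouxT, tangent, dot_curve hF.smooth]
    have h4 := Immersed.inner_T_N (F := F) z
    rw [h1, hX, h, map_smul, real_inner_smul_left]
    rw [h3, real_inner_smul_left, mul_eq_zero, inv_eq_zero] at h4
    rw [h4.resolve_left (hF.speed_ne_zero z), mul_zero]; rfl
  · funext p
    rw [h2, hX, real_inner_comm, inner_unitNormal_D F hF.smooth]; rfl

lemma lineTerm_zero (F : S2 → E3) (i : Fin 3) : lineTerm F i 0 0 = 0 := by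
  funext z
  have : Ds (curve F) (0 : Circle → ℝ) z = 0 := by simp [Ds, dot]
  have h' : Ds (curve F) (fun _ : Circle => (0 : ℝ)) z = 0 := this
  fin_cases i <;> simp [lineTerm, this, h']

lemma rotGrad_zero (F : S2 → E3) : rotGrad F 0 = 0 := by
  funext p
  have : D (0 : S2 → ℝ) p = 0 := (hasFDerivAt_const (0 : ℝ) (p : E3)).fderiv
  simp [rotGrad, wedge_frame, this]

/-- The null directions of the form include those with `h₁ = 0` and `h₂ = 0`. -/
lemma flagForm_eq_zero (a₁ a₂ b₁ b₂ c₁ c₂ : ℝ) (F : S2 → E3) (hF : Immersed F) {X : Field}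
    (hX1 : h1 F X = 0) (hX2 : h2 F X = 0) (Y : Field) :
    flagForm a₁ a₂ b₁ b₂ c₁ c₂ F hF X Y = 0 := by
  have e1 : ∀ i, lineMap F hF i X = 0 := by
    intro i
    change lineTerm F i (h1 F X) (h2 F X) = 0
    rw [hX1, hX2, lineTerm_zero]
  have e2 : h2Map F X = 0 := hX2
  have e3 : rotGradMap F hF X = 0 := by
    change rotGrad F (h2 F X) = 0
    rw [hX2, rotGrad_zero]
  simp [flagForm, lineForm, areaForm, gradForm, intForm_apply, e1, e2, e3]

/-- A linear choice of representatives of classes modulo vertical vectors. -/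
def norSection (F : PreShape) : Nor F →ₗ[ℝ] Field :=
  ((Ver F).mkQ.exists_rightInverse_of_surjective (Submodule.range_mkQ _)).choose

lemma mk_norSection (F : PreShape) (x : Nor F) : Nor.mk F (norSection F x) = x :=
  congrArg (fun L : Nor F →ₗ[ℝ] Nor F => L x)
    ((Ver F).mkQ.exists_rightInverse_of_surjective (Submodule.range_mkQ _)).choose_spec

/-- The form induced by `flagForm` on the fibre of the normal bundle. -/
def norForm (a₁ a₂ b₁ b₂ c₁ c₂ : ℝ) (F : PreShape) : LinearMap.BilinForm ℝ (Nor F) :=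
  (flagForm a₁ a₂ b₁ b₂ c₁ c₂ F F.immersed).compl₁₂ (norSection F) (norSection F)

lemma norForm_mk (a₁ a₂ b₁ b₂ c₁ c₂ : ℝ) (F : PreShape) (X Y : Field) :
    norForm a₁ a₂ b₁ b₂ c₁ c₂ F (Nor.mk F X) (Nor.mk F Y) =
      flagForm a₁ a₂ b₁ b₂ c₁ c₂ F F.immersed X Y := by
  have key : ∀ X Y : Field, flagForm a₁ a₂ b₁ b₂ c₁ c₂ F F.immersed (norSection F (Nor.mk F X)) Y =
      flagForm a₁ a₂ b₁ b₂ c₁ c₂ F F.immersed X Y := by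
    intro X Y
    have h : norSection F (Nor.mk F X) - X ∈ Ver F :=
      (Submodule.Quotient.eq _).1 (mk_norSection F (Nor.mk F X))
    obtain ⟨e1, e2⟩ := h1_h2_of_mem_Ver F h
    have h0 := flagForm_eq_zero a₁ a₂ b₁ b₂ c₁ c₂ F F.immersed e1 e2 Y
    rw [map_sub, LinearMap.sub_apply, sub_eq_zero] at h0
    exact h0
  rw [norForm, LinearMap.compl₁₂_apply, key, flagForm_comm, key, flagForm_comm]

lemma norForm_isSymm (a₁ a₂ b₁ b₂ c₁ c₂ : ℝ) (F : PreShape) :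
    (norForm a₁ a₂ b₁ b₂ c₁ c₂ F).IsSymm :=
  ⟨fun _ _ => flagForm_comm _ _ _ _ _ _ _ _ _ _⟩

lemma norForm_self (a₁ a₂ b₁ b₂ c₁ c₂ : ℝ) (F : PreShape) (X : Field) :
    norForm a₁ a₂ b₁ b₂ c₁ c₂ F (Nor.mk F X) (Nor.mk F X) =
      geometricForm a₁ a₂ b₁ b₂ c₁ c₂ F (h1 F X) (h2 F X) := by
  rw [norForm_mk, flagForm_self]

end Form

/-! ### Integrals depending smoothly on a parameter -/

section Parameter

open Set Filter Topology MeasureTheory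

/-- Differentiation under the integral sign: the integral over a compact set of a function that is
jointly smooth in a real parameter and the integration variable is smooth in the parameter. -/
lemma contDiff_integral_of_contDiffOn {E : Type*} [NormedAddCommGroup E] [NormedSpace ℝ E]
    [MeasurableSpace E] [BorelSpace E] [SecondCountableTopology E]
    {μ : Measure E} [IsFiniteMeasure μ] {K O : Set E} (hK : IsCompact K) (hO : IsOpen O)
    (hKO : K ⊆ O) {Φ : ℝ × E → ℝ} (hΦ : ContDiffOn ℝ ∞ Φ {q | q.2 ∈ O}) :
    ContDiff ℝ ∞ fun s => ∫ x in K, Φ (s, x) ∂μ := by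
  have hopen : IsOpen {q : ℝ × E | q.2 ∈ O} := hO.preimage continuous_snd
  have hder : ∀ Φ : ℝ × E → ℝ, ContDiffOn ℝ ∞ Φ {q | q.2 ∈ O} →
      ContDiffOn ℝ ∞ (fun q => fderiv ℝ Φ q (1, 0)) {q | q.2 ∈ O} ∧
      ∀ s₀, HasDerivAt (fun s => ∫ x in K, Φ (s, x) ∂μ)
        (∫ x in K, fderiv ℝ Φ (s₀, x) (1, 0) ∂μ) s₀ := by
    intro Φ hΦ
    have h1 : ContDiffOn ℝ ∞ (fun q => fderiv ℝ Φ q (1, 0)) {q | q.2 ∈ O} :=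
      (hΦ.fderiv_of_isOpen hopen (by simp)).clm_apply contDiffOn_const
    refine ⟨h1, fun s₀ => ?_⟩
    have hsec : ∀ Ψ : ℝ × E → ℝ, ContDiffOn ℝ ∞ Ψ {q | q.2 ∈ O} → ∀ s,
        ContinuousOn (fun x => Ψ (s, x)) K := by
      intro Ψ hΨ s
      exact hΨ.continuousOn.comp (by fun_prop) fun x hx => hKO hx
    obtain ⟨C, hC⟩ := ((isCompact_Icc (a := s₀ - 1) (b := s₀ + 1)).prod hK).exists_bound_of_continuousOn
      (h1.continuousOn.mono fun q hq => hKO hq.2)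
    refine (hasDerivAt_integral_of_dominated_loc_of_deriv_le (μ := μ.restrict K)
      (F := fun s x => Φ (s, x)) (F' := fun s x => fderiv ℝ Φ (s, x) (1, 0)) (x₀ := s₀)
      (bound := fun _ => C) (Icc_mem_nhds (sub_one_lt s₀) (lt_add_one s₀)) ?_ ?_ ?_ ?_ ?_ ?_).2
    · exact Eventually.of_forall fun s => (hsec Φ hΦ s).aestronglyMeasurable hK.measurableSet
    · exact (hsec Φ hΦ s₀).integrableOn_compact hK
    · exact (hsec _ h1 s₀).aestronglyMeasurable hK.measurableSet
    · filter_upwards [ae_restrict_mem hK.measurableSet] with x hx s hs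
      exact hC (s, x) ⟨hs, hx⟩
    · exact integrable_const C
    · filter_upwards [ae_restrict_mem hK.measurableSet] with x hx s hs
      have hd : DifferentiableAt ℝ Φ (s, x) :=
        (hΦ.contDiffAt (hopen.mem_nhds (hKO hx))).differentiableAt (by simp)
      have hc : HasDerivAt (fun s : ℝ => (s, x)) ((1 : ℝ), (0 : E)) s :=
        (hasDerivAt_id s).prodMk (hasDerivAt_const s x)
      exact hd.hasFDerivAt.comp_hasDerivAt s hc
  rw [contDiff_infty]
  intro n
  induction n generalizing Φ with
  | zero =>
    exact contDiff_zero.2 (continuous_iff_continuousAt.2 fun s => ((hder Φ hΦ).2 s).continuousAt)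
  | succ n ih =>
    obtain ⟨h1, h2⟩ := hder Φ hΦ
    rw [Nat.cast_add, Nat.cast_one, contDiff_succ_iff_deriv]
    refine ⟨fun s => (h2 s).differentiableAt, by simp, ?_⟩
    have : (deriv fun s => ∫ x in K, Φ (s, x) ∂μ) =
        fun s => ∫ x in K, fderiv ℝ Φ (s, x) (1, 0) ∂μ := funext fun s => (h2 s).deriv
    rw [this]
    exact ih h1

lemma SmoothFam.contDiff_integral {φ : ℝ → S2 → ℝ} (h : SmoothFam φ) :
    ContDiff ℝ ∞ fun s => ∫ p, φ s p ∂((volume : Measure E3).toSphere) := by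
  have hemb : MeasurableEmbedding (Subtype.val : S2 → E3) :=
    MeasurableEmbedding.subtype_coe Metric.isClosed_sphere.measurableSet
  set μ : Measure E3 := ((volume : Measure E3).toSphere).map (Subtype.val : S2 → E3) with hμ
  have : IsFiniteMeasure μ := Measure.isFiniteMeasure_map _ _
  have h1 := contDiff_integral_of_contDiffOn (μ := μ) (isCompact_sphere (0 : E3) 1)
    (isOpen_compl_singleton (x := (0 : E3))) (fun x hx => ne_zero_of_mem_unit_sphere ⟨x, hx⟩)
    (Φ := fun q : ℝ × E3 => φ q.1 (radial q.2)) h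
  have hres : μ.restrict (Metric.sphere (0 : E3) 1) = μ := by
    refine Measure.restrict_eq_self_of_ae_mem ?_
    rw [hμ, hemb.ae_map_iff]
    exact Eventually.of_forall fun p => p.2
  rw [hres] at h1
  convert! h1 using 2 with s
  rw [hμ, hemb.integral_map]
  simp

lemma SmoothLoop.contDiff_integral {φ : ℝ → Circle → ℝ} (h : SmoothLoop φ) :
    ContDiff ℝ ∞ fun s => ∫ θ, φ s (Circle.exp θ) ∂(volume.restrict (Ioc 0 (2 * Real.pi))) := by
  have h1 := contDiff_integral_of_contDiffOn (μ := volume.restrict (Ioc 0 (2 * Real.pi)))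
    (isCompact_Icc (a := 0) (b := 2 * Real.pi)) isOpen_univ (subset_univ _)
    (Φ := fun q : ℝ × ℝ => φ q.1 (Circle.exp q.2)) (ContDiff.contDiffOn h)
  rwa [Measure.restrict_restrict measurableSet_Icc, inter_eq_right.2 Ioc_subset_Icc_self] at h1

lemma ImmersedFam.contDiff_lineIntegral {F : ℝ → S2 → E3} (hF : ImmersedFam F)
    {φ : ℝ → Circle → ℝ} (h : SmoothLoop φ) :
    ContDiff ℝ ∞ fun s => lineIntegral (curve (F s)) (φ s) := by
  simp only [lineIntegral_eq]
  exact (h.mul hF.speed).contDiff_integral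

lemma ImmersedFam.contDiff_areaIntegral {F : ℝ → S2 → E3} (hF : ImmersedFam F)
    {φ : ℝ → S2 → ℝ} (h : SmoothFam φ) :
    ContDiff ℝ ∞ fun s => areaIntegral (F s) (φ s) := by
  simp only [areaIntegral_eq]
  exact (h.mul hF.norm_normalVec).contDiff_integral

lemma ImmersedFam.contDiff_areaIntegral_gradNormSq {F : ℝ → S2 → E3} (hF : ImmersedFam F)
    {φ : ℝ → S2 → ℝ} (h : SmoothFam φ) :
    ContDiff ℝ ∞ fun s => areaIntegral (F s) (gradNormSq (F s) (φ s)) := by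
  simp only [areaIntegral_eq, gradNormSq_mul_norm (hF.immersed _)]
  exact ((hF.norm_normalVec.inv fun s p => norm_ne_zero_iff.2 (hF.ne_zero s p)).mul
    ((hF.smooth.rotGrad h).inner (hF.smooth.rotGrad h))).contDiff_integral

/-- The geometric expression depends smoothly on the immersion and on the variation. -/
lemma ImmersedFam.contDiff_geometricForm {F X : ℝ → S2 → E3} (hF : ImmersedFam F)
    (hX : SmoothFam X) (a₁ a₂ b₁ b₂ c₁ c₂ : ℝ) :
    ContDiff ℝ ∞ fun s =>
      geometricForm a₁ a₂ b₁ b₂ c₁ c₂ (F s) (h1 (F s) (X s)) (h2 (F s) (X s)) := by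
  have k1 : SmoothLoop fun s => h1 (F s) (X s) := hX.loop.inner hF.darbouxN
  have k2 : SmoothFam fun s => h2 (F s) (X s) := hX.inner hF.unitNormal
  have L := fun i => hF.contDiff_lineIntegral ((hF.lineTerm i k1 k2).pow 2)
  exact (((((contDiff_const.mul (L 0)).add (contDiff_const.mul
    (hF.contDiff_areaIntegral ((k2.pow 2).mul hF.kappa_sub_sq)))).add
    (contDiff_const.mul (L 1))).add (contDiff_const.mul
    (hF.contDiff_areaIntegral ((k2.pow 2).mul hF.kappa_add_sq)))).add
    (contDiff_const.mul (L 2))).add (contDiff_const.mul (hF.contDiff_areaIntegral_gradNormSq k2))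

end Parameter

/-! ### Prescribing the normal components of a variation -/

section Surjectivity

open Set Filter Topology

/-- The radial projection of the plane to the circle (with an arbitrary value at `0`). -/
def circleProj (w : ℂ) : Circle := Circle.exp (Complex.arg w)

lemma circleProj_coe {w : ℂ} (hw : w ≠ 0) : (circleProj w : ℂ) = ‖w‖⁻¹ • w := by
  rw [circleProj, Circle.coe_exp]
  have := Complex.norm_mul_exp_arg_mul_I w
  have h : (‖w‖ : ℂ) ≠ 0 := by exact_mod_cast norm_ne_zero_iff.2 hw
  rw [Complex.real_smul, Complex.ofReal_inv, eq_inv_mul_iff_mul_eq₀ h]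
  exact this

lemma circleProj_circle (z : Circle) : circleProj z = z := Circle.exp_arg z

lemma contMDiffAt_circleProj {w : ℂ} (hw : w ≠ 0) :
    ContMDiffAt 𝓘(ℝ, ℂ) (𝓡 1) ∞ circleProj w := by
  set U : TopologicalSpace.Opens ℂ := ⟨{0}ᶜ, isOpen_compl_singleton⟩ with hU
  have h1 : ContMDiff 𝓘(ℝ, ℂ) 𝓘(ℝ, ℂ) ∞ fun y : U => (circleProj (y : ℂ) : ℂ) := by
    intro y
    refine (contMDiffAt_subtype_iff (U := U) (f := fun y : ℂ => (circleProj y : ℂ))).2 ?_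
    have hy : (y : ℂ) ≠ 0 := y.2
    have : ContDiffAt ℝ ∞ (fun y : ℂ => ‖y‖⁻¹ • y) (y : ℂ) :=
      ((contDiffAt_norm ℝ hy).inv (norm_ne_zero_iff.2 hy)).smul contDiffAt_id
    refine (this.congr_of_eventuallyEq ?_).contMDiffAt
    filter_upwards [isOpen_ne.mem_nhds hy] with z hz using circleProj_coe hz
  have : Fact (Module.finrank ℝ ℂ = 1 + 1) := finrank_real_complex_fact'
  have h2 : ContMDiff 𝓘(ℝ, ℂ) (𝓡 1) ∞ fun y : U => circleProj (y : ℂ) :=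
    h1.codRestrict_sphere (n := 1) (fun y => (circleProj (y : ℂ)).2)
  exact (contMDiffAt_subtype_iff (U := U) (f := circleProj) (x := ⟨w, hw⟩)).1 (h2 ⟨w, hw⟩)

/-- The projection of space to the equatorial plane. -/
def planeProj (x : E3) : ℂ := ⟨x 0, x 1⟩

lemma normSq_planeProj (x : E3) : Complex.normSq (planeProj x) = x 0 ^ 2 + x 1 ^ 2 := by
  rw [Complex.normSq_apply, planeProj]; ring

lemma contDiff_planeProj : ContDiff ℝ ∞ planeProj := by
  have h : ∀ i : Fin 3, ContDiff ℝ ∞ fun x : E3 => x i :=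
    fun i => (EuclideanSpace.proj (𝕜 := ℝ) i : E3 →L[ℝ] ℝ).contDiff
  have h2 : ContDiff ℝ ∞ fun x : E3 => x 0 • (1 : ℂ) + x 1 • Complex.I :=
    ((h 0).smul contDiff_const).add ((h 1).smul contDiff_const)
  convert! h2 using 1
  funext x
  apply Complex.ext <;> simp [planeProj]

/-- An extension of a function on the equator to the sphere, cut off near the poles. -/
def equatorExt (u : Circle → ℝ) (p : S2) : ℝ :=
  Real.smoothTransition (2 * ((p : E3) 0 ^ 2 + (p : E3) 1 ^ 2) - 1) * u (circleProj (planeProj p))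

lemma equatorExt_equator (u : Circle → ℝ) (z : Circle) : equatorExt u (equator z) = u z := by
  have h1 : planeProj (equator z) = z := rfl
  have h2 := Circle.normSq_coe z
  rw [← h1, normSq_planeProj] at h2
  rw [equatorExt, h2, h1, circleProj_circle, Real.smoothTransition.one_of_one_le (by norm_num),
    one_mul]

lemma smooth_equatorExt (u : ContMDiffMap (𝓡 1) 𝓘(ℝ, ℝ) Circle ℝ ∞) : Smooth (equatorExt u) := by
  have hq : Smooth fun p : S2 => (p : E3) 0 ^ 2 + (p : E3) 1 ^ 2 :=
    ((smoothFam_coe.coord 0).pow 2).add ((smoothFam_coe.coord 1).pow 2)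
  refine smooth_of_contDiffAt fun x hx => ?_
  have hqx := hq.contDiffAt hx
  rcases lt_or_ge ((radial x : E3) 0 ^ 2 + (radial x : E3) 1 ^ 2) (1 / 2) with h | h
  · refine (contDiffAt_const (c := (0 : ℝ))).congr_of_eventuallyEq ?_
    filter_upwards [hqx.continuousAt.eventually_lt_const h] with y hy
    rw [equatorExt, Real.smoothTransition.zero_of_nonpos (by linarith), zero_mul]
  · have hw : planeProj (radial x) ≠ 0 := by
      intro h0
      have := normSq_planeProj (radial x)
      rw [h0, map_zero] at this
      linarith
    have h1 : ContDiffAt ℝ ∞ (fun y => planeProj (radial y)) x :=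
      contDiff_planeProj.contDiffAt.comp x (Smooth.contDiffAt (smoothFam_coe.smooth 0) hx)
    have h2 : ContDiffAt ℝ ∞ (fun y => u (circleProj (planeProj (radial y)))) x := by
      rw [← contMDiffAt_iff_contDiffAt]
      have h4 : ContMDiffAt 𝓘(ℝ, E3) (𝓡 1) ∞
          (circleProj ∘ fun y : E3 => planeProj (radial y)) x :=
        ContMDiffAt.comp (g := circleProj) x (contMDiffAt_circleProj hw) h1.contMDiffAt
      exact ContMDiffAt.comp (g := u) x (u.contMDiff _) h4
    have h3 : ContDiffAt ℝ ∞ (fun y => Real.smoothTransition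
        (2 * ((radial y : E3) 0 ^ 2 + (radial y : E3) 1 ^ 2) - 1)) x :=
      Real.smoothTransition.contDiff.contDiffAt.comp x
        ((contDiffAt_const.mul hqx).sub contDiffAt_const)
    exact h3.mul h2

/-- Every pair of smooth functions on the curve and on the surface consists of the normal
components of a variation. -/
lemma Immersed.exists_field {F : S2 → E3} (hF : Immersed F)
    (u : ContMDiffMap (𝓡 1) 𝓘(ℝ, ℝ) Circle ℝ ∞) (v : ContMDiffMap (𝓡 2) 𝓘(ℝ, ℝ) S2 ℝ ∞) :
    ∃ X : Field, h1 F X = u ∧ h2 F X = v := by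
  -- the tangent of the images of the parallels, which vanishes at the images of the poles
  set T : S2 → E3 := fun p => D F p (equatorDir p) with hT
  have hTs : Smooth T := (SmoothFam.D hF.smooth).clm_apply
    ((smoothFam_const (stdVec 2)).cross smoothFam_coe)
  have hne : ∀ p : S2, ⟪T p, T p⟫ + (p : E3) 2 ^ 2 ≠ 0 := by
    intro p h0
    have h1 : 0 ≤ ⟪T p, T p⟫ := real_inner_self_nonneg
    have h2 : (p : E3) 2 = 0 := by nlinarith [sq_nonneg ((p : E3) 2)]
    have h3 : T p = 0 := inner_self_eq_zero (𝕜 := ℝ).1 (by nlinarith [sq_nonneg ((p : E3) 2)])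
    have h4 := hF.ne_zero_of_tangent p (inner_equatorDir _) h3
    rw [equatorDir_eq] at h4
    have h5 := congrArg (fun y : E3 => y 0) h4
    have h6 := congrArg (fun y : E3 => y 1) h4
    refine coe_ne_zero p (ext_three ?_ ?_ h2)
    · simpa using h6
    · simpa using h5
  set X : S2 → E3 := fun p =>
    (equatorExt u p * (√(⟪T p, T p⟫ + (p : E3) 2 ^ 2))⁻¹) • cross (unitNormal F p) (T p) +
      v p • unitNormal F p with hX
  have hXs : Smooth X := by
    have hroot : Smooth fun p => √(⟪T p, T p⟫ + (p : E3) 2 ^ 2) :=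
      SmoothFam.sqrt ((SmoothFam.inner hTs hTs).add ((smoothFam_coe.coord 2).pow 2))
        fun _ p => hne p
    refine ((SmoothFam.mul (smooth_equatorExt u) (SmoothFam.inv hroot fun _ p => ?_)).smul
      (SmoothFam.cross hF.smooth_unitNormal hTs)).add
      (SmoothFam.smul (smooth_of_contMDiff v.contMDiff) hF.smooth_unitNormal)
    have h1 : 0 ≤ ⟪T p, T p⟫ := real_inner_self_nonneg
    exact Real.sqrt_ne_zero'.2 (lt_of_le_of_ne (by positivity) (hne p).symm)
  refine ⟨⟨X, hXs.contMDiff⟩, ?_, ?_⟩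
  · funext z
    have e1 : √(⟪T (equator z), T (equator z)⟫ + (equator z : E3) 2 ^ 2) = speed (curve F) z := by
      rw [equator_two, zero_pow two_ne_zero, add_zero, real_inner_self_eq_norm_sq,
        Real.sqrt_sq (norm_nonneg _), speed, dot_curve hF.smooth]
    have e2 : (speed (curve F) z)⁻¹ • cross (unitNormal F (equator z)) (T (equator z)) =
        darbouxN F z := by
      rw [← cross_smul_right, hT, darbouxN, darbouxT, tangent, dot_curve hF.smooth]; rfl
    change ⟪X (equator z), darbouxN F z⟫ = u z
    simp only [hX]
    rw [e1, mul_smul, e2, equatorExt_equator, inner_add_left, real_inner_smul_left,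
      real_inner_smul_left, hF.inner_N_N]
    have := Immersed.inner_Nu_N (F := F) z
    rw [darbouxNu] at this
    rw [this]; simp
  · funext p
    change ⟪X p, unitNormal F p⟫ = v p
    simp only [hX]
    rw [inner_add_left, real_inner_smul_left, real_inner_smul_left, hF.inner_unitNormal_self,
      inner_cross_left']
    simp

end Surjectivity

/-! ### Variations without normal components are vertical -/

section Vertical

open Set Filter Topology

/-- The tangent vector field on the sphere whose image under `dF` is the tangential part of `X`. -/
def pullField (F X : S2 → E3) (p : S2) : E3 :=
  -(‖normalVec F p‖ ^ 2)⁻¹ • wedge (ContinuousLinearMap.lsmul ℝ ℝ)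
    ((innerSL ℝ (normalVec F p)).comp ((crossL (X p)).comp (D F p)))
    (ContinuousLinearMap.id ℝ E3) p

lemma pullField_eq (F X : S2 → E3) (p : S2) : pullField F X p =
    -((‖normalVec F p‖ ^ 2)⁻¹ * sgn p) •
      (⟪normalVec F p, cross (X p) (D F p (frame p 0))⟫ • frame p 1 -
        ⟪normalVec F p, cross (X p) (D F p (frame p 1))⟫ • frame p 0) := by
  rw [pullField, wedge_frame, smul_smul, neg_mul]
  rfl

lemma Immersed.smooth_pullField {F X : S2 → E3} (hF : Immersed F) (hX : Smooth X) :
    Smooth (pullField F X) := by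
  have h : SmoothFam fun (_ : ℝ) p =>
      ((innerSL ℝ (normalVec F p)).comp ((crossL (X p)).comp (D F p)) : E3 →L[ℝ] ℝ) := by
    refine contDiffOn_clm_apply.2 fun y => ?_
    exact SmoothFam.inner (SmoothFam.normalVec hF.smooth) (SmoothFam.cross hX
      ((SmoothFam.D hF.smooth).clm_apply (smoothFam_const y)))
  exact (SmoothFam.inv (SmoothFam.pow hF.const.norm_normalVec 2) fun _ p =>
    pow_ne_zero 2 (norm_ne_zero_iff.2 (hF.ne_zero p))).neg.smul
      (h.wedge (smoothFam_const _) _)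

lemma inner_pullField (F X : S2 → E3) (p : S2) : ⟪pullField F X p, (p : E3)⟫ = 0 := by
  have h : ∀ i, ⟪frame p i, (p : E3)⟫ = 0 := fun i => by rw [real_inner_comm, inner_frame]
  rw [pullField_eq, real_inner_smul_left, inner_sub_left, real_inner_smul_left,
    real_inner_smul_left, h, h]
  ring

lemma Immersed.D_pullField {F X : S2 → E3} (hF : Immersed F) (p : S2)
    (h : ⟪X p, unitNormal F p⟫ = 0) : D F p (pullField F X p) = X p := by
  have hN : ‖normalVec F p‖ ^ 2 ≠ 0 := pow_ne_zero 2 (norm_ne_zero_iff.2 (hF.ne_zero p))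
  have hdet := norm_normalVec_sq F p
  rw [norm_cross_sq] at hdet
  have key : ∀ y, ⟪D F p (pullField F X p), y⟫ = (‖normalVec F p‖ ^ 2)⁻¹ *
      ((⟪X p, D F p (frame p 0)⟫ * ‖D F p (frame p 1)‖ ^ 2 -
        ⟪X p, D F p (frame p 1)⟫ * ⟪D F p (frame p 0), D F p (frame p 1)⟫) *
          ⟪D F p (frame p 0), y⟫ +
      (⟪X p, D F p (frame p 1)⟫ * ‖D F p (frame p 0)‖ ^ 2 -
        ⟪X p, D F p (frame p 0)⟫ * ⟪D F p (frame p 0), D F p (frame p 1)⟫) *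
          ⟪D F p (frame p 1), y⟫) := by
    intro y
    have e : ∀ b, ⟪normalVec F p, cross (X p) b⟫ = sgn p *
        (⟪X p, D F p (frame p 0)⟫ * ⟪b, D F p (frame p 1)⟫ -
          ⟪X p, D F p (frame p 1)⟫ * ⟪b, D F p (frame p 0)⟫) := by
      intro b
      rw [normalVec_eq_sgn, real_inner_smul_left, real_inner_comm, inner_cross_cross]
    rw [pullField_eq, e, e, map_smul, map_sub, map_smul, map_smul, real_inner_smul_left,
      inner_sub_left, real_inner_smul_left, real_inner_smul_left, real_inner_self_eq_norm_sq,
      real_inner_self_eq_norm_sq, real_inner_comm (D F p (frame p 0)) (D F p (frame p 1))]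
    have := sgn_sq p
    linear_combination ((‖normalVec F p‖ ^ 2)⁻¹ *
      ((⟪X p, D F p (frame p 0)⟫ * ‖D F p (frame p 1)‖ ^ 2 -
        ⟪X p, D F p (frame p 1)⟫ * ⟪D F p (frame p 0), D F p (frame p 1)⟫) *
          ⟪D F p (frame p 0), y⟫ +
      (⟪X p, D F p (frame p 1)⟫ * ‖D F p (frame p 0)‖ ^ 2 -
        ⟪X p, D F p (frame p 0)⟫ * ⟪D F p (frame p 0), D F p (frame p 1)⟫) *
          ⟪D F p (frame p 1), y⟫)) * this
  rw [← sub_eq_zero]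
  refine hF.eq_zero_of_inner p ?_ ?_ ?_
  · rw [inner_sub_right, inner_unitNormal_D F hF.smooth, real_inner_comm, h, sub_zero]
  · rw [inner_sub_left, key, sub_eq_zero, inv_mul_eq_iff_eq_mul₀ hN, hdet,
      real_inner_self_eq_norm_sq, real_inner_comm (D F p (frame p 0)) (D F p (frame p 1))]
    ring
  · rw [inner_sub_left, key, sub_eq_zero, inv_mul_eq_iff_eq_mul₀ hN, hdet,
      real_inner_self_eq_norm_sq]
    ring

/-- A variation without normal components is tangential, hence the image of a tangent field on the
sphere; along the equator that field is tangent to the equator because the variation is tangent to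
the curve. -/
lemma mem_Ver_of_h1_h2 (F : PreShape) {X : Field} (hX1 : h1 F X = 0) (hX2 : h2 F X = 0) :
    X ∈ Ver F := by
  have hF := F.immersed
  have hD : ∀ p, D F p (pullField F X p) = X p := fun p => hF.D_pullField p (congrFun hX2 p)
  refine ⟨⟨pullField F X, (hF.smooth_pullField X.smooth).contMDiff⟩, ⟨inner_pullField F X, ?_⟩,
    fun p => (hD p).symm⟩
  intro z
  have e1 : ⟪X (equator z), darbouxN F z⟫ = 0 := congrFun hX1 z
  have e2 : ⟪X (equator z), darbouxNu F z⟫ = 0 := congrFun hX2 (equator z)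
  have e3 := hF.darboux_expand z (X (equator z))
  rw [e1, e2, zero_smul, zero_smul, add_zero, add_zero] at e3
  set c := ⟪X (equator z), darbouxT F z⟫ * (speed (curve F) z)⁻¹ with hc
  have e4 : D F (equator z) (pullField F X (equator z) - c • equatorDir (equator z)) = 0 := by
    rw [map_sub, hD, map_smul, sub_eq_zero]
    have eT : darbouxT F z = (speed (curve F) z)⁻¹ • D F (equator z) (equatorDir (equator z)) := by
      rw [darbouxT, tangent, dot_curve hF.smooth]
    rw [hc, mul_smul, ← eT]
    exact e3
  have e5 := hF.ne_zero_of_tangent _ (by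
    rw [inner_sub_right, real_inner_smul_right, inner_equatorDir, mul_zero, sub_zero,
      real_inner_comm, inner_pullField]) e4
  rw [sub_eq_zero] at e5
  change pullField F X (equator z) 2 = 0
  rw [e5, equatorDir_eq]
  simp

lemma norMk_eq_zero_iff (F : PreShape) (X : Field) :
    Nor.mk F X = 0 ↔ h1 F X = 0 ∧ h2 F X = 0 := by
  rw [show Nor.mk F X = 0 ↔ X ∈ Ver F from Submodule.Quotient.mk_eq_zero _]
  exact ⟨h1_h2_of_mem_Ver F, fun h => mem_Ver_of_h1_h2 F h.1 h.2⟩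

end Vertical

/-! ### Positivity and the null space -/

section Positivity

open Set Filter Topology MeasureTheory

lemma lineIntegral_sq_nonneg (f : Circle → E3) (φ : Circle → ℝ) :
    0 ≤ lineIntegral f fun z => φ z ^ 2 := by
  rw [lineIntegral_eq]
  exact integral_nonneg fun θ => mul_nonneg (sq_nonneg _) (norm_nonneg _)

lemma areaIntegral_nonneg (F : S2 → E3) {φ : S2 → ℝ} (h : ∀ p, 0 ≤ φ p) :
    0 ≤ areaIntegral F φ := by
  rw [areaIntegral_eq]
  exact integral_nonneg fun p => mul_nonneg (h p) (norm_nonneg _)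

lemma exists_exp_mem_Icc (z : Circle) : ∃ θ ∈ Icc 0 (2 * Real.pi), Circle.exp θ = z := by
  rcases le_or_gt 0 (Complex.arg z) with h | h
  · exact ⟨Complex.arg z, ⟨h, by linarith [Complex.arg_le_pi (z : ℂ), Real.pi_pos]⟩,
      Circle.exp_arg z⟩
  · refine ⟨Complex.arg z + 2 * Real.pi, ⟨by linarith [Complex.neg_pi_lt_arg (z : ℂ), Real.pi_pos],
      by linarith⟩, ?_⟩
    rw [Circle.exp_add, Circle.exp_two_pi, mul_one, Circle.exp_arg]

lemma Immersed.eq_zero_of_lineIntegral_sq {F : S2 → E3} (hF : Immersed F) {φ : Circle → ℝ}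
    (hφ : SmoothC φ) (h : lineIntegral (curve F) (fun z => φ z ^ 2) = 0) (z : Circle) :
    φ z = 0 := by
  have hc : Continuous fun θ => φ (Circle.exp θ) ^ 2 * speed (curve F) (Circle.exp θ) :=
    (((SmoothLoop.contDiff hφ 0).continuous).pow 2).mul
      (SmoothLoop.contDiff hF.const.speed 0).continuous
  have h0 : ∀ θ, 0 ≤ φ (Circle.exp θ) ^ 2 * speed (curve F) (Circle.exp θ) :=
    fun θ => mul_nonneg (sq_nonneg _) (norm_nonneg _)
  rw [lineIntegral_eq, integral_eq_zero_iff_of_nonneg h0 hc.integrableOn_Ioc] at h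
  rw [Measure.restrict_congr_set Ioc_ae_eq_Icc] at h
  have h2 := Measure.eqOn_Icc_of_ae_eq (μ := volume) Real.two_pi_pos.ne h hc.continuousOn
    continuousOn_const
  obtain ⟨θ, hθ, rfl⟩ := exists_exp_mem_Icc z
  have h3 : φ (Circle.exp θ) ^ 2 * speed (curve F) (Circle.exp θ) = 0 := h2 hθ
  exact pow_eq_zero_iff two_ne_zero |>.1 ((mul_eq_zero.1 h3).resolve_right (hF.speed_ne_zero _))

lemma eq_zero_of_integral_S2 {φ : S2 → ℝ} (hφ : Continuous φ) (h0 : ∀ p, 0 ≤ φ p)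
    (h : ∫ p, φ p ∂((volume : Measure E3).toSphere) = 0) (p : S2) : φ p = 0 := by
  rw [integral_eq_zero_iff_of_nonneg h0 (integrable_of_continuous_S2 hφ)] at h
  have := (Continuous.ae_eq_iff_eq _ hφ continuous_zero).1 h
  exact congrFun this p

/-- The unit normal is not constant: where the height function in a direction `e` is maximal, `e` is
normal to the surface, so a constant normal could not be orthogonal to `e`. -/
lemma Immersed.unitNormal_not_const {F : S2 → E3} (hF : Immersed F)
    (h : ∀ p q, unitNormal F p = unitNormal F q) : False := by
  set p₀ : S2 := equator 1
  -- a vector orthogonal to the constant normal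
  obtain ⟨e, he1, he2⟩ : ∃ e : E3, e ≠ 0 ∧ ⟪e, unitNormal F p₀⟫ = 0 := by
    refine ⟨D F p₀ (frame p₀ 0), ?_, ?_⟩
    · intro h0
      have h1 := hF.ne_zero_of_tangent p₀ (inner_frame p₀ 0) h0
      have h2 := frame_norm p₀ 0
      rw [h1, norm_zero] at h2
      exact zero_ne_one h2
    · rw [real_inner_comm, inner_unitNormal_D F hF.smooth]
  have hcont : Continuous fun p => ⟪e, F p⟫ :=
    continuous_const.inner (Smooth.continuous hF.smooth)
  obtain ⟨p, -, hp⟩ := isCompact_univ.exists_isMaxOn ⟨p₀, mem_univ _⟩ hcont.continuousOn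
  have hmax : IsLocalMax (fun x : E3 => ⟪e, F (radial x)⟫) (p : E3) := by
    refine Eventually.of_forall fun x => ?_
    simpa using hp (mem_univ (radial x))
  have h1 := (hasFDerivAt_const e (p : E3)).inner ℝ (hF.smooth.hasFDerivAt p)
  have h2 := hmax.hasFDerivAt_eq_zero h1
  have h3 : ∀ y, ⟪e, D F p y⟫ = 0 := by
    intro y
    simpa using congrArg (fun L : E3 →L[ℝ] ℝ => L y) h2
  refine he1 (hF.eq_zero_of_inner p ?_ (h3 _) (h3 _))
  rw [h p p₀, real_inner_comm, he2]

lemma Immersed.rotGrad_eq_zero {F : S2 → E3} (hF : Immersed F) {h : S2 → ℝ} (hh : Smooth h)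
    {p : S2} (h0 : rotGrad F h p = 0) : D h p = 0 := by
  rw [rotGrad, wedge_frame, smul_eq_zero] at h0
  have hs : sgn p ≠ 0 := fun h1 => by have := sgn_sq p; rw [h1] at this; norm_num at this
  have h1 := h0.resolve_left hs
  have h2 : D F p (D h p (frame p 0) • frame p 1 - D h p (frame p 1) • frame p 0) = 0 := by
    rw [map_sub, map_smul, map_smul]; exact h1
  have h3 := hF.ne_zero_of_tangent p (by
    rw [inner_sub_right, real_inner_smul_right, real_inner_smul_right, inner_frame, inner_frame]
    simp) h2
  have o := frame_orthogonal p
  have o' : ⟪frame p 1, frame p 0⟫ = 0 := by rw [real_inner_comm, o]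
  have h4 := congrArg (fun y => ⟪y, frame p 0⟫) h3
  have h5 := congrArg (fun y => ⟪y, frame p 1⟫) h3
  simp only [inner_sub_left, real_inner_smul_left, real_inner_self_eq_norm_sq, frame_norm, o, o',
    inner_zero_left] at h4 h5
  ext1 y
  rw [D_frame hh, show D h p (frame p 0) = 0 by linarith, show D h p (frame p 1) = 0 by linarith]
  simp

/-- A function on the curve with vanishing derivative is constant. -/
lemma eq_of_Ds_eq_zero {V : Type*} [NormedAddCommGroup V] [NormedSpace ℝ V] {F : S2 → E3}
    (hF : Immersed F) {f : Circle → V} (hf : SmoothC f) (h : ∀ z, Ds (curve F) f z = 0)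
    (z w : Circle) : f z = f w := by
  obtain ⟨θ, rfl⟩ := exists_exp z
  obtain ⟨η, rfl⟩ := exists_exp w
  refine is_const_of_deriv_eq_zero (f := fun θ => f (Circle.exp θ))
    ((SmoothLoop.contDiff hf 0).differentiable (by simp)) (fun θ => ?_) θ η
  rw [← dot_exp]
  exact (smul_eq_zero.1 (h (Circle.exp θ))).resolve_left (inv_ne_zero (hF.speed_ne_zero _))

/-- The geometric expression vanishes only if `h₂ = 0`, `h₁` is constant, and the curve is, where
`h₁` does not vanish, without geodesic curvature and torsion. -/
lemma Immersed.of_geometricForm_eq_zero {F : S2 → E3} (hF : Immersed F)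
    {a₁ a₂ b₁ b₂ c₁ c₂ : ℝ} (ha₁ : 0 < a₁) (ha₂ : 0 < a₂) (hb₁ : 0 < b₁) (hb₂ : 0 < b₂)
    (hc₁ : 0 < c₁) (hc₂ : 0 < c₂) {u : Circle → ℝ} {v : S2 → ℝ} (hu : SmoothC u) (hv : Smooth v)
    (h : geometricForm a₁ a₂ b₁ b₂ c₁ c₂ F u v = 0) :
    v = 0 ∧ ∀ z, u z * kappaG F z = 0 ∧ Ds (curve F) u z = 0 ∧ u z * tauG F z = 0 := by
  have n : ∀ i, 0 ≤ lineIntegral (curve F) fun z => lineTerm F i u v z ^ 2 :=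
    fun i => lineIntegral_sq_nonneg _ _
  have m1 : 0 ≤ areaIntegral F fun p => v p ^ 2 * (kappa1 F p - kappa2 F p) ^ 2 :=
    areaIntegral_nonneg F fun p => by positivity
  have m2 : 0 ≤ areaIntegral F fun p => v p ^ 2 * (kappa1 F p + kappa2 F p) ^ 2 :=
    areaIntegral_nonneg F fun p => by positivity
  have hg : ∀ p, 0 ≤ gradNormSq F v p := by
    intro p
    rw [hF.gradNormSq_eq]
    positivity
  have m3 : 0 ≤ areaIntegral F fun p => gradNormSq F v p := areaIntegral_nonneg F hg
  have n0 := n 0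
  have n1 := n 1
  have n2 := n 2
  simp only [lineTerm] at n0 n1 n2
  rw [geometricForm] at h
  have p1 := mul_nonneg ha₁.le n0
  have p2 := mul_nonneg ha₂.le m1
  have p3 := mul_nonneg hb₁.le n1
  have p4 := mul_nonneg hb₂.le m2
  have p5 := mul_nonneg hc₁.le n2
  have p6 := mul_nonneg hc₂.le m3
  have z1 := (mul_eq_zero.1 (le_antisymm (by linarith) p1)).resolve_left ha₁.ne'
  have z2 := (mul_eq_zero.1 (le_antisymm (by linarith) p2)).resolve_left ha₂.ne'
  have z3 := (mul_eq_zero.1 (le_antisymm (by linarith) p3)).resolve_left hb₁.ne'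
  have z4 := (mul_eq_zero.1 (le_antisymm (by linarith) p4)).resolve_left hb₂.ne'
  have z5 := (mul_eq_zero.1 (le_antisymm (by linarith) p5)).resolve_left hc₁.ne'
  have z6 := (mul_eq_zero.1 (le_antisymm (by linarith) p6)).resolve_left hc₂.ne'
  have hN : ∀ p, ‖normalVec F p‖ ≠ 0 := fun p => norm_ne_zero_iff.2 (hF.ne_zero p)
  -- the gradient of `v` vanishes, so `v` is constant
  have hvconst : ∀ p q, v p = v q := by
    refine eq_of_D_eq_zero hv fun p => hF.rotGrad_eq_zero hv ?_
    have hs : Smooth fun p => ‖normalVec F p‖⁻¹ * ⟪rotGrad F v p, rotGrad F v p⟫ :=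
      SmoothFam.mul (SmoothFam.inv hF.const.norm_normalVec fun _ p => hN p)
        (SmoothFam.inner (SmoothFam.rotGrad hF.smooth hv) (SmoothFam.rotGrad hF.smooth hv))
    rw [areaIntegral_eq] at z6
    simp only [gradNormSq_mul_norm hF] at z6
    have := eq_zero_of_integral_S2 hs.continuous
      (fun p => mul_nonneg (inv_nonneg.2 (norm_nonneg _)) real_inner_self_nonneg) z6 p
    exact inner_self_eq_zero (𝕜 := ℝ).1
      ((mul_eq_zero.1 this).resolve_left (inv_ne_zero (hN p)))
  have hv0 : v = 0 := by
    by_contra hne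
    obtain ⟨q, hq⟩ := Function.ne_iff.1 hne
    have hvp : ∀ p, v p ^ 2 ≠ 0 := fun p => by
      rw [hvconst p q]; exact pow_ne_zero 2 hq
    -- a nonzero constant `v` forces all points to be planar
    have k1 : ∀ p, kappa1 F p - kappa2 F p = 0 := by
      intro p
      have hs : Smooth fun p => v p ^ 2 * (kappa1 F p - kappa2 F p) ^ 2 * ‖normalVec F p‖ :=
        SmoothFam.mul (SmoothFam.mul (SmoothFam.pow hv 2) hF.smooth_kappa_sub_sq)
          hF.const.norm_normalVec
      rw [areaIntegral_eq] at z2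
      have := eq_zero_of_integral_S2 hs.continuous (fun p => by positivity) z2 p
      exact pow_eq_zero_iff two_ne_zero |>.1 ((mul_eq_zero.1
        ((mul_eq_zero.1 this).resolve_right (hN p))).resolve_left (hvp p))
    have k2 : ∀ p, kappa1 F p + kappa2 F p = 0 := by
      intro p
      have hs : Smooth fun p => v p ^ 2 * (kappa1 F p + kappa2 F p) ^ 2 * ‖normalVec F p‖ :=
        SmoothFam.mul (SmoothFam.mul (SmoothFam.pow hv 2) hF.smooth_kappa_add_sq)
          hF.const.norm_normalVec
      rw [areaIntegral_eq] at z4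
      have := eq_zero_of_integral_S2 hs.continuous (fun p => by positivity) z4 p
      exact pow_eq_zero_iff two_ne_zero |>.1 ((mul_eq_zero.1
        ((mul_eq_zero.1 this).resolve_right (hN p))).resolve_left (hvp p))
    exact hF.unitNormal_not_const (eq_of_D_eq_zero hF.smooth_unitNormal
      fun p => hF.D_unitNormal_eq_zero p (k1 p) (k2 p))
  refine ⟨hv0, fun z => ?_⟩
  have w := fun i => hF.const.lineTerm i hu hv
  have w0 := hF.eq_zero_of_lineIntegral_sq (w 0) z1 z
  have w1 := hF.eq_zero_of_lineIntegral_sq (w 1) z3 z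
  have w2 := hF.eq_zero_of_lineIntegral_sq (w 2) z5 z
  have hd : Ds (curve F) (fun _ => (0 : ℝ)) z = 0 := by simp [Ds, dot]
  simp only [lineTerm, hv0, Pi.zero_apply, zero_mul, add_zero, sub_zero, hd, zero_add] at w0 w1 w2
  exact ⟨w0, w1, w2⟩

lemma geometricForm_nonneg {F : S2 → E3} (hF : Immersed F)
    {a₁ a₂ b₁ b₂ c₁ c₂ : ℝ} (ha₁ : 0 ≤ a₁) (ha₂ : 0 ≤ a₂) (hb₁ : 0 ≤ b₁) (hb₂ : 0 ≤ b₂)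
    (hc₁ : 0 ≤ c₁) (hc₂ : 0 ≤ c₂) (u : Circle → ℝ) (v : S2 → ℝ) :
    0 ≤ geometricForm a₁ a₂ b₁ b₂ c₁ c₂ F u v := by
  have hg : ∀ p, 0 ≤ gradNormSq F v p := by
    intro p
    rw [hF.gradNormSq_eq]
    positivity
  have n1 := lineIntegral_sq_nonneg (curve F)
    (fun z => u z * kappaG F z + v (equator z) * kappaN F z)
  have n2 := lineIntegral_sq_nonneg (curve F)
    (fun z => Ds (curve F) u z - v (equator z) * tauG F z)
  have n3 := lineIntegral_sq_nonneg (curve F)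
    (fun z => Ds (curve F) (fun w => v (equator w)) z + u z * tauG F z)
  have m1 : 0 ≤ areaIntegral F fun p => v p ^ 2 * (kappa1 F p - kappa2 F p) ^ 2 :=
    areaIntegral_nonneg F fun p => by positivity
  have m2 : 0 ≤ areaIntegral F fun p => v p ^ 2 * (kappa1 F p + kappa2 F p) ^ 2 :=
    areaIntegral_nonneg F fun p => by positivity
  have m3 : 0 ≤ areaIntegral F fun p => gradNormSq F v p := areaIntegral_nonneg F hg
  rw [geometricForm]
  positivity

lemma gradNormSq_zero {F : S2 → E3} (hF : Immersed F) (p : S2) : gradNormSq F 0 p = 0 := by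
  have h := congrFun (rotGrad_zero F) p
  rw [rotGrad] at h
  rw [hF.gradNormSq_eq, h]
  simp

/-- If `n` is constant along the curve, the variations with `h₁` constant and `h₂ = 0` are null. -/
lemma geometricForm_const {F : S2 → E3} (hF : Immersed F) (a₁ a₂ b₁ b₂ c₁ c₂ : ℝ) {m : E3}
    (hm : ∀ z, darbouxN F z = m) {u : Circle → ℝ} {c : ℝ} (hu : ∀ z, u z = c) :
    geometricForm a₁ a₂ b₁ b₂ c₁ c₂ F u 0 = 0 := by
  have hD : ∀ z, Ds (curve F) (darbouxN F) z = 0 := by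
    intro z
    rw [show darbouxN F = fun _ => m from funext hm]
    simp [Ds, dot]
  have hτ : ∀ z, tauG F z = 0 := by intro z; rw [tauG, hD, inner_zero_left]
  have hκ : ∀ z, kappaG F z = 0 := by
    intro z
    have := hF.inner_Ds_N_T z
    rw [hD, inner_zero_left] at this
    linarith
  have hdu : ∀ z, Ds (curve F) u z = 0 := by
    intro z
    rw [show u = fun _ => c from funext hu]
    simp [Ds, dot]
  have hd : ∀ z, Ds (curve F) (fun _ => (0 : ℝ)) z = 0 := by intro z; simp [Ds, dot]
  simp [geometricForm, hτ, hκ, hdu, hd, lineIntegral, areaIntegral, gradNormSq_zero hF]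

/-- The null space of the form. -/
lemma geometricForm_eq_zero_iff (F : PreShape) (X : Field)
    {a₁ a₂ b₁ b₂ c₁ c₂ : ℝ} (ha₁ : 0 < a₁) (ha₂ : 0 < a₂) (hb₁ : 0 < b₁) (hb₂ : 0 < b₂)
    (hc₁ : 0 < c₁) (hc₂ : 0 < c₂) :
    geometricForm a₁ a₂ b₁ b₂ c₁ c₂ F (h1 F X) (h2 F X) = 0 ↔ Nor.mk F X = 0 ∨
      ((∃ m : E3, ∀ z, darbouxN F z = m) ∧ (∃ c : ℝ, ∀ z, h1 F X z = c) ∧ ∀ p, h2 F X p = 0) := by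
  have hF := F.immersed
  rw [norMk_eq_zero_iff]
  constructor
  · intro h
    obtain ⟨hv, hu⟩ := hF.of_geometricForm_eq_zero ha₁ ha₂ hb₁ hb₂ hc₁ hc₂ (hF.smoothC_h1 X.smooth)
      (hF.smooth_h2 X.smooth) h
    have hconst := eq_of_Ds_eq_zero hF (hF.smoothC_h1 X.smooth) fun z => (hu z).2.1
    by_cases h0 : h1 F X 1 = 0
    · exact Or.inl ⟨funext fun z => (hconst z 1).trans h0, hv⟩
    · have hne : ∀ z, h1 F X z ≠ 0 := fun z => by rw [hconst z 1]; exact h0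
      refine Or.inr ⟨⟨darbouxN F 1, fun z => eq_of_Ds_eq_zero hF hF.smoothC_N (fun z => ?_) z 1⟩,
        ⟨h1 F X 1, fun z => hconst z 1⟩, fun p => congrFun hv p⟩
      rw [hF.Ds_N_eq, (mul_eq_zero.1 (hu z).1).resolve_left (hne z),
        (mul_eq_zero.1 (hu z).2.2).resolve_left (hne z)]
      simp
  · rintro (⟨hu, hv⟩ | ⟨⟨m, hm⟩, ⟨c, hc⟩, hv⟩)
    · have h0 := flagForm_eq_zero a₁ a₂ b₁ b₂ c₁ c₂ F hF hu hv X
      rwa [flagForm_self] at h0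
    · rw [show h2 F X = 0 from funext hv]
      exact geometricForm_const hF _ _ _ _ _ _ hm hc

end Positivity

/-! ### Change of variables on the sphere -/

section ChangeOfVariables

open Set Filter Topology MeasureTheory
open scoped Pointwise

lemma hasFDerivAt_norm_E3 {x : E3} (hx : x ≠ 0) :
    HasFDerivAt (fun x : E3 => ‖x‖) (innerSL ℝ (radial x : E3)) x := by
  have h1 := ((hasStrictFDerivAt_norm_sq x).hasFDerivAt).sqrt
    (pow_ne_zero 2 (norm_ne_zero_iff.2 hx))
  simp only [Real.sqrt_sq (norm_nonneg _)] at h1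
  refine h1.congr_fderiv ?_
  have := norm_ne_zero_iff.2 hx
  ext y
  rw [radial_of_ne hx]
  simp only [smul_apply, innerSL_apply_apply, real_inner_smul_left, smul_eq_mul, nsmul_eq_mul]
  field_simp
  simp

/-- The determinant of a linear map as the factor by which it changes triple products. -/
lemma inner_cross_map (A : E3 →L[ℝ] E3) (a b c : E3) :
    ⟪A a, cross (A b) (A c)⟫ = A.det * ⟪a, cross b c⟫ := by
  have hA : A.det = ⟪A (stdVec 0), cross (A (stdVec 1)) (A (stdVec 2))⟫ := by
    rw [ContinuousLinearMap.det, ← LinearMap.det_toMatrix (EuclideanSpace.basisFun (Fin 3) ℝ).toBasis,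
      Matrix.det_fin_three]
    simp [LinearMap.toMatrix_apply, inner_eq_sum, stdVec]
    ring
  rw [hA]
  conv_lhs => rw [eq_sum_stdVec a, eq_sum_stdVec b, eq_sum_stdVec c]
  simp only [map_add, map_smul, inner_eq_sum, cross_apply_zero, cross_apply_one, cross_apply_two,
    PiLp.add_apply, PiLp.smul_apply, smul_eq_mul]
  ring

/-- The product of two vectors of the plane `p^⊥` is a multiple of `p`. -/
lemma cross_eq_inner_smul {p a b : E3} (hp : ‖p‖ = 1) (ha : ⟪p, a⟫ = 0) (hb : ⟪p, b⟫ = 0) :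
    cross a b = ⟪p, cross a b⟫ • p := by
  have h1 : cross p (cross a b) = 0 := by rw [cross_cross_eq, ha, hb]; simp
  have h2 := norm_cross_sq p (cross a b)
  rw [h1, hp, norm_zero] at h2
  have hpp : ⟪p, p⟫ = 1 := by rw [real_inner_self_eq_norm_sq, hp, one_pow]
  rw [← real_inner_self_eq_norm_sq] at h2
  rw [← sub_eq_zero, ← inner_self_eq_zero (𝕜 := ℝ)]
  simp only [inner_sub_left, inner_sub_right, real_inner_smul_left, real_inner_smul_right, hpp,
    real_inner_comm p (cross a b)]
  linear_combination -h2

/-- A diffeomorphism of the sphere as a map into space. -/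
def sphereMap (γ : DiffS2) (p : S2) : E3 := γ p

lemma smooth_sphereMap (γ : DiffS2) : Smooth (sphereMap γ) := by
  have := fact_finrank_E3
  have h1 : ContMDiff (𝓡 2) 𝓘(ℝ, E3) ∞ (Subtype.val : S2 → E3) := contMDiff_coe_sphere
  exact smooth_of_contMDiff (h1.comp γ.contMDiff)

lemma norm_sphereMap (γ : DiffS2) (p : S2) : ‖sphereMap γ p‖ = 1 := norm_coe (γ p)

lemma inner_sphereMap_D (γ : DiffS2) (p : S2) (x : E3) :
    ⟪sphereMap γ p, D (sphereMap γ) p x⟫ = 0 := by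
  have h := D_inner_add (smooth_sphereMap γ) (smooth_sphereMap γ) (c := 1)
    (fun p => by rw [real_inner_self_eq_norm_sq, norm_sphereMap, one_pow]) p x
  rw [real_inner_comm (sphereMap γ p)] at h
  linarith

/-- The Jacobian determinant of a diffeomorphism of the sphere. -/
def jac (γ : DiffS2) (p : S2) : ℝ := ⟪sphereMap γ p, normalVec (sphereMap γ) p⟫

lemma smooth_jac (γ : DiffS2) : Smooth (jac γ) :=
  SmoothFam.inner (smooth_sphereMap γ) (SmoothFam.normalVec (smooth_sphereMap γ))

lemma normalVec_sphereMap (γ : DiffS2) (p : S2) :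
    normalVec (sphereMap γ) p = jac γ p • sphereMap γ p := by
  rw [jac, normalVec_eq_sgn, real_inner_smul_right, mul_smul,
    ← cross_eq_inner_smul (norm_sphereMap γ p) (inner_sphereMap_D γ p _) (inner_sphereMap_D γ p _)]

lemma continuousOn_radial : ContinuousOn radial {x | x ≠ 0} := fun _ hx =>
  (contMDiffAt_radial hx).continuousAt.continuousWithinAt

/-- The punctured unit ball. -/
def puncturedBall : Set E3 := {x | x ≠ 0 ∧ ‖x‖ < 1}

lemma isOpen_puncturedBall : IsOpen puncturedBall :=
  isOpen_ne.inter (isOpen_lt continuous_norm continuous_const)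

/-- The surface measure is, up to the factor `3`, the image of the volume of the ball under the
radial projection. -/
lemma toSphere_eq_map : (volume : Measure E3).toSphere =
    (3 : ENNReal) • (volume.restrict puncturedBall).map radial := by
  have hm : AEMeasurable radial (volume.restrict puncturedBall) :=
    (continuousOn_radial.mono fun x hx => hx.1).aemeasurable isOpen_puncturedBall.measurableSet
  ext s hs
  rw [Measure.toSphere_apply' _ hs, Measure.smul_apply, Measure.map_apply_of_aemeasurable hm hs]
  have hrank : Module.finrank ℝ E3 = 3 := finrank_euclideanSpace_fin
  have hset : Ioo (0 : ℝ) 1 • ((↑) '' s : Set E3) = radial ⁻¹' s ∩ puncturedBall := by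
    ext x
    rw [Set.mem_smul]
    constructor
    · rintro ⟨r, ⟨hr0, hr1⟩, _, ⟨p, hp, rfl⟩, rfl⟩
      refine ⟨?_, smul_ne_zero hr0.ne' (coe_ne_zero p), ?_⟩
      · rw [mem_preimage, radial_smul hr0, radial_coe]; exact hp
      · rw [norm_smul, norm_coe, mul_one, Real.norm_eq_abs, abs_of_pos hr0]; exact hr1
    · rintro ⟨hx, hx0, hx1⟩
      refine ⟨‖x‖, ⟨norm_pos_iff.2 hx0, hx1⟩, radial x, ⟨radial x, hx, rfl⟩, ?_⟩
      rw [radial_of_ne hx0, smul_smul, mul_inv_cancel₀ (norm_ne_zero_iff.2 hx0), one_smul]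
  have hnull : NullMeasurableSet (radial ⁻¹' s) (volume.restrict puncturedBall) :=
    hm.nullMeasurableSet_preimage hs
  rw [Measure.restrict_apply₀ hnull, hset, hrank]
  rfl

lemma integral_toSphere {ψ : S2 → ℝ} (hψ : Continuous ψ) :
    ∫ p, ψ p ∂((volume : Measure E3).toSphere) = 3 * ∫ x in puncturedBall, ψ (radial x) := by
  have hm : AEMeasurable radial (volume.restrict puncturedBall) :=
    (continuousOn_radial.mono fun x hx => hx.1).aemeasurable isOpen_puncturedBall.measurableSet
  rw [toSphere_eq_map, integral_smul_measure, integral_map hm hψ.aestronglyMeasurable]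
  simp

/-- The extension of a diffeomorphism of the sphere to space that is homogeneous of degree one. -/
def coneMap (γ : DiffS2) (x : E3) : E3 := ‖x‖ • sphereMap γ (radial x)

lemma norm_coneMap (γ : DiffS2) (x : E3) : ‖coneMap γ x‖ = ‖x‖ := by
  rw [coneMap, norm_smul, norm_sphereMap, mul_one, norm_norm]

lemma radial_coneMap (γ : DiffS2) {x : E3} (hx : x ≠ 0) : radial (coneMap γ x) = γ (radial x) := by
  rw [coneMap, radial_smul (norm_pos_iff.2 hx), sphereMap, radial_coe]

lemma norm_smul_radial {x : E3} (hx : x ≠ 0) : ‖x‖ • (radial x : E3) = x := by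
  rw [radial_of_ne hx, smul_smul, mul_inv_cancel₀ (norm_ne_zero_iff.2 hx), one_smul]

lemma injOn_coneMap (γ : DiffS2) : InjOn (coneMap γ) puncturedBall := by
  intro x hx y hy h
  have h1 : ‖x‖ = ‖y‖ := by rw [← norm_coneMap γ x, h, norm_coneMap]
  have h2 : radial x = radial y :=
    γ.injective (by
      change γ (radial x) = γ (radial y)
      rw [← radial_coneMap γ hx.1, h, radial_coneMap γ hy.1])
  rw [← norm_smul_radial hx.1, h1, h2, norm_smul_radial hy.1]

lemma image_coneMap (γ : DiffS2) : coneMap γ '' puncturedBall = puncturedBall := by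
  ext y
  constructor
  · rintro ⟨x, hx, rfl⟩
    refine ⟨?_, by rw [norm_coneMap]; exact hx.2⟩
    rw [← norm_ne_zero_iff, norm_coneMap]
    exact norm_ne_zero_iff.2 hx.1
  · intro hy
    have hpos := norm_pos_iff.2 hy.1
    set q := γ.symm (radial y)
    have hn : ‖‖y‖ • (q : E3)‖ = ‖y‖ := by rw [norm_smul, norm_coe, mul_one, norm_norm]
    refine ⟨‖y‖ • (q : E3), ⟨smul_ne_zero hpos.ne' (coe_ne_zero _), by rw [hn]; exact hy.2⟩, ?_⟩
    rw [coneMap, hn, radial_smul hpos, radial_coe, sphereMap, γ.apply_symm_apply,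
      norm_smul_radial hy.1]

lemma hasFDerivAt_coneMap (γ : DiffS2) {x : E3} (hx : x ≠ 0) :
    HasFDerivAt (coneMap γ) (D (sphereMap γ) (radial x) +
      (innerSL ℝ (radial x : E3)).smulRight (sphereMap γ (radial x))) x := by
  have h1 := ((smooth_sphereMap γ).differentiableAt hx).hasFDerivAt
  rw [fderiv_radial (smooth_sphereMap γ) hx] at h1
  refine ((hasFDerivAt_norm_E3 hx).smul h1).congr_fderiv ?_
  rw [smul_smul, mul_inv_cancel₀ (norm_ne_zero_iff.2 hx), one_smul]

lemma det_coneMap (γ : DiffS2) (p : S2) : (D (sphereMap γ) p +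
    (innerSL ℝ (p : E3)).smulRight (sphereMap γ p)).det = jac γ p := by
  set A := D (sphereMap γ) p + (innerSL ℝ (p : E3)).smulRight (sphereMap γ p) with hA
  have h := inner_cross_map A p (frame p 0) (frame p 1)
  have e0 : A (p : E3) = sphereMap γ p := by
    simp [hA, D_self (smooth_sphereMap γ)]
  have e1 : ∀ i, A (frame p i) = D (sphereMap γ) p (frame p i) := by
    intro i; simp [hA, inner_frame]
  rw [e0, e1, e1] at h
  rw [jac, normalVec_eq_sgn, real_inner_smul_right, h]
  change _ = sgn p * (A.det * sgn p)
  linear_combination (-A.det) * sgn_sq p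

/-- Change of variables on the sphere. -/
lemma integral_comp_mul_abs_jac (γ : DiffS2) {ψ : S2 → ℝ} (hψ : Continuous ψ) :
    ∫ p, ψ (γ p) * |jac γ p| ∂((volume : Measure E3).toSphere) =
      ∫ p, ψ p ∂((volume : Measure E3).toSphere) := by
  have hγ : Continuous γ := γ.contMDiff.continuous
  have hc : Continuous fun p => ψ (γ p) * |jac γ p| :=
    (hψ.comp hγ).mul (smooth_jac γ).continuous.abs
  rw [integral_toSphere hψ, integral_toSphere hc]
  congr 1
  conv_rhs => rw [← image_coneMap γ]
  rw [integral_image_eq_integral_abs_det_fderiv_smul volume isOpen_puncturedBall.measurableSet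
    (fun x hx => (hasFDerivAt_coneMap γ hx.1).hasFDerivWithinAt) (injOn_coneMap γ)]
  refine setIntegral_congr_fun isOpen_puncturedBall.measurableSet fun x hx => ?_
  beta_reduce
  rw [det_coneMap, radial_coneMap γ hx.1, smul_eq_mul, mul_comm]

end ChangeOfVariables

/-! ### Reparametrization of surfaces -/

section SurfaceReparam

open Set Filter Topology MeasureTheory

variable {V : Type*} [NormedAddCommGroup V] [NormedSpace ℝ V]

lemma hasFDerivAt_comp_diff {φ : S2 → V} (hφ : Smooth φ) (γ : DiffS2) (p : S2) :
    HasFDerivAt (fun x => φ (γ (radial x))) ((D φ (γ p)).comp (D (sphereMap γ) p)) (p : E3) := by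
  have h1 := (smooth_sphereMap γ).hasFDerivAt p
  have h2 := hφ.hasFDerivAt (γ p)
  have e : (γ p : E3) = sphereMap γ (radial (p : E3)) := by rw [radial_coe]; rfl
  rw [e] at h2
  have h3 := h2.comp (p : E3) h1
  refine h3.congr_of_eventuallyEq (Eventually.of_forall fun x => ?_)
  simp [sphereMap]

lemma D_comp_diff {φ : S2 → V} (hφ : Smooth φ) (γ : DiffS2) (p : S2) :
    D (fun q => φ (γ q)) p = (D φ (γ p)).comp (D (sphereMap γ) p) :=
  (hasFDerivAt_comp_diff hφ γ p).fderiv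

/-- Composition with a diffeomorphism multiplies alternating expressions by the Jacobian
determinant. -/
lemma wedge_comp_diff {V₁ V₂ : Type*} [NormedAddCommGroup V₁] [NormedSpace ℝ V₁]
    [NormedAddCommGroup V₂] [NormedSpace ℝ V₂] (β : V₁ →L[ℝ] V₂ →L[ℝ] V)
    (A : E3 →L[ℝ] V₁) (B : E3 →L[ℝ] V₂) (γ : DiffS2) (p : S2) :
    wedge β (A.comp (D (sphereMap γ) p)) (B.comp (D (sphereMap γ) p)) p =
      jac γ p • wedge β A B (γ p) := by
  have h : jac γ p • (γ p : E3) = normalVec (sphereMap γ) p := (normalVec_sphereMap γ p).symm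
  rw [wedge_frame, ← wedge_smul, h, normalVec_eq_sgn, wedge_smul, wedge_cross]
  rfl

lemma normalVec_comp_diff {F : S2 → E3} (hF : Smooth F) (γ : DiffS2) (p : S2) :
    normalVec (fun q => F (γ q)) p = jac γ p • normalVec F (γ p) := by
  rw [normalVec_eq, normalVec_eq, D_comp_diff hF, wedge_comp_diff, smul_comm]

lemma reparam_apply (F : PreShape) (γ : DiffS2) :
    ((F.reparam γ).toField : S2 → E3) = fun q => F (γ q) := rfl

lemma jac_ne_zero (F : PreShape) (γ : DiffS2) (p : S2) : jac γ p ≠ 0 := by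
  intro h
  have h1 := (F.reparam γ).immersed.ne_zero p
  rw [reparam_apply, normalVec_comp_diff F.immersed.smooth, h, zero_smul] at h1
  exact h1 rfl

/-- The Jacobian determinant has constant sign. -/
lemma exists_sign_jac (F : PreShape) (γ : DiffS2) :
    ∃ e : ℝ, e * e = 1 ∧ ∀ p, jac γ p = e * |jac γ p| := by
  have habs : Smooth fun p => |jac γ p| := by
    have : Smooth fun p => √(jac γ p ^ 2) := SmoothFam.sqrt (SmoothFam.pow (smooth_jac γ) 2)
      fun _ p => pow_ne_zero 2 (jac_ne_zero F γ p)
    simpa only [Real.sqrt_sq_eq_abs] using this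
  set ε : S2 → ℝ := fun p => jac γ p / |jac γ p| with hε
  have hne : ∀ p, |jac γ p| ≠ 0 := fun p => abs_ne_zero.2 (jac_ne_zero F γ p)
  have hs : Smooth ε := SmoothFam.div (smooth_jac γ) habs fun _ p => hne p
  have hsq : ∀ p, ε p * ε p = 1 := by
    intro p
    have := hne p
    have h2 := abs_mul_abs_self (jac γ p)
    simp only [hε]
    field_simp
    rw [sq, sq, h2]
  have hD : ∀ p, D ε p = 0 := by
    intro p
    have h1 := (hs.hasFDerivAt p).mul (hs.hasFDerivAt p)
    simp only [Pi.mul_def, hsq, radial_coe] at h1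
    have h2 := h1.unique (hasFDerivAt_const (1 : ℝ) (p : E3))
    rw [← two_smul ℝ, smul_smul] at h2
    refine (smul_eq_zero.1 h2).resolve_left ?_
    have : ε p ≠ 0 := fun h0 => by have := hsq p; rw [h0] at this; norm_num at this
    exact mul_ne_zero two_ne_zero this
  refine ⟨ε (equator 1), hsq _, fun p => ?_⟩
  rw [eq_of_D_eq_zero hs hD (equator 1) p, hε]
  exact (div_mul_cancel₀ _ (hne p)).symm

variable {F : PreShape} {γ : DiffS2} {e : ℝ} (he : e * e = 1) (hj : ∀ p, jac γ p = e * |jac γ p|)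

lemma norm_normalVec_reparam (F : PreShape) (γ : DiffS2) (p : S2) :
    ‖normalVec (F.reparam γ) p‖ = |jac γ p| * ‖normalVec F (γ p)‖ := by
  rw [reparam_apply, normalVec_comp_diff F.immersed.smooth, norm_smul, Real.norm_eq_abs]

include hj in
lemma unitNormal_reparam : unitNormal (F.reparam γ) = fun p => e • unitNormal F (γ p) := by
  funext p
  have h := abs_ne_zero.2 (jac_ne_zero F γ p)
  rw [unitNormal, norm_normalVec_reparam, reparam_apply, normalVec_comp_diff F.immersed.smooth,
    unitNormal, smul_smul, smul_smul]
  congr 1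
  conv_lhs => rw [hj p]
  rw [abs_mul, abs_abs]
  have he : |e| * |jac γ p| = |jac γ p| := by
    rw [← abs_abs (jac γ p), ← abs_mul, ← hj, abs_abs]
  rw [he]
  field_simp

include hj in
lemma D_unitNormal_reparam (p : S2) :
    D (unitNormal (F.reparam γ)) p = (e • D (unitNormal F) (γ p)).comp (D (sphereMap γ) p) := by
  rw [unitNormal_reparam hj]
  exact ((hasFDerivAt_comp_diff F.immersed.smooth_unitNormal γ p).const_smul e).fderiv

lemma wedge_smul_right {V₁ V₂ : Type*} [NormedAddCommGroup V₁] [NormedSpace ℝ V₁]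
    [NormedAddCommGroup V₂] [NormedSpace ℝ V₂] (β : V₁ →L[ℝ] V₂ →L[ℝ] V)
    (A : E3 →L[ℝ] V₁) (B : E3 →L[ℝ] V₂) (r : ℝ) (p : E3) :
    wedge β A (r • B) p = r • wedge β A B p := by
  simp only [wedge, smul_apply, map_smul]
  module

lemma wedge_smul_left {V₁ V₂ : Type*} [NormedAddCommGroup V₁] [NormedSpace ℝ V₁]
    [NormedAddCommGroup V₂] [NormedSpace ℝ V₂] (β : V₁ →L[ℝ] V₂ →L[ℝ] V)
    (A : E3 →L[ℝ] V₁) (B : E3 →L[ℝ] V₂) (r : ℝ) (p : E3) :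
    wedge β (r • A) B p = r • wedge β A B p := by
  simp only [wedge, smul_apply, map_smul]
  module

include hj in
lemma trace_shapeOp_reparam (p : S2) :
    (shapeOp (F.reparam γ) p).trace = e * (shapeOp F (γ p)).trace := by
  have h := jac_ne_zero F γ p
  rw [trace_shapeOp_eq_wedge, trace_shapeOp_eq_wedge, D_unitNormal_reparam hj,
    norm_normalVec_reparam, reparam_apply, D_comp_diff F.immersed.smooth, wedge_comp_diff,
    wedge_smul_right, normalVec_comp_diff F.immersed.smooth, real_inner_smul_left,
    real_inner_smul_left, real_inner_smul_right, mul_pow, sq_abs]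
  have := norm_ne_zero_iff.2 (F.immersed.ne_zero (γ p))
  field_simp

include he hj in
lemma det_shapeOp_reparam (p : S2) :
    (shapeOp (F.reparam γ) p).det = (shapeOp F (γ p)).det := by
  have h := jac_ne_zero F γ p
  rw [det_shapeOp_eq_wedge, det_shapeOp_eq_wedge, normalVec_eq (unitNormal (F.reparam γ)),
    D_unitNormal_reparam hj,
    norm_normalVec_reparam, reparam_apply, wedge_comp_diff, wedge_smul_right, wedge_smul_left,
    normalVec_comp_diff F.immersed.smooth, smul_smul, smul_smul, smul_smul, mul_pow, sq_abs,
    show 1 / 2 * jac γ p * e * e = jac γ p * (1 / 2) by rw [mul_assoc (1 / 2 * jac γ p), he]; ring, mul_smul,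
    ← normalVec_eq, real_inner_smul_left, real_inner_smul_right]
  have := norm_ne_zero_iff.2 (F.immersed.ne_zero (γ p))
  field_simp

include he hj in
lemma kappa_add_sq_reparam (p : S2) :
    (kappa1 (F.reparam γ) p + kappa2 (F.reparam γ) p) ^ 2 =
      (kappa1 F (γ p) + kappa2 F (γ p)) ^ 2 := by
  rw [(F.reparam γ).immersed.kappa_add, F.immersed.kappa_add, trace_shapeOp_reparam hj, mul_pow,
    sq e, he, one_mul]

include he hj in
lemma kappa_sub_sq_reparam (p : S2) :
    (kappa1 (F.reparam γ) p - kappa2 (F.reparam γ) p) ^ 2 =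
      (kappa1 F (γ p) - kappa2 F (γ p)) ^ 2 := by
  rw [(F.reparam γ).immersed.kappa_sub_sq, F.immersed.kappa_sub_sq, trace_shapeOp_reparam hj,
    det_shapeOp_reparam he hj, mul_pow, sq e, he, one_mul]

include he in
lemma gradNormSq_reparam {h : S2 → ℝ} (hh : Smooth h) (p : S2) :
    gradNormSq (F.reparam γ) (fun q => e * h (γ q)) p = gradNormSq F h (γ p) := by
  have h0 := jac_ne_zero F γ p
  have hD : D (fun q => e * h (γ q)) p = (e • D h (γ p)).comp (D (sphereMap γ) p) :=
    ((hasFDerivAt_comp_diff hh γ p).const_mul e).fderiv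
  rw [(F.reparam γ).immersed.gradNormSq_eq, F.immersed.gradNormSq_eq, norm_normalVec_reparam,
    reparam_apply, D_comp_diff F.immersed.smooth, hD, wedge_comp_diff, wedge_smul_left, norm_smul,
    norm_smul, mul_pow, mul_pow, mul_pow, Real.norm_eq_abs, Real.norm_eq_abs, sq_abs, sq_abs, sq e,
    he, one_mul]
  have := norm_ne_zero_iff.2 (F.immersed.ne_zero (γ p))
  field_simp

include hj in
lemma h2_reparam (X : Field) :
    h2 (F.reparam γ) (reparamField X γ) = fun p => e * h2 F X (γ p) := by
  funext p
  rw [h2, unitNormal_reparam hj, real_inner_smul_right]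
  rfl

lemma areaIntegral_reparam (F : PreShape) (γ : DiffS2) {φ : S2 → ℝ} (hφ : Smooth φ) :
    areaIntegral (F.reparam γ) (fun p => φ (γ p)) = areaIntegral F φ := by
  rw [areaIntegral_eq, areaIntegral_eq]
  simp only [norm_normalVec_reparam]
  have hc : Continuous fun p => φ p * ‖normalVec F p‖ :=
    Smooth.continuous (SmoothFam.mul hφ F.immersed.const.norm_normalVec)
  rw [← integral_comp_mul_abs_jac γ hc]
  congr 1
  funext p
  ring

lemma smooth_gradNormSq (F : PreShape) {φ : S2 → ℝ} (hφ : Smooth φ) :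
    Smooth (gradNormSq F φ) := by
  have h : gradNormSq F φ =
      fun p => (‖normalVec F p‖ ^ 2)⁻¹ * ⟪rotGrad F φ p, rotGrad F φ p⟫ := by
    funext p
    rw [F.immersed.gradNormSq_eq, real_inner_self_eq_norm_sq, rotGrad]
  have hr := SmoothFam.rotGrad F.immersed.smooth hφ
  rw [h]
  exact SmoothFam.mul (SmoothFam.inv (SmoothFam.pow F.immersed.const.norm_normalVec 2)
    fun _ p => pow_ne_zero 2 (norm_ne_zero_iff.2 (F.immersed.ne_zero p))) (SmoothFam.inner hr hr)

end SurfaceReparam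

/-! ### Reparametrization of curves -/

section CurveReparam

open Set Filter Topology MeasureTheory

variable {V : Type*} [NormedAddCommGroup V] [NormedSpace ℝ V]

/-- The angular speed of the restriction to the equator of a diffeomorphism that preserves the
equator. -/
def angularSpeed (γ : DiffS2) (z : Circle) : ℝ :=
  ⟪dot (fun w => sphereMap γ (equator w)) z, equatorDir (sphereMap γ (equator z))⟫

lemma smoothC_const (c : V) : SmoothC fun _ => c :=
  (contDiff_const : ContDiff ℝ ∞ fun _ : ℝ × ℝ => c)

lemma smoothC_sphereMap (γ : DiffS2) : SmoothC fun w => sphereMap γ (equator w) :=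
  SmoothFam.loop (smooth_sphereMap γ)

lemma continuous_angularSpeed (γ : DiffS2) : Continuous (angularSpeed γ) := by
  have h1 := SmoothLoop.inner (SmoothLoop.dot (smoothC_sphereMap γ))
    (SmoothLoop.cross (smoothC_const (stdVec 2)) (smoothC_sphereMap γ))
  exact SmoothLoop.continuous h1 0

variable {γ : DiffS2} {σ : Circle → Circle} (hσ : ∀ z, γ (equator z) = equator (σ z))
include hσ

lemma sphereMap_equator (z : Circle) : sphereMap γ (equator z) = equator (σ z) := by
  rw [sphereMap, hσ]

lemma dot_sphereMap (z : Circle) : dot (fun w => sphereMap γ (equator w)) z =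
    angularSpeed γ z • equatorDir (equator (σ z)) := by
  have h1 := dot_inner_add (smoothC_sphereMap γ) (smoothC_sphereMap γ) (c := 1)
    (fun w => by rw [real_inner_self_eq_norm_sq, norm_sphereMap, one_pow]) z
  have h2 := dot_inner_add (smoothC_const (stdVec 2)) (smoothC_sphereMap γ) (c := 0)
    (fun w => by rw [sphereMap_equator hσ, inner_eq_sum, equator_two]; simp [stdVec]) z
  have h3 : dot (fun _ : Circle => stdVec 2) z = 0 := by simp [dot]
  rw [h3, inner_zero_left, add_zero] at h2
  rw [angularSpeed, sphereMap_equator hσ]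
  refine eq_smul_equatorDir _ ?_ ?_
  · rw [sphereMap_equator hσ, real_inner_comm] at h1
    linarith
  · rw [inner_eq_sum] at h2
    simpa [stdVec] using h2

/-- The restriction to the equator lifts to a map of angles. -/
lemma exists_lift : ∃ L : ℝ → ℝ, (∀ θ, HasDerivAt L (angularSpeed γ (Circle.exp θ)) θ) ∧
    ∀ θ, σ (Circle.exp θ) = Circle.exp (L θ) := by
  have hc : Continuous fun θ : ℝ => angularSpeed γ (Circle.exp θ) :=
    (continuous_angularSpeed γ).comp Circle.exp.continuous
  set L : ℝ → ℝ := fun θ => Complex.arg (σ (Circle.exp 0)) +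
    ∫ t in (0 : ℝ)..θ, angularSpeed γ (Circle.exp t) with hL
  have hd : ∀ θ, HasDerivAt L (angularSpeed γ (Circle.exp θ)) θ := fun θ =>
    (intervalIntegral.integral_hasDerivAt_right (hc.intervalIntegrable _ _)
      (hc.stronglyMeasurableAtFilter _ _) hc.continuousAt).const_add _
  refine ⟨L, hd, fun θ => ?_⟩
  set g : ℝ → ℂ := fun θ => σ (Circle.exp θ) with hg
  have hgd : ∀ θ, HasDerivAt g (angularSpeed γ (Circle.exp θ) * Complex.I * g θ) θ := by
    intro θ
    have h1 := (smoothC_sphereMap γ).hasDerivAt θ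
    rw [dot_sphereMap hσ, equatorDir_eq] at h1
    have hcoord : ∀ i : Fin 3, HasDerivAt (fun θ => (equator (σ (Circle.exp θ)) : E3) i)
        ((angularSpeed γ (Circle.exp θ) • (!₂[-(equator (σ (Circle.exp θ)) : E3) 1,
          (equator (σ (Circle.exp θ)) : E3) 0, 0] : E3)) i) θ := by
      intro i
      have := (EuclideanSpace.proj (𝕜 := ℝ) i : E3 →L[ℝ] ℝ).hasFDerivAt.comp_hasDerivAt θ h1
      simp only [sphereMap_equator hσ] at this
      exact this
    have h2 := (hcoord 0).ofReal_comp.add ((hcoord 1).ofReal_comp.mul_const Complex.I)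
    have e : g = fun θ => (((equator (σ (Circle.exp θ)) : E3) 0 : ℝ) : ℂ) +
        (((equator (σ (Circle.exp θ)) : E3) 1 : ℝ) : ℂ) * Complex.I := by
      funext θ
      exact (Complex.re_add_im _).symm
    rw [e]
    refine h2.congr_deriv ?_
    simp
    linear_combination (-(angularSpeed γ (Circle.exp θ) : ℂ) *
      (((equator (σ (Circle.exp θ)) : E3) 1 : ℝ) : ℂ)) * Complex.I_mul_I
  have hprod : ∀ θ, HasDerivAt (fun θ => g θ * Complex.exp (-(L θ : ℂ) * Complex.I)) 0 θ := by
    intro θ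
    have h1 := (((hd θ).ofReal_comp.neg).mul_const Complex.I).cexp
    refine ((hgd θ).mul h1).congr_deriv ?_
    ring
  have hconst := is_const_of_deriv_eq_zero (fun θ => (hprod θ).differentiableAt)
    (fun θ => (hprod θ).deriv) θ 0
  have h0 : g 0 * Complex.exp (-(L 0 : ℂ) * Complex.I) = 1 := by
    have e0 : L 0 = Complex.arg (σ (Circle.exp 0)) := by simp [hL]
    have e1 : g 0 = Complex.exp (L 0 * Complex.I) := by
      rw [e0, hg, ← Circle.coe_exp, Circle.exp_arg]
    rw [e1, ← Complex.exp_add]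
    simp
  rw [h0, neg_mul, Complex.exp_neg, mul_inv_eq_one₀ (Complex.exp_ne_zero _)] at hconst
  apply Circle.ext
  rw [Circle.coe_exp]
  exact hconst

/-- The chain rule along the circle; the constant factor accounts for the signs by which the Darboux
frame changes. -/
lemma dot_comp_circle {k : Circle → V} (hk : SmoothC k) (c : ℝ) (z : Circle) :
    dot (fun w => c • k (σ w)) z = (c * angularSpeed γ z) • dot k (σ z) := by
  obtain ⟨L, hd, hL⟩ := exists_lift hσ
  obtain ⟨θ, rfl⟩ := exists_exp z
  rw [dot_exp]
  simp only [hL]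
  rw [mul_smul]
  exact (((hk.hasDerivAt (L θ)).scomp θ (hd θ)).const_smul c).deriv

omit hσ in
/-- A strictly increasing lift of an injective circle map increases by exactly `2 π` over a period:
if it increased by more, the circle map would take its value at `0` a second time. -/
lemma lift_two_pi {M : ℝ → ℝ} (hM : StrictMono M) (hc : Continuous M)
    (h : Circle.exp (M (2 * Real.pi)) = Circle.exp (M 0))
    (hinj : ∀ s, Circle.exp (M s) = Circle.exp (M 0) → Circle.exp s = Circle.exp 0) :
    M (2 * Real.pi) = M 0 + 2 * Real.pi := by
  have hπ := Real.two_pi_pos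
  obtain ⟨m, hm⟩ := Circle.exp_eq_exp.1 h
  have h0 := hM hπ
  have hm0 : 0 < m := by
    by_contra! hle
    have : (m : ℝ) ≤ 0 := by exact_mod_cast hle
    nlinarith
  rcases (show m = 1 ∨ 2 ≤ m by omega) with rfl | h2
  · simpa using hm
  · exfalso
    have h2' : (2 : ℝ) ≤ m := by exact_mod_cast h2
    obtain ⟨θ, ⟨hθ0, hθ1⟩, hθ⟩ : M 0 + 2 * Real.pi ∈ M '' Ioo 0 (2 * Real.pi) :=
      intermediate_value_Ioo hπ.le hc.continuousOn ⟨by linarith, by nlinarith⟩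
    have := hinj θ (by rw [hθ]; exact Circle.exp_eq_exp.2 ⟨1, by simp⟩)
    obtain ⟨k, hk⟩ := Circle.exp_eq_exp.1 this
    rw [zero_add] at hk
    have hk0 : (0 : ℝ) < k := by
      by_contra! hle
      nlinarith
    have hk1 : (k : ℝ) < 1 := by
      by_contra! hle
      nlinarith
    have a1 : 0 < k := by exact_mod_cast hk0
    have a2 : k < 1 := by exact_mod_cast hk1
    omega

/-- Change of variables on the circle. -/
lemma integral_comp_circle (hinj : Function.Injective σ) {e : ℝ} (he : e * e = 1)
    (hs : ∀ z, 0 < e * angularSpeed γ z) {ψ : Circle → ℝ} (hψ : Continuous ψ) :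
    ∫ θ in (0 : ℝ)..(2 * Real.pi), ψ (σ (Circle.exp θ)) * (e * angularSpeed γ (Circle.exp θ)) =
      ∫ θ in (0 : ℝ)..(2 * Real.pi), ψ (Circle.exp θ) := by
  obtain ⟨L, hd, hL⟩ := exists_lift hσ
  have hLc : Continuous L := continuous_iff_continuousAt.2 fun θ => (hd θ).continuousAt
  have hper : Function.Periodic (fun θ => ψ (Circle.exp θ)) (2 * Real.pi) := fun θ => by
    simp only [Circle.periodic_exp θ]
  have hac : Continuous fun θ : ℝ => angularSpeed γ (Circle.exp θ) :=
    (continuous_angularSpeed γ).comp Circle.exp.continuous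
  have hψc : Continuous fun θ => ψ (Circle.exp θ) := hψ.comp Circle.exp.continuous
  have hsub : ∫ θ in (0 : ℝ)..(2 * Real.pi), ψ (σ (Circle.exp θ)) *
      (e * angularSpeed γ (Circle.exp θ)) = e * ∫ s in (L 0)..(L (2 * Real.pi)),
        ψ (Circle.exp s) := by
    rw [← intervalIntegral.integral_comp_mul_deriv (f := L)
      (f' := fun θ => angularSpeed γ (Circle.exp θ)) (g := fun s => ψ (Circle.exp s))
      (fun θ _ => hd θ) hac.continuousOn hψc, ← intervalIntegral.integral_const_mul]
    congr 1
    funext θ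
    rw [hL, Function.comp_apply]
    ring
  have hmono : StrictMono fun θ => e * L θ :=
    strictMono_of_hasDerivAt_pos (fun θ => (hd θ).const_mul e) fun θ => hs _
  have hexp : Circle.exp (2 * Real.pi) = Circle.exp 0 := by simp
  have hend : Circle.exp (L (2 * Real.pi)) = Circle.exp (L 0) := by rw [← hL, ← hL, hexp]
  have hback : ∀ s, Circle.exp (L s) = Circle.exp (L 0) → Circle.exp s = Circle.exp 0 := by
    intro s h
    rw [← hL, ← hL] at h
    exact hinj h
  rw [hsub]
  rcases mul_self_eq_one_iff.1 he with rfl | rfl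
  · simp only [one_mul] at hmono ⊢
    rw [lift_two_pi hmono hLc hend hback, hper.intervalIntegral_add_eq (L 0) 0, zero_add]
  · simp only [neg_mul, one_mul] at hmono ⊢
    have hneg : ∀ s t, Circle.exp (-L s) = Circle.exp (-L t) ↔
        Circle.exp (L s) = Circle.exp (L t) := fun s t => by
      rw [Circle.exp_neg, Circle.exp_neg, inv_inj]
    have h := lift_two_pi hmono hLc.neg ((hneg _ _).2 hend) fun s h => hback s ((hneg _ _).1 h)
    have h' : L 0 = L (2 * Real.pi) + 2 * Real.pi := by linarith
    rw [← intervalIntegral.integral_symm, h', hper.intervalIntegral_add_eq _ 0, zero_add]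

lemma curve_reparam (F : PreShape) : curve (F.reparam γ) = fun z => curve F (σ z) := by
  funext z
  rw [curve, reparam_apply]
  beta_reduce
  rw [hσ]; rfl

lemma dot_curve_reparam (F : PreShape) (z : Circle) :
    dot (curve (F.reparam γ)) z = angularSpeed γ z • dot (curve F) (σ z) := by
  have := dot_comp_circle hσ F.immersed.smoothC_curve 1 z
  simpa only [curve_reparam hσ, one_smul, one_mul] using this

/-- The restriction to the equator preserves or reverses the orientation. -/
lemma exists_sign_angularSpeed (F : PreShape) :
    ∃ e : ℝ, e * e = 1 ∧ ∀ z, 0 < e * angularSpeed γ z := by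
  have hne : ∀ z, angularSpeed γ z ≠ 0 := by
    intro z h0
    have h := (F.reparam γ).immersed.dot_curve_ne_zero z
    rw [dot_curve_reparam hσ, h0, zero_smul] at h
    exact h rfl
  have hc : Continuous fun θ : ℝ => angularSpeed γ (Circle.exp θ) :=
    (continuous_angularSpeed γ).comp Circle.exp.continuous
  have hsame : ∀ s t : ℝ, angularSpeed γ (Circle.exp s) ≤ 0 →
      0 ≤ angularSpeed γ (Circle.exp t) → False := fun s t h1 h2 => by
    obtain ⟨θ, hθ⟩ := mem_range_of_exists_le_of_exists_ge hc ⟨s, h1⟩ ⟨t, h2⟩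
    exact hne _ hθ
  rcases lt_or_ge 0 (angularSpeed γ (Circle.exp 0)) with h | h
  · refine ⟨1, one_mul 1, fun z => ?_⟩
    obtain ⟨θ, rfl⟩ := exists_exp z
    rw [one_mul]
    by_contra! hle
    exact hsame θ 0 hle h.le
  · refine ⟨-1, by norm_num, fun z => ?_⟩
    obtain ⟨θ, rfl⟩ := exists_exp z
    by_contra! hle
    exact hsame 0 θ h (by linarith)

section Sign

variable {F : PreShape} {e e' : ℝ} (he : e * e = 1) (hj : ∀ p, jac γ p = e * |jac γ p|)
  (he' : e' * e' = 1) (hs : ∀ z, 0 < e' * angularSpeed γ z)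

include he' hs

lemma speed_reparam (z : Circle) :
    speed (curve (F.reparam γ)) z = e' * angularSpeed γ z * speed (curve F) (σ z) := by
  have h : |e'| = 1 := by
    rcases mul_self_eq_one_iff.1 he' with rfl | rfl <;> simp
  have h2 := abs_of_pos (hs z)
  rw [abs_mul, h, one_mul] at h2
  rw [speed, dot_curve_reparam hσ, norm_smul, Real.norm_eq_abs, h2, speed]

lemma Ds_reparam {k : Circle → V} (hk : SmoothC k) (c : ℝ) (z : Circle) :
    Ds (curve (F.reparam γ)) (fun w => c • k (σ w)) z = (c * e') • Ds (curve F) k (σ z) := by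
  have h1 := hs z
  have h2 := F.immersed.speed_ne_zero (σ z)
  have h3 : angularSpeed γ z ≠ 0 := right_ne_zero_of_mul h1.ne'
  have h4 : e' ≠ 0 := left_ne_zero_of_mul h1.ne'
  rw [Ds, dot_comp_circle hσ hk, speed_reparam hσ he' hs, Ds, smul_smul, smul_smul]
  congr 1
  field_simp
  linear_combination -c * he'

lemma darbouxT_reparam : darbouxT (F.reparam γ) = fun z => e' • darbouxT F (σ z) := by
  funext z
  have h := Ds_reparam (F := F) hσ he' hs F.immersed.smoothC_curve 1 z
  simp only [one_smul, one_mul, ← curve_reparam hσ] at h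
  exact h

include he hj

omit he he' hs in
lemma darbouxNu_reparam : darbouxNu (F.reparam γ) = fun z => e • darbouxNu F (σ z) := by
  funext z
  rw [darbouxNu, unitNormal_reparam hj]
  beta_reduce
  rw [hσ]; rfl

omit he in
lemma darbouxN_reparam : darbouxN (F.reparam γ) = fun z => (e * e') • darbouxN F (σ z) := by
  funext z
  rw [darbouxN, darbouxNu_reparam hσ hj, darbouxT_reparam hσ he' hs, cross_smul_left,
    cross_smul_right, smul_smul, darbouxN]

omit he in
lemma h1_reparam (X : Field) :
    h1 (F.reparam γ) (reparamField X γ) = fun z => (e * e') • h1 F X (σ z) := by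
  funext z
  have : reparamField X γ (equator z) = X (equator (σ z)) := by rw [← hσ]; rfl
  rw [h1, darbouxN_reparam hσ hj he' hs, real_inner_smul_right, this]; rfl

omit he in
lemma kappaG_reparam (z : Circle) : kappaG (F.reparam γ) z = e * e' * kappaG F (σ z) := by
  rw [kappaG, darbouxT_reparam hσ he' hs, Ds_reparam hσ he' hs F.immersed.smoothC_T,
    darbouxN_reparam hσ hj he' hs, he', one_smul, real_inner_smul_right, kappaG]

omit he in
lemma kappaN_reparam (z : Circle) : kappaN (F.reparam γ) z = e * kappaN F (σ z) := by
  rw [kappaN, darbouxT_reparam hσ he' hs, Ds_reparam hσ he' hs F.immersed.smoothC_T,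
    darbouxNu_reparam hσ hj, he', one_smul, real_inner_smul_right, kappaN]

lemma tauG_reparam (z : Circle) : tauG (F.reparam γ) z = tauG F (σ z) := by
  rw [tauG, darbouxN_reparam hσ hj he' hs, Ds_reparam hσ he' hs F.immersed.smoothC_N,
    darbouxNu_reparam hσ hj, real_inner_smul_right, real_inner_smul_left, tauG]
  linear_combination (e' * e' * he + he') * ⟪Ds (curve F) (darbouxN F) (σ z), darbouxNu F (σ z)⟫

/-- The three expressions along the curve are invariant up to sign. -/
lemma lineTerm_sq_reparam (i : Fin 3) (X : Field) (z : Circle) :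
    lineTerm (F.reparam γ) i (h1 (F.reparam γ) (reparamField X γ))
      (h2 (F.reparam γ) (reparamField X γ)) z ^ 2 = lineTerm F i (h1 F X) (h2 F X) (σ z) ^ 2 := by
  have hF := F.immersed
  have k1 : SmoothC (h1 F X) := hF.smoothC_h1 X.smooth
  have k2 : SmoothC fun w => h2 F X (equator w) := SmoothFam.loop (hF.smooth_h2 X.smooth)
  have e2 : ∀ w, h2 (F.reparam γ) (reparamField X γ) (equator w) = e • h2 F X (equator (σ w)) :=
    fun w => by
      rw [h2_reparam hj]
      beta_reduce
      rw [hσ, smul_eq_mul]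
  fin_cases i
  · simp only [lineTerm, e2, h1_reparam hσ hj he' hs, kappaG_reparam hσ hj he' hs,
      kappaN_reparam hσ hj he' hs, smul_eq_mul]
    have : e * e' * h1 F X (σ z) * (e * e' * kappaG F (σ z)) +
        e * h2 F X (equator (σ z)) * (e * kappaN F (σ z)) =
        h1 F X (σ z) * kappaG F (σ z) + h2 F X (equator (σ z)) * kappaN F (σ z) := by
      linear_combination (e' * e' * he + he') * (h1 F X (σ z) * kappaG F (σ z)) +
        he * (h2 F X (equator (σ z)) * kappaN F (σ z))
    rw [this]
  · simp only [lineTerm, e2, h1_reparam hσ hj he' hs, tauG_reparam hσ he hj he' hs,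
      Ds_reparam hσ he' hs k1]
    simp only [smul_eq_mul]
    have : e * e' * e' * Ds (curve F) (h1 F X) (σ z) -
        e * h2 F X (equator (σ z)) * tauG F (σ z) =
        e * (Ds (curve F) (h1 F X) (σ z) - h2 F X (equator (σ z)) * tauG F (σ z)) := by
      linear_combination e * he' * Ds (curve F) (h1 F X) (σ z)
    rw [this, mul_pow, sq e, he, one_mul]
  · simp only [lineTerm, e2, h1_reparam hσ hj he' hs, tauG_reparam hσ he hj he' hs,
      Ds_reparam hσ he' hs k2]
    simp only [smul_eq_mul]
    rw [mul_assoc (e * e') (h1 F X (σ z)), ← mul_add, mul_pow, mul_pow, sq e, sq e', he, he',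
      one_mul, one_mul]

omit he hj in
lemma lineIntegral_reparam (hinj : Function.Injective σ) {φ : Circle → ℝ} (hφ : Continuous φ) :
    lineIntegral (curve (F.reparam γ)) (fun z => φ (σ z)) = lineIntegral (curve F) φ := by
  have hc : Continuous fun z => φ z * speed (curve F) z :=
    hφ.mul (SmoothLoop.continuous F.immersed.const.speed 0)
  rw [lineIntegral, lineIntegral, ← integral_comp_circle hσ hinj he' hs hc]
  simp only [speed_reparam hσ he' hs]
  congr 1
  funext θ
  ring

end Sign

omit hσ

/-- The geometric expression is invariant under reparametrizations. -/
lemma geometricForm_reparam (a₁ a₂ b₁ b₂ c₁ c₂ : ℝ) (F : PreShape) (hγ : IsReparam γ)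
    (X : Field) : geometricForm a₁ a₂ b₁ b₂ c₁ c₂ (F.reparam γ)
      (h1 (F.reparam γ) (reparamField X γ)) (h2 (F.reparam γ) (reparamField X γ)) =
      geometricForm a₁ a₂ b₁ b₂ c₁ c₂ F (h1 F X) (h2 F X) := by
  obtain ⟨γ', hσ⟩ := hγ
  obtain ⟨e, he, hj⟩ := exists_sign_jac F γ
  obtain ⟨e', he', hs⟩ := exists_sign_angularSpeed hσ F
  have hF := F.immersed
  have k2 : Smooth (h2 F X) := hF.smooth_h2 X.smooth
  have hline : ∀ i, lineIntegral (curve (F.reparam γ)) (fun z => lineTerm (F.reparam γ) i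
      (h1 (F.reparam γ) (reparamField X γ)) (h2 (F.reparam γ) (reparamField X γ)) z ^ 2) =
      lineIntegral (curve F) fun z => lineTerm F i (h1 F X) (h2 F X) z ^ 2 := by
    intro i
    simp only [lineTerm_sq_reparam hσ he hj he' hs]
    exact lineIntegral_reparam hσ he' hs γ'.injective
      (φ := fun z => lineTerm F i (h1 F X) (h2 F X) z ^ 2)
      ((SmoothLoop.continuous (hF.smoothC_lineTerm i X) 0).pow 2)
  have hsub := areaIntegral_reparam F γ
    (SmoothFam.mul (SmoothFam.pow k2 2) hF.smooth_kappa_sub_sq)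
  have hadd := areaIntegral_reparam F γ
    (SmoothFam.mul (SmoothFam.pow k2 2) hF.smooth_kappa_add_sq)
  have hgrad := areaIntegral_reparam F γ (smooth_gradNormSq F k2)
  have e0 := hline 0
  have e1 := hline 1
  have e2 := hline 2
  simp only [lineTerm] at e0 e1 e2
  have hsq : ∀ p, (e * h2 F X (γ p)) ^ 2 = h2 F X (γ p) ^ 2 := fun p => by
    rw [mul_pow, sq e, he, one_mul]
  have i1 : (fun p => h2 (F.reparam γ) (reparamField X γ) p ^ 2 *
      (kappa1 (F.reparam γ) p - kappa2 (F.reparam γ) p) ^ 2) =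
      fun p => h2 F X (γ p) ^ 2 * (kappa1 F (γ p) - kappa2 F (γ p)) ^ 2 := by
    funext p
    rw [kappa_sub_sq_reparam he hj, h2_reparam hj, hsq]
  have i2 : (fun p => h2 (F.reparam γ) (reparamField X γ) p ^ 2 *
      (kappa1 (F.reparam γ) p + kappa2 (F.reparam γ) p) ^ 2) =
      fun p => h2 F X (γ p) ^ 2 * (kappa1 F (γ p) + kappa2 F (γ p)) ^ 2 := by
    funext p
    rw [kappa_add_sq_reparam he hj, h2_reparam hj, hsq]
  have i3 : (fun p => gradNormSq (F.reparam γ) (h2 (F.reparam γ) (reparamField X γ)) p) =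
      fun p => gradNormSq F (h2 F X) (γ p) := by
    funext p
    rw [h2_reparam hj, gradNormSq_reparam he k2]
  rw [geometricForm, geometricForm, e0, e1, e2, i1, i2, i3, hsub, hadd, hgrad]

/-- The form on the normal bundle is invariant: its quadratic form is, and a symmetric form is
determined by its quadratic form. -/
lemma norForm_reparam (a₁ a₂ b₁ b₂ c₁ c₂ : ℝ) (F : PreShape) (hγ : IsReparam γ) (X Y : Field) :
    norForm a₁ a₂ b₁ b₂ c₁ c₂ (F.reparam γ) (Nor.mk _ (reparamField X γ))
        (Nor.mk _ (reparamField Y γ)) =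
      norForm a₁ a₂ b₁ b₂ c₁ c₂ F (Nor.mk F X) (Nor.mk F Y) := by
  have hq : ∀ X : Field, flagForm a₁ a₂ b₁ b₂ c₁ c₂ (F.reparam γ) (F.reparam γ).immersed
      (reparamField X γ) (reparamField X γ) =
      flagForm a₁ a₂ b₁ b₂ c₁ c₂ F F.immersed X X := fun X => by
    rw [flagForm_self, flagForm_self, geometricForm_reparam _ _ _ _ _ _ F hγ]
  have hadd : reparamField (X + Y) γ = reparamField X γ + reparamField Y γ := rfl
  have h := hq (X + Y)
  simp only [hadd, map_add, LinearMap.add_apply] at h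
  have h1 := hq X
  have h2 := hq Y
  rw [flagForm_comm _ _ _ _ _ _ _ _ (reparamField Y γ), flagForm_comm _ _ _ _ _ _ _ _ Y X] at h
  rw [norForm_mk, norForm_mk]
  linarith

end CurveReparam

end FlagShape

end

open FlagShape in
theorem theorem2 (a₁ a₂ b₁ b₂ c₁ c₂ : ℝ) :
    ∃ 𝒢 : (F : PreShape) → LinearMap.BilinForm ℝ (Nor F),
      -- the pulled back gauge invariant elastic metric, with the split parameter
      (∀ F : PreShape, (𝒢 F).IsSymm) ∧
      (∀ (F : PreShape) (X : Field), 𝒢 F (Nor.mk F X) (Nor.mk F X) =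
        splitPullbackElastic a₁ b₁ c₁ (a₂ / 2) (b₂ / 4) c₂ F X) ∧
      (b₁ = c₁ → ∀ (F : PreShape) (X : Field), 𝒢 F (Nor.mk F X) (Nor.mk F X) =
        pullbackElastic a₁ b₁ (a₂ / 2) (b₂ / 4) c₂ F X) ∧
      -- invariance under reparametrizations
      (∀ (F : PreShape) (γ : DiffS2), IsReparam γ → ∀ X Y : Field,
        𝒢 (F.reparam γ) (Nor.mk _ (reparamField X γ)) (Nor.mk _ (reparamField Y γ)) =
          𝒢 F (Nor.mk F X) (Nor.mk F Y)) ∧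
      -- smoothness, along smooth paths in the tangent bundle
      (∀ (F : ℝ → PreShape) (X : ℝ → Field),
        ContMDiff (𝓘(ℝ, ℝ).prod (𝓡 2)) 𝓘(ℝ, E3) ∞ (fun q : ℝ × S2 => F q.1 q.2) →
        ContMDiff (𝓘(ℝ, ℝ).prod (𝓡 2)) 𝓘(ℝ, E3) ∞ (fun q : ℝ × S2 => X q.1 q.2) →
        ContDiff ℝ ∞ (fun s => 𝒢 (F s) (Nor.mk (F s) (X s)) (Nor.mk (F s) (X s)))) ∧
      -- the geometric expression
      (∀ (F : PreShape) (X : Field), 𝒢 F (Nor.mk F X) (Nor.mk F X) =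
        geometricForm a₁ a₂ b₁ b₂ c₁ c₂ F (h1 F X) (h2 F X)) ∧
      -- every pair of smooth functions occurs
      (∀ (F : PreShape) (u : ContMDiffMap (𝓡 1) 𝓘(ℝ, ℝ) Circle ℝ ∞)
        (v : ContMDiffMap (𝓡 2) 𝓘(ℝ, ℝ) S2 ℝ ∞),
        ∃ X : Field, h1 F X = u ∧ h2 F X = v) ∧
      -- positivity, with the exact null space
      (0 < a₁ → 0 < a₂ → 0 < b₁ → 0 < b₂ → 0 < c₁ → 0 < c₂ →
        ∀ (F : PreShape) (X : Field),
          0 ≤ 𝒢 F (Nor.mk F X) (Nor.mk F X) ∧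
          (𝒢 F (Nor.mk F X) (Nor.mk F X) = 0 ↔
            Nor.mk F X = 0 ∨
              ((∃ m : E3, ∀ z, darbouxN F z = m) ∧ (∃ c : ℝ, ∀ z, h1 F X z = c) ∧
                ∀ p, h2 F X p = 0))) := by
  refine ⟨norForm a₁ a₂ b₁ b₂ c₁ c₂, norForm_isSymm _ _ _ _ _ _, fun F X => ?_,
    fun hbc F X => ?_, fun F γ hγ X Y => norForm_reparam _ _ _ _ _ _ F hγ X Y,
    fun F X hF hX => ?_, norForm_self _ _ _ _ _ _, fun F u v => F.immersed.exists_field u v,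
    fun ha₁ ha₂ hb₁ hb₂ hc₁ hc₂ F X => ⟨?_, ?_⟩⟩
  · rw [norForm_self, F.immersed.splitPullbackElastic_eq X.smooth]
  · subst hbc
    rw [norForm_self, F.immersed.pullbackElastic_eq X.smooth,
      F.immersed.splitPullbackElastic_eq X.smooth]
  · have hFam : ImmersedFam fun s => (F s : S2 → E3) :=
      ⟨smoothFam_of_contMDiff hF, fun s => (F s).immersed.ne_zero⟩
    simp only [norForm_self]
    exact hFam.contDiff_geometricForm (smoothFam_of_contMDiff hX) _ _ _ _ _ _
  · rw [norForm_self]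
    exact geometricForm_nonneg F.immersed ha₁.le ha₂.le hb₁.le hb₂.le hc₁.le hc₂.le _ _
  · rw [norForm_self]
    exact geometricForm_eq_zero_iff F X ha₁ ha₂ hb₁ hb₂ hc₁ hc₂
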